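/- Let $G$ be a finite simple graph with a fixed planar embedding. A graph is biconnected if it has at least three vertices, is connected, and remains connected after the deletion of any single vertex. The plane graph $G$ is inner-chordal if every cycle $C$ of length at least $4$ has a chord (an edge of $G$ that is not on $C$ and joins two vertices of $C$) that is embedded in the bounded region of $\mathbb{R}^2\setminus C$. A chord of the plane graph $G$ is an edge that is not incident to the outer face but whose two endpoints are incident to the outer face. An outside-obstacle orientation of $G$ is an orientation of all chords of $G$ such that (i) every vertex has in-degree at most $2$ and (ii) if a vertex has in-degree $2$, then its two incoming chords share a face (that is, some face of $G$ is incident to both). A plane outside-obstacle representation of a graph is an assignment of distinct points of the plane, no three of them collinear, to its vertices such that the straight-line drawing of the graph is free of crossings and the segment between any two distinct non-adjacent vertices intersects the outer (unbounded) face of the drawing. Theorem. Let $G$ be a biconnected inner-chordal plane graph. Then $G$ admits a plane outside-obstacle representation if and only if $G$ admits an outside-obstacle orientation. The same equivalence holds if the drawing is moreover required to realize the given planar embedding of $G$ (the same counterclockwise order of edges around each vertex and the same outer face). -/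

import Mathlib

open Filter Topology

/-- A finite connected graph with a fixed planar embedding, described combinatorially: a rotation
system `rot`, which sends every dart (directed edge) to the next dart in counterclockwise order
around its tail, such that tracing the faces gives Euler's formula `|V| - |E| + |F| = 2`, together
with a distinguished outer face.

The face to the left of the dart `u → v` is traced by the permutation
`(u → v) ↦ rot⁻¹ (v → u)`, and the faces are the cycles of this permutation. -/
structure PlaneGraph (V : Type*) where
  /-- The underlying simple graph. -/
  graph : SimpleGraph V
  connected : graph.Connected
  /-- The next dart counterclockwise around the tail. -/
  rot : Equiv.Perm graph.Dart
  rot_fst : ∀ d : graph.Dart, (rot d).fst = d.fst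
  /-- All darts with the same tail form a single cycle of the rotation. -/
  rot_sameCycle : ∀ d e : graph.Dart, d.fst = e.fst → rot.SameCycle d e
  /-- Euler's formula (the number of darts is twice the number of edges). -/
  euler : 2 * Nat.card V +
      2 * Nat.card (Quotient (Equiv.Perm.SameCycle.setoid
        (SimpleGraph.Dart.symm_involutive.toPerm.trans rot⁻¹ : Equiv.Perm graph.Dart))) =
    Nat.card graph.Dart + 4
  /-- The outer face. -/
  outer : Quotient (Equiv.Perm.SameCycle.setoid
    (SimpleGraph.Dart.symm_involutive.toPerm.trans rot⁻¹ : Equiv.Perm graph.Dart))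

namespace PlaneGraph

variable {V : Type*} (G : PlaneGraph V)

/-- The permutation `(u → v) ↦ rot⁻¹ (v → u)` tracing the faces, each face lying to the left of
its darts. -/
def facePerm : Equiv.Perm G.graph.Dart :=
  SimpleGraph.Dart.symm_involutive.toPerm.trans G.rot⁻¹

/-- The faces of the embedding. -/
def Face : Type _ := Quotient (Equiv.Perm.SameCycle.setoid G.facePerm)

/-- The outer face. -/
def outerFace : G.Face := G.outer

/-- The face to the left of a dart. -/
def leftFace (d : G.graph.Dart) : G.Face :=
  Quotient.mk (Equiv.Perm.SameCycle.setoid G.facePerm) d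

/-- The edge `e` is incident to the face `f`. -/
def EdgeIncident (e : Sym2 V) (f : G.Face) : Prop :=
  ∃ d : G.graph.Dart, d.edge = e ∧ G.leftFace d = f

/-- The vertex `v` is incident to the face `f`. -/
def VertexIncident (v : V) (f : G.Face) : Prop :=
  ∃ d : G.graph.Dart, d.fst = v ∧ G.leftFace d = f

/-- `G` is biconnected: it has at least three vertices, is connected, and stays connected when
any one vertex is deleted. -/
def Biconnected : Prop :=
  3 ≤ Nat.card V ∧ G.graph.Connected ∧ ∀ v : V, (G.graph.induce {v}ᶜ).Connected

/-- The face `f` lies in the unbounded region of the complement of the closed walk `C`: it can be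
reached from the outer face by repeatedly passing from a face to a neighbouring face across an edge
that does not belong to `C`. -/
def FaceOutside {v : V} (C : G.graph.Walk v v) (f : G.Face) : Prop :=
  Relation.ReflTransGen
    (fun f₁ f₂ => ∃ d : G.graph.Dart,
      d.edge ∉ C.edges ∧ G.leftFace d = f₁ ∧ G.leftFace d.symm = f₂)
    G.outerFace f

/-- The plane graph `G` is inner-chordal: every cycle `C` of length at least four has a chord (an
edge of `G` not on `C` joining two vertices of `C`) that is embedded in the bounded region of the
complement of `C`, that is, the two faces at this chord lie in the bounded region. -/
def InnerChordal : Prop :=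
  ∀ (v : V) (C : G.graph.Walk v v), C.IsCycle → 4 ≤ C.length →
    ∃ d : G.graph.Dart, d.fst ∈ C.support ∧ d.snd ∈ C.support ∧ d.edge ∉ C.edges ∧
      ¬ G.FaceOutside C (G.leftFace d) ∧ ¬ G.FaceOutside C (G.leftFace d.symm)

/-- A chord of the plane graph `G`: an edge that is not incident to the outer face, but whose two
endpoints are incident to the outer face. -/
def IsChord (e : Sym2 V) : Prop :=
  e ∈ G.graph.edgeSet ∧ ¬ G.EdgeIncident e G.outerFace ∧
    ∀ v ∈ e, G.VertexIncident v G.outerFace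

/-- `A` is an orientation of the chords of `G`: it consists of exactly one of the two darts of
every chord, and of nothing else. -/
def IsChordOrientation (A : Set G.graph.Dart) : Prop :=
  (∀ d ∈ A, G.IsChord d.edge) ∧ ∀ d : G.graph.Dart, G.IsChord d.edge → (d ∈ A ↔ d.symm ∉ A)

/-- The arcs of `A` directed towards `v`. -/
def incoming (A : Set G.graph.Dart) (v : V) : Set G.graph.Dart :=
  {d | d ∈ A ∧ d.snd = v}

/-- An outside-obstacle orientation: an orientation of the chords such that every vertex has
in-degree at most two and, if a vertex has in-degree two, then its two incoming chords share
a face. -/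
def IsOutsideObstacleOrientation (A : Set G.graph.Dart) : Prop :=
  G.IsChordOrientation A ∧
  (∀ v : V, (G.incoming A v).ncard ≤ 2) ∧
  ∀ v : V, (G.incoming A v).ncard = 2 →
    ∀ d ∈ G.incoming A v, ∀ e ∈ G.incoming A v, d ≠ e →
      ∃ f : G.Face, G.EdgeIncident d.edge f ∧ G.EdgeIncident e.edge f

end PlaneGraph

/-- The point set of the straight-line drawing of `H` with vertex positions `pos`; the Euclidean
plane is identified with `ℂ`. -/
def drawnSet {V : Type*} (H : SimpleGraph V) (pos : V → ℂ) : Set ℂ :=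
  Set.range pos ∪ ⋃ d : H.Dart, segment ℝ (pos d.fst) (pos d.snd)

/-- The outer (unbounded) face of the straight-line drawing of `H` at `pos`. -/
def drawnOuterFace {V : Type*} (H : SimpleGraph V) (pos : V → ℂ) : Set ℂ :=
  {x | x ∉ drawnSet H pos ∧
    ¬ Bornology.IsBounded (connectedComponentIn (drawnSet H pos)ᶜ x)}

/-- The points `pos` form an outside-obstacle representation of `H`: they are distinct and in
general position, and the segment between any two non-adjacent vertices meets the outer face of the
straight-line drawing (the segments of edges belong to the drawing, so they never do). -/
structure IsOutsideObstacleRep {V : Type*} (H : SimpleGraph V) (pos : V → ℂ) : Prop where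
  injective : Function.Injective pos
  general_position : ∀ u v w : V, u ≠ v → u ≠ w → v ≠ w →
    ¬ Collinear ℝ {pos u, pos v, pos w}
  nonedge : ∀ u v : V, u ≠ v → ¬ H.Adj u v →
    (segment ℝ (pos u) (pos v) ∩ drawnOuterFace H pos).Nonempty

/-- The straight-line drawing of `H` at `pos` is free of crossings: distinct edges meet only in
common endpoints. -/
def IsCrossingFree {V : Type*} (H : SimpleGraph V) (pos : V → ℂ) : Prop :=
  ∀ a b c d : V, H.Adj a b → H.Adj c d → s(a, b) ≠ s(c, d) →
    segment ℝ (pos a) (pos b) ∩ segment ℝ (pos c) (pos d) ⊆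
      pos '' (({a, b} : Set V) ∩ {c, d})

/-- A plane outside-obstacle representation. -/
def IsPlaneOutsideObstacleRep {V : Type*} (H : SimpleGraph V) (pos : V → ℂ) : Prop :=
  IsOutsideObstacleRep H pos ∧ IsCrossingFree H pos

/-- The counterclockwise angle in `[0, 2π)` from the direction `a` to the direction `b`. -/
noncomputable def ccwAngle (a b : ℂ) : ℝ :=
  toIcoMod Real.two_pi_pos 0 (Complex.arg (b / a))

namespace PlaneGraph

/-- The straight-line drawing at `pos` realizes the embedding of `G`: around every vertex, the
successor of each dart in the rotation is the next one counterclockwise in the drawing, and a dart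
has the outer face of `G` on its left exactly if the points immediately to the left of the midpoint
of the drawn edge lie in the unbounded face of the drawing. -/
def IsRealizedBy {V : Type*} (G : PlaneGraph V) (pos : V → ℂ) : Prop :=
  (∀ d e : G.graph.Dart, e.fst = d.fst → e ≠ d →
    ccwAngle (pos d.snd - pos d.fst) (pos (G.rot d).snd - pos (G.rot d).fst) ≤
      ccwAngle (pos d.snd - pos d.fst) (pos e.snd - pos e.fst)) ∧
  ∀ d : G.graph.Dart, G.leftFace d = G.outerFace ↔
    ∀ᶠ ε : ℝ in 𝓝[>] 0,
      (pos d.fst + pos d.snd) / 2 + (ε : ℂ) * Complex.I * (pos d.snd - pos d.fst) ∈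
        drawnOuterFace G.graph pos

end PlaneGraph

/-!
# Plane outside-obstacle representations of inner-chordal plane graphs

**The combinatorial side.** A plane graph is a rotation system satisfying Euler's formula. Over the
field with two elements, Euler's formula says that the chain complex of faces, edges and vertices is
exact in the middle (`exists_boundary_eq`, and dually `exists_potential`); this is the form of the
Jordan curve theorem used throughout. It shows that the inner faces of a biconnected inner-chordal
plane graph are triangles (`Biconnected.facePerm_cube`), that a vertex off the outer face has degree
three (`Biconnected.rot_cube`), and that a chord separates the apexes of the two triangles at it
(`Tri.exists_side`). Hence the outer polygon is triangulated by *cells*: a cell is an inner face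
with all corners on the outer face, or the union of the three inner faces around a vertex of degree
three, and any two cells with a common edge are separated by this edge.

**From a representation to an orientation** (`exists_orientation_of_rep`). Let `a b` be a chord with
apexes `x` and `y`. The vertices `x` and `y` are not adjacent, and the segment between them is not
contained in the two triangles at `a b`, since those do not meet the outer face of the drawing. So
the quadrilateral `a x b y` has a reflex corner at `a` or at `b` (`pivot_or_pivot`), and the chord
is directed towards it. Two chords directed towards `a` share a face: otherwise the triangles at one
of them would lie in the angle at `a` that the triangles at the other one leave free. This angle is
smaller than a half-turn, but no such angle contains all triangles at a chord with a reflex corner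
at `a` (`tri_or_of_pivot`). If three chords were directed towards `a`, then they would pairwise
share a face, the three triangles between them would close up around `a`, and `a` would not be on
the outer face (`not_out_of_cyclic`).

**From an orientation to a representation** (`exists_rep_of_orientation`). The cells are drawn one
at a time. Suppose that a cell is to be attached at the boundary edge `r s` of the region drawn so
far, where the chord `r s` is directed towards `r`. Its new corner `y` is placed very close to `r`,
such that the line through `r` and `y` separates `s` from all other neighbours of `r` drawn so far;
the positions with this property form the `cone` at `r`. The triangle `r s y` is so thin that it
overlaps no old cell and destroys no visibility. The new corner `y` sees every vertex `v` of the
region other than `r` and `s`, because `r` saw `v`, or because `v` is a neighbour of `r`, and then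
the segment from `y` to `v` starts on the free side of the line through `r` and `y`
(`IsDrawing.exists_extend`). A vertex of degree three in the new cell is placed close to `y` and
behaves in the same way.

It remains to see that the cone is never empty. The region is kept convex at every vertex `u`
towards which no chord inside the region is directed, and at a convex corner a cell can be attached
at either of the two boundary edges. Attaching a cell at a chord directed towards `u` may destroy
convexity at `u`, but at most one further chord is directed towards `u`, and it shares a face with
the first one. So it joins `u` to the new corner, or it belongs to the cell that was the only one at
`u` before; in both cases its cone is still not empty (`IsGuided.exists_extend`). Therefore a
maximal guided drawing is a drawing of the whole graph (`IsGuide.exists_isDrawing`). The complement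
of the drawn cells is connected, so it is the outer face of the drawing
(`IsDrawing.drawnOuterFace_eq`), and since all triangles are drawn counterclockwise, the drawing
realizes the given embedding (`IsDrawing.isRealizedBy`).
-/

set_option linter.unusedSectionVars false

/-! ### Homology of a plane graph over the field with two elements -/

section Homology

open Matrix Module

theorem Matrix.card_le_rank_add_one {Z W : Type*} [Fintype Z] [Fintype W] [Nonempty Z]
    (Q : Matrix W Z (ZMod 2)) (hQ : ∀ φ : Z → ZMod 2, Q *ᵥ φ = 0 → ∀ y y', φ y = φ y') :
    Fintype.card Z ≤ Q.rank + 1 := by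
  classical
  have h1 := LinearMap.finrank_range_add_finrank_ker Q.mulVecLin
  have h2 : LinearMap.ker Q.mulVecLin ≤ Submodule.span (ZMod 2) {fun _ : Z => (1 : ZMod 2)} := by
    intro φ hφ
    obtain ⟨z₀⟩ := ‹Nonempty Z›
    rw [Submodule.mem_span_singleton]
    refine ⟨φ z₀, ?_⟩
    funext z
    simpa using hQ φ (by simpa using hφ) z₀ z
  have h3 := Submodule.finrank_mono h2
  have h4 := finrank_span_le_card (R := ZMod 2) ({fun _ : Z => (1 : ZMod 2)} : Set (Z → ZMod 2))
  rw [Module.finrank_fintype_fun_eq_card] at h1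
  simp only [Set.toFinset_singleton, Finset.card_singleton] at h4
  have h5 : Q.rank = finrank (ZMod 2) (LinearMap.range Q.mulVecLin) := rfl
  omega

/-- If two incidence matrices compose to zero, have only the constant functions as cocycles and
satisfy Euler's formula, then the sequence they form is exact. -/
theorem Matrix.exists_mulVec_eq_of_euler {X E Y : Type*} [Fintype X] [Fintype E] [Fintype Y]
    [Nonempty X] [Nonempty Y]
    (M : Matrix X E (ZMod 2)) (N : Matrix E Y (ZMod 2)) (hMN : M * N = 0)
    (hM : ∀ h : X → ZMod 2, Mᵀ *ᵥ h = 0 → ∀ x x', h x = h x')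
    (hN : ∀ φ : Y → ZMod 2, N *ᵥ φ = 0 → ∀ y y', φ y = φ y')
    (hcard : Fintype.card X + Fintype.card Y = Fintype.card E + 2)
    (c : E → ZMod 2) (hc : M *ᵥ c = 0) : ∃ φ : Y → ZMod 2, N *ᵥ φ = c := by
  classical
  have hX := Matrix.card_le_rank_add_one Mᵀ hM
  have hY := Matrix.card_le_rank_add_one N hN
  rw [Matrix.rank_transpose] at hX
  have h1 := LinearMap.finrank_range_add_finrank_ker M.mulVecLin
  rw [Module.finrank_fintype_fun_eq_card] at h1
  have hle : LinearMap.range N.mulVecLin ≤ LinearMap.ker M.mulVecLin := by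
    rintro _ ⟨φ, rfl⟩
    simp [Matrix.mulVec_mulVec, hMN]
  have h5 : M.rank = finrank (ZMod 2) (LinearMap.range M.mulVecLin) := rfl
  have h6 : N.rank = finrank (ZMod 2) (LinearMap.range N.mulVecLin) := rfl
  have heq := Submodule.eq_of_le_of_finrank_le hle (by omega)
  have : c ∈ LinearMap.ker M.mulVecLin := by simpa using hc
  rw [← heq] at this
  obtain ⟨φ, hφ⟩ := this
  exact ⟨φ, by simpa using hφ⟩

end Homology

namespace PlaneGraph

variable {V : Type*} (G : PlaneGraph V)

theorem facePerm_apply (d : G.graph.Dart) : G.facePerm d = G.rot⁻¹ d.symm := rfl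

theorem rot_rot_inv (d : G.graph.Dart) : G.rot (G.rot⁻¹ d) = d := G.rot.apply_symm_apply d

theorem rot_inv_rot (d : G.graph.Dart) : G.rot⁻¹ (G.rot d) = d := G.rot.symm_apply_apply d

theorem facePerm_fst (d : G.graph.Dart) : (G.facePerm d).fst = d.snd := by
  rw [facePerm_apply]
  have := G.rot_fst (G.rot⁻¹ d.symm)
  rw [rot_rot_inv] at this
  exact this.symm

theorem rot_facePerm (d : G.graph.Dart) : G.rot (G.facePerm d) = d.symm := by
  rw [facePerm_apply, rot_rot_inv]

theorem leftFace_facePerm (d : G.graph.Dart) : G.leftFace (G.facePerm d) = G.leftFace d :=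
  Quotient.sound (Equiv.Perm.SameCycle.refl G.facePerm d).apply_left

theorem leftFace_symm (d : G.graph.Dart) : G.leftFace d.symm = G.leftFace (G.rot⁻¹ d) := by
  have := G.leftFace_facePerm d.symm
  rw [facePerm_apply, SimpleGraph.Dart.symm_symm] at this
  exact this.symm

theorem leftFace_rot_symm (d : G.graph.Dart) : G.leftFace (G.rot d).symm = G.leftFace d := by
  rw [leftFace_symm, rot_inv_rot]

theorem exists_leftFace (f : G.Face) : ∃ d, G.leftFace d = f := by
  induction f using Quotient.inductionOn with
  | h d => exact ⟨d, rfl⟩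

theorem rot_pow_fst (n : ℕ) (d : G.graph.Dart) : ((G.rot ^ n) d).fst = d.fst := by
  induction n with
  | zero => rfl
  | succ n ih => rw [pow_succ', Equiv.Perm.mul_apply, rot_fst, ih]

theorem leftFace_facePerm_pow (n : ℕ) (d : G.graph.Dart) :
    G.leftFace ((G.facePerm ^ n) d) = G.leftFace d := by
  induction n with
  | zero => rfl
  | succ n ih => rw [pow_succ', Equiv.Perm.mul_apply, leftFace_facePerm, ih]

variable [Finite V]

instance : Finite G.graph.Dart :=
  Finite.of_injective _ SimpleGraph.Dart.toProd_injective

instance : Finite G.Face := Finite.of_surjective G.leftFace G.exists_leftFace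

theorem exists_rot_pow {d e : G.graph.Dart} (h : d.fst = e.fst) : ∃ n : ℕ, (G.rot ^ n) d = e :=
  let ⟨n, _, hn⟩ := (G.rot_sameCycle d e h).exists_pow_eq'
  ⟨n, hn⟩

theorem exists_facePerm_pow {d e : G.graph.Dart} (h : G.leftFace d = G.leftFace e) :
    ∃ n : ℕ, (G.facePerm ^ n) d = e := by
  have : G.facePerm.SameCycle d e := Quotient.exact h
  obtain ⟨n, _, hn⟩ := this.exists_pow_eq'
  exact ⟨n, hn⟩

/-- A vertex function that agrees on the two ends of every edge is constant. -/
theorem eq_of_forall_dart {α : Type*} (h : V → α) (hh : ∀ d : G.graph.Dart, h d.fst = h d.snd)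
    (u v : V) : h u = h v := by
  obtain ⟨p⟩ := G.connected.preconnected u v
  induction p with
  | nil => rfl
  | cons hadj _ ih => exact (hh ⟨(_, _), hadj⟩).trans ih

/-- A face function that agrees on the two sides of every edge is constant. -/
theorem eq_of_forall_leftFace {α : Type*} (φ : G.Face → α)
    (hφ : ∀ d : G.graph.Dart, φ (G.leftFace d) = φ (G.leftFace d.symm)) (f g : G.Face) :
    φ f = φ g := by
  have hrot : ∀ d, φ (G.leftFace (G.rot d)) = φ (G.leftFace d) := fun d => by
    rw [hφ, leftFace_rot_symm]
  have hpow : ∀ n d, φ (G.leftFace ((G.rot ^ n) d)) = φ (G.leftFace d) := fun n d => by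
    induction n with
    | zero => rfl
    | succ n ih => rw [pow_succ', Equiv.Perm.mul_apply, hrot, ih]
  have hv : ∀ d e : G.graph.Dart, d.fst = e.fst → φ (G.leftFace d) = φ (G.leftFace e) := by
    intro d e h
    obtain ⟨n, rfl⟩ := G.exists_rot_pow h
    rw [hpow]
  obtain ⟨d, rfl⟩ := G.exists_leftFace f
  obtain ⟨e, rfl⟩ := G.exists_leftFace g
  obtain ⟨p⟩ := G.connected.preconnected d.fst e.fst
  generalize hu : d.fst = u at p
  generalize hw : e.fst = w at p
  induction p generalizing d with
  | nil => exact hv _ _ (hu.trans hw.symm)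
  | @cons u v w hadj _ ih =>
    have h1 := hv d ⟨(u, v), hadj⟩ hu
    rw [h1, hφ]
    exact ih _ rfl hw

open scoped Classical in
theorem sum_filter_edge [Fintype G.graph.Dart] {R : Type*} [AddCommMonoid R]
    (F : G.graph.Dart → R) (d : G.graph.Dart) :
    ∑ d' : G.graph.Dart, (if d'.edge = d.edge then F d' else 0) = F d + F d.symm := by
  have : ∀ d' : G.graph.Dart, (if d'.edge = d.edge then F d' else 0) =
      (if d' = d then F d else 0) + (if d' = d.symm then F d.symm else 0) := by
    intro d'
    simp only [SimpleGraph.dart_edge_eq_iff]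
    by_cases h1 : d' = d
    · subst h1
      simp [(SimpleGraph.Dart.symm_ne d').symm]
    · by_cases h2 : d' = d.symm
      · subst h2; simp [SimpleGraph.Dart.symm_ne]
      · simp [h1, h2]
  simp_rw [this, Finset.sum_add_distrib]
  simp

section

open scoped Classical

open Matrix

/-- The incidence matrix between edges and the values of a map on darts, modulo two. -/
noncomputable def incid [Fintype G.graph.Dart] {X : Type*} (p : G.graph.Dart → X) :
    Matrix X G.graph.edgeSet (ZMod 2) :=
  fun x e => ∑ d : G.graph.Dart, if d.edge = e then (if p d = x then 1 else 0) else 0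

/-- Euler's formula, with the number of edges in place of half the number of darts. -/
theorem card_vertex_add_card_face [Fintype V] [Fintype G.Face] [Fintype G.graph.edgeSet] :
    Fintype.card V + Fintype.card G.Face = Fintype.card G.graph.edgeSet + 2 := by
  have h1 := G.euler
  have h2 : Nat.card G.graph.Dart = 2 * Fintype.card G.graph.edgeSet := by
    have := SimpleGraph.dart_card_eq_twice_card_edges (G := G.graph)
    rw [← Nat.card_eq_fintype_card, SimpleGraph.edgeFinset, Set.toFinset_card] at this
    convert this
  have h3 : Nat.card (Quotient (Equiv.Perm.SameCycle.setoid
        (SimpleGraph.Dart.symm_involutive.toPerm.trans G.rot⁻¹ : Equiv.Perm G.graph.Dart))) =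
      Fintype.card G.Face := Nat.card_eq_fintype_card (α := G.Face)
  rw [h2, h3, Nat.card_eq_fintype_card] at h1
  omega

variable [Fintype G.graph.Dart]

theorem incid_transpose_mulVec [Fintype G.graph.edgeSet] {X : Type*} [Fintype X] (p : G.graph.Dart → X) (h : X → ZMod 2)
    (d : G.graph.Dart) :
    ((G.incid p)ᵀ *ᵥ h) ⟨d.edge, d.edge_mem⟩ = h (p d) + h (p d.symm) := by
  simp only [Matrix.mulVec, dotProduct, Matrix.transpose_apply, incid, Finset.sum_mul]
  rw [Finset.sum_comm]
  rw [← G.sum_filter_edge (fun d => h (p d))]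
  refine Finset.sum_congr rfl fun d' _ => ?_
  split_ifs with hd <;> simp

theorem incid_mulVec [Fintype G.graph.edgeSet] {X : Type*} [Fintype X] (p : G.graph.Dart → X)
    (c : G.graph.edgeSet → ZMod 2) (x : X) :
    (G.incid p *ᵥ c) x =
      ∑ d : G.graph.Dart, if p d = x then c ⟨d.edge, d.edge_mem⟩ else 0 := by
  simp only [Matrix.mulVec, dotProduct, incid, Finset.sum_mul]
  rw [Finset.sum_comm]
  refine Finset.sum_congr rfl fun d' _ => ?_
  rw [Finset.sum_eq_single ⟨d'.edge, d'.edge_mem⟩]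
  · simp
  · intro e _ he
    rw [if_neg (fun h => he (Subtype.ext h.symm)), zero_mul]
  · simp

theorem incid_mul_incid [Fintype V] [Fintype G.graph.edgeSet] [Fintype G.Face] :
    G.incid (fun d => d.fst) * (G.incid G.leftFace)ᵀ = 0 := by
  apply Matrix.toLin'.injective
  rw [map_zero]
  refine LinearMap.ext fun φ => ?_
  rw [Matrix.toLin'_mul, LinearMap.comp_apply, Matrix.toLin'_apply, Matrix.toLin'_apply]
  funext v
  rw [incid_mulVec]
  simp_rw [incid_transpose_mulVec]
  rw [LinearMap.zero_apply, Pi.zero_apply]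
  have : ∀ d : G.graph.Dart, (if d.fst = v then φ (G.leftFace d) + φ (G.leftFace d.symm) else 0) =
      (if d.fst = v then φ (G.leftFace d) else 0) +
      (if d.fst = v then φ (G.leftFace d.symm) else 0) := by
    intro d; split_ifs <;> simp
  simp_rw [this, Finset.sum_add_distrib]
  -- the second sum is the first one, reindexed by the rotation
  rw [← Equiv.sum_comp G.rot (fun d => if d.fst = v then φ (G.leftFace d.symm) else 0)]
  simp_rw [rot_fst, leftFace_rot_symm]
  exact CharTwo.add_self_eq_zero _

/-- The combinatorial Jordan curve theorem: an edge set with even degree at every vertex is the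
boundary of a set of faces. -/
theorem exists_boundary_eq (c : Sym2 V → ZMod 2)
    (hc : ∀ v, ∑ d : G.graph.Dart, (if d.fst = v then c d.edge else 0) = 0) :
    ∃ φ : G.Face → ZMod 2, ∀ d : G.graph.Dart,
      φ (G.leftFace d) + φ (G.leftFace d.symm) = c d.edge := by
  let _ := Fintype.ofFinite V
  let _ := Fintype.ofFinite G.Face
  let _ := Fintype.ofFinite G.graph.edgeSet
  have : Nonempty V := G.connected.nonempty
  have : Nonempty G.Face := ⟨G.outerFace⟩
  obtain ⟨φ, hφ⟩ := Matrix.exists_mulVec_eq_of_euler (G.incid fun d => d.fst)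
    (G.incid G.leftFace)ᵀ G.incid_mul_incid
    (fun h hh => G.eq_of_forall_dart h fun d => by
      have := congrFun hh ⟨d.edge, d.edge_mem⟩
      rw [incid_transpose_mulVec] at this
      exact CharTwo.add_eq_zero.1 this)
    (fun φ hh => G.eq_of_forall_leftFace φ fun d => by
      have := congrFun hh ⟨d.edge, d.edge_mem⟩
      rw [incid_transpose_mulVec] at this
      exact CharTwo.add_eq_zero.1 this)
    G.card_vertex_add_card_face (fun e => c e) (by
      funext v
      rw [incid_mulVec]
      exact hc v)
  exact ⟨φ, fun d => by rw [← incid_transpose_mulVec, hφ]⟩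

/-- The dual of `exists_boundary_eq`: an edge set that meets every face boundary evenly is a cut. -/
theorem exists_potential (c : Sym2 V → ZMod 2)
    (hc : ∀ f, ∑ d : G.graph.Dart, (if G.leftFace d = f then c d.edge else 0) = 0) :
    ∃ h : V → ZMod 2, ∀ d : G.graph.Dart, h d.fst + h d.snd = c d.edge := by
  let _ := Fintype.ofFinite V
  let _ := Fintype.ofFinite G.Face
  let _ := Fintype.ofFinite G.graph.edgeSet
  have : Nonempty V := G.connected.nonempty
  have : Nonempty G.Face := ⟨G.outerFace⟩
  obtain ⟨φ, hφ⟩ := Matrix.exists_mulVec_eq_of_euler (G.incid G.leftFace)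
    (G.incid fun d => d.fst)ᵀ
    (by rw [← Matrix.transpose_transpose (G.incid G.leftFace), ← Matrix.transpose_mul,
      incid_mul_incid, Matrix.transpose_zero])
    (fun φ hh => G.eq_of_forall_leftFace φ fun d => by
      have := congrFun hh ⟨d.edge, d.edge_mem⟩
      rw [incid_transpose_mulVec] at this
      exact CharTwo.add_eq_zero.1 this)
    (fun h hh => G.eq_of_forall_dart h fun d => by
      have := congrFun hh ⟨d.edge, d.edge_mem⟩
      rw [incid_transpose_mulVec] at this
      exact CharTwo.add_eq_zero.1 this)
    (by rw [add_comm]; exact G.card_vertex_add_card_face) (fun e => c e) (by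
      funext v
      rw [incid_mulVec]
      exact hc v)
  exact ⟨φ, fun d => by
    have := incid_transpose_mulVec G (fun d => d.fst) φ d
    rw [hφ] at this
    exact this.symm⟩

end

end PlaneGraph

/-! ### Faces of a biconnected plane graph -/

namespace PlaneGraph

variable {V : Type*} (G : PlaneGraph V) [Finite V]

theorem edge_eq_edge_iff {d e : G.graph.Dart} (h : d.fst = e.fst) : d.edge = e.edge ↔ d = e := by
  rw [SimpleGraph.dart_edge_eq_iff]
  refine ⟨?_, Or.inl⟩
  rintro (rfl | rfl)
  · rfl
  · exact absurd h.symm (SimpleGraph.Dart.fst_ne_snd e)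

/-- A function on the vertices other than `v` that is constant along edges is constant. -/
theorem Biconnected.eq_of_forall_dart {G : PlaneGraph V} (hbi : G.Biconnected) {α : Type*} (v : V)
    (h : V → α) (hh : ∀ d : G.graph.Dart, d.fst ≠ v → d.snd ≠ v → h d.fst = h d.snd)
    {u w : V} (hu : u ≠ v) (hw : w ≠ v) : h u = h w := by
  obtain ⟨p⟩ := (hbi.2.2 v).preconnected ⟨u, hu⟩ ⟨w, hw⟩
  have key : ∀ (a b : ({v}ᶜ : Set V)), (G.graph.induce {v}ᶜ).Walk a b → h a = h b := by
    intro a b p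
    induction p with
    | nil => rfl
    | @cons a b c hadj _ ih =>
      exact (hh ⟨(a.1, b.1), hadj⟩ a.2 b.2).trans ih
  exact key _ _ p

theorem Biconnected.rot_ne {G : PlaneGraph V} (hbi : G.Biconnected) (d : G.graph.Dart) :
    G.rot d ≠ d := by
  intro h
  have hpow : ∀ n : ℕ, (G.rot ^ n) d = d := fun n => by
    induction n with
    | zero => rfl
    | succ n ih => rw [pow_succ', Equiv.Perm.mul_apply, ih, h]
  have hall : ∀ e : G.graph.Dart, e.fst = d.fst → e = d := fun e he => by
    obtain ⟨n, rfl⟩ := G.exists_rot_pow he.symm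
    exact hpow n
  obtain ⟨w, hw1, hw2⟩ : ∃ w, w ≠ d.fst ∧ w ≠ d.snd := by
    by_contra hcon
    push Not at hcon
    have h3 := hbi.1
    have hsub : (Set.univ : Set V) ⊆ {d.fst, d.snd} := fun w _ => by
      by_cases h1 : w = d.fst
      · exact Or.inl h1
      · exact Or.inr (hcon w h1)
    have := Set.ncard_le_ncard hsub (Set.toFinite _)
    rw [Set.ncard_univ] at this
    have := Set.ncard_insert_le d.fst {d.snd}
    rw [Set.ncard_singleton] at this
    omega
  have := hbi.eq_of_forall_dart d.snd (fun x => x = d.fst) (fun e he1 he2 => by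
    refine propext ⟨fun h1 => ?_, fun h1 => ?_⟩
    · have := hall e h1
      rw [this] at he2
      exact absurd rfl he2
    · have := hall e.symm h1
      rw [← this] at he1
      exact absurd rfl he1) d.fst_ne_snd hw2
  simp [hw1] at this

theorem CharTwo.sum_range_add_succ (g : ℕ → ZMod 2) (k : ℕ) :
    ∑ i ∈ Finset.range k, (g (i + 1) + g i) = g k + g 0 := by
  have := Finset.sum_range_sub g k
  simpa only [CharTwo.sub_eq_add] using this

open scoped Classical in
/-- In a biconnected plane graph every face visits every vertex at most once. If a face had two
corners at `v`, then a closed curve inside the face through these corners would separate the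
neighbours of `v` without meeting the graph outside `v`; the darts at `v` on one side of this curve
form the edge set to which `exists_potential` is applied. -/
theorem Biconnected.eq_of_leftFace_eq {G : PlaneGraph V} (hbi : G.Biconnected)
    {d e : G.graph.Dart} (h : d.fst = e.fst) (hf : G.leftFace d = G.leftFace e) : d = e := by
  by_contra hne
  let _ := Fintype.ofFinite G.graph.Dart
  have hex := G.exists_rot_pow h
  set k := Nat.find hex with hk
  have hke : (G.rot ^ k) d = e := Nat.find_spec hex
  have hmin : ∀ j < k, (G.rot ^ j) d ≠ e := fun j hj => Nat.find_min hex hj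
  have hk0 : 0 < k := by
    rcases Nat.eq_zero_or_pos k with h0 | h0
    · rw [h0] at hke
      exact absurd hke hne
    · exact h0
  have hmind : ∀ j, 0 < j → j ≤ k → (G.rot ^ j) d ≠ d := by
    intro j hj0 hjk hjd
    apply hmin (k - j) (by omega)
    rw [← hke]
    conv_rhs => rw [show k = (k - j) + j by omega, pow_add, Equiv.Perm.mul_apply, hjd]
  let c : Sym2 V → ZMod 2 := fun ε =>
    ∑ i ∈ Finset.range k, if ε = ((G.rot ^ (i + 1)) d).edge then 1 else 0
  obtain ⟨p, hp⟩ := G.exists_potential c (fun f => by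
    have h1 : ∀ x : G.graph.Dart, (if G.leftFace x = f then c x.edge else 0) =
        ∑ i ∈ Finset.range k, if x.edge = ((G.rot ^ (i + 1)) d).edge then
          (if G.leftFace x = f then 1 else 0) else 0 := by
      intro x
      split_ifs
      · rfl
      · simp
    simp_rw [h1]
    rw [Finset.sum_comm]
    simp_rw [G.sum_filter_edge]
    have h2 : ∀ i, (if G.leftFace ((G.rot ^ (i + 1)) d).symm = f then (1 : ZMod 2) else 0) =
        if G.leftFace ((G.rot ^ i) d) = f then 1 else 0 := by
      intro i
      rw [pow_succ', Equiv.Perm.mul_apply, leftFace_rot_symm]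
    simp_rw [h2]
    rw [CharTwo.sum_range_add_succ (fun i => if G.leftFace ((G.rot ^ i) d) = f then 1 else 0)]
    simp only [pow_zero, Equiv.Perm.coe_one, id_eq]
    rw [hke, hf]
    exact CharTwo.add_self_eq_zero _)
  have hconst := fun {u w : V} => hbi.eq_of_forall_dart d.fst p (fun x hx1 hx2 => by
    rw [← CharTwo.add_eq_zero, hp]
    refine Finset.sum_eq_zero fun i _ => if_neg fun hi => ?_
    rcases (SimpleGraph.dart_edge_eq_iff _ _).1 hi with h1 | h1
    · exact hx1 (by rw [h1, G.rot_pow_fst])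
    · exact hx2 (by rw [h1]; exact G.rot_pow_fst _ _)) (u := u) (w := w)
  have hde : c d.edge = c e.edge := by
    rw [← hp, ← hp, ← h, hconst d.fst_ne_snd.symm (by rw [h]; exact e.fst_ne_snd.symm)]
  have hcd : c d.edge = 0 := by
    refine Finset.sum_eq_zero fun i hi => if_neg fun hi' => ?_
    rw [G.edge_eq_edge_iff (G.rot_pow_fst _ _).symm] at hi'
    exact hmind (i + 1) (by omega) (by rw [Finset.mem_range] at hi; omega) hi'.symm
  have hce : c e.edge = 1 := by
    have : ∀ i ∈ Finset.range k, (if e.edge = ((G.rot ^ (i + 1)) d).edge then (1 : ZMod 2) else 0) =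
        if i = k - 1 then 1 else 0 := by
      intro i hi
      rw [Finset.mem_range] at hi
      congr 1
      rw [G.edge_eq_edge_iff (by rw [G.rot_pow_fst, h])]
      refine propext ⟨fun h1 => ?_, fun h1 => ?_⟩
      · by_contra h2
        exact hmin (i + 1) (by omega) h1.symm
      · rw [h1, Nat.sub_add_cancel hk0, hke]
    simp only [c]
    rw [Finset.sum_congr rfl this, Finset.sum_ite_eq', if_pos (by simp; omega)]
  rw [hcd, hce] at hde
  exact zero_ne_one hde

theorem Biconnected.leftFace_ne_symm {G : PlaneGraph V} (hbi : G.Biconnected)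
    (d : G.graph.Dart) : G.leftFace d ≠ G.leftFace d.symm := by
  intro h
  rw [leftFace_symm] at h
  have h1 : (G.rot⁻¹ d).fst = d.fst := by
    have := G.rot_fst (G.rot⁻¹ d)
    rw [rot_rot_inv] at this
    exact this.symm
  have := hbi.eq_of_leftFace_eq h1.symm h
  apply hbi.rot_ne (G.rot⁻¹ d)
  rw [rot_rot_inv]
  exact this

open scoped Classical in
/-- The degree of the dart sum at a vertex, for the edge of a single dart. -/
theorem sum_fst_edge [Fintype G.graph.Dart] (v : V) (y : G.graph.Dart) :
    ∑ x : G.graph.Dart, (if x.fst = v then (if x.edge = y.edge then (1 : ZMod 2) else 0) else 0) =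
      (if y.fst = v then 1 else 0) + (if y.snd = v then 1 else 0) := by
  change _ = (if y.fst = v then 1 else 0) + (if y.symm.fst = v then 1 else 0)
  rw [← G.sum_filter_edge (fun x => if x.fst = v then (1 : ZMod 2) else 0)]
  refine Finset.sum_congr rfl fun x _ => ?_
  split_ifs <;> rfl

open scoped Classical in
/-- The boundary of a set of faces has even degree at every vertex. -/
theorem sum_fst_boundary [Fintype G.graph.Dart] (φ : G.Face → ZMod 2) (v : V) :
    ∑ d : G.graph.Dart, (if d.fst = v then φ (G.leftFace d) + φ (G.leftFace d.symm) else 0) = 0 := by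
  have : ∀ d : G.graph.Dart, (if d.fst = v then φ (G.leftFace d) + φ (G.leftFace d.symm) else 0) =
      (if d.fst = v then φ (G.leftFace d) else 0) +
      (if d.fst = v then φ (G.leftFace d.symm) else 0) := by
    intro d; split_ifs <;> simp
  simp_rw [this, Finset.sum_add_distrib]
  rw [← Equiv.sum_comp G.rot (fun d => if d.fst = v then φ (G.leftFace d.symm) else 0)]
  simp_rw [rot_fst, leftFace_rot_symm]
  exact CharTwo.add_self_eq_zero _

end PlaneGraph

/-! ### Inner faces are triangles and inner vertices have degree three -/

theorem Equiv.Perm.pow_apply_eq_iff_modEq {α : Type*} (p : Equiv.Perm α) (d : α) (i j : ℕ) :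
    (p ^ i) d = (p ^ j) d ↔ i ≡ j [MOD Function.minimalPeriod p d] := by
  wlog h : i ≤ j generalizing i j
  · rw [eq_comm, this j i (by omega)]
    exact ⟨Nat.ModEq.symm, Nat.ModEq.symm⟩
  rw [Nat.modEq_iff_dvd' h, ← Function.isPeriodicPt_iff_minimalPeriod_dvd]
  obtain ⟨k, rfl⟩ := Nat.exists_eq_add_of_le h
  rw [Nat.add_sub_cancel_left, pow_add, Equiv.Perm.mul_apply, (p ^ i).injective.eq_iff,
    Function.IsPeriodicPt, Function.IsFixedPt, ← Equiv.Perm.iterate_eq_pow]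
  exact eq_comm

namespace PlaneGraph

variable {V : Type*} (G : PlaneGraph V)

/-- The darts `w 0, w 1, …` run periodically around a cycle of the graph with `n` vertices. -/
structure IsCyc (w : ℕ → G.graph.Dart) (n : ℕ) : Prop where
  three_le : 3 ≤ n
  snd_eq : ∀ i, (w i).snd = (w (i + 1)).fst
  eq_of_modEq : ∀ i j, i ≡ j [MOD n] → w i = w j
  modEq_of_fst : ∀ i j, (w i).fst = (w j).fst → i ≡ j [MOD n]

variable {G}

theorem IsCyc.ne_symm {w : ℕ → G.graph.Dart} {n : ℕ} (h : G.IsCyc w n) (i j : ℕ) :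
    w i ≠ (w j).symm := by
  intro hij
  have h1 : (w i).fst = (w (j + 1)).fst := by rw [hij, ← h.snd_eq]; rfl
  have h2 : (w (i + 1)).fst = (w j).fst := by rw [← h.snd_eq, hij]; rfl
  have h3 := h.modEq_of_fst _ _ h1
  have h4 := h.modEq_of_fst _ _ h2
  have h5 : j + 1 + 1 ≡ j [MOD n] := (h3.add_right 1).symm.trans h4
  have h6 := (Nat.modEq_iff_dvd' (by omega)).1 h5.symm
  have := Nat.le_of_dvd (by omega) h6
  have := h.three_le
  omega

theorem IsCyc.edge_eq_iff {w : ℕ → G.graph.Dart} {n : ℕ} (h : G.IsCyc w n) (i j : ℕ) :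
    (w i).edge = (w j).edge ↔ i ≡ j [MOD n] := by
  rw [SimpleGraph.dart_edge_eq_iff]
  refine ⟨?_, fun h1 => Or.inl (h.eq_of_modEq _ _ h1)⟩
  rintro (h1 | h1)
  · exact h.modEq_of_fst _ _ (by rw [h1])
  · exact absurd h1 (h.ne_symm i j)

/-- The walk along the first `k` darts of a sequence. -/
def seqWalk (w : ℕ → G.graph.Dart) (hw : ∀ i, (w i).snd = (w (i + 1)).fst) :
    (k : ℕ) → G.graph.Walk (w 0).fst (w k).fst
  | 0 => .nil
  | k + 1 => (seqWalk w hw k).concat (by rw [← hw]; exact (w k).adj)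

theorem support_seqWalk (w : ℕ → G.graph.Dart) (hw : ∀ i, (w i).snd = (w (i + 1)).fst) (k : ℕ) :
    (seqWalk w hw k).support = (List.range (k + 1)).map (fun i => (w i).fst) := by
  induction k with
  | zero => simp [seqWalk]
  | succ k ih =>
    rw [seqWalk, SimpleGraph.Walk.support_concat, ih, List.range_succ (n := k + 1), List.map_append]
    simp

theorem edges_seqWalk (w : ℕ → G.graph.Dart) (hw : ∀ i, (w i).snd = (w (i + 1)).fst) (k : ℕ) :
    (seqWalk w hw k).edges = (List.range k).map (fun i => (w i).edge) := by
  induction k with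
  | zero => simp [seqWalk]
  | succ k ih =>
    rw [seqWalk, SimpleGraph.Walk.edges_concat, ih, List.range_succ (n := k), List.map_append]
    simp [SimpleGraph.Dart.edge, ← hw]

theorem IsCyc.exists_isCycle {w : ℕ → G.graph.Dart} {n : ℕ} (h : G.IsCyc w n) :
    ∃ (v : V) (C : G.graph.Walk v v), C.IsCycle ∧ C.length = n ∧
      (∀ x, x ∈ C.support ↔ ∃ i, x = (w i).fst) ∧ ∀ e, e ∈ C.edges ↔ ∃ i, e = (w i).edge := by
  have h3 := h.three_le
  have h0 : (w n).fst = (w 0).fst := by rw [h.eq_of_modEq n 0 (by simp [Nat.ModEq])]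
  refine ⟨(w 0).fst, (seqWalk w h.snd_eq n).copy rfl h0, ?_, ?_, fun x => ?_, fun e => ?_⟩
  · rw [SimpleGraph.Walk.isCycle_def]
    refine ⟨⟨?_⟩, ?_, ?_⟩
    · rw [SimpleGraph.Walk.edges_copy, edges_seqWalk]
      refine List.Nodup.map_on (fun i hi j hj hij => ?_) List.nodup_range
      rw [List.mem_range] at hi hj
      exact Nat.ModEq.eq_of_lt_of_lt ((h.edge_eq_iff i j).1 hij) hi hj
    · intro hn
      have := congrArg SimpleGraph.Walk.edges hn
      rw [SimpleGraph.Walk.edges_copy, edges_seqWalk, SimpleGraph.Walk.edges_nil,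
        List.map_eq_nil_iff, List.range_eq_nil] at this
      omega
    · rw [SimpleGraph.Walk.support_copy, support_seqWalk, List.range_succ_eq_map]
      rw [List.map_cons, List.tail_cons, List.map_map]
      refine List.Nodup.map_on (fun i hi j hj hij => ?_) List.nodup_range
      rw [List.mem_range] at hi hj
      have := h.modEq_of_fst _ _ hij
      exact Nat.ModEq.eq_of_lt_of_lt (Nat.ModEq.add_right_cancel' 1 this) hi hj
  · have h2 := SimpleGraph.Walk.length_edges (seqWalk w h.snd_eq n)
    rw [edges_seqWalk] at h2
    simpa using h2.symm
  · rw [SimpleGraph.Walk.support_copy, support_seqWalk]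
    simp only [List.mem_map, List.mem_range]
    constructor
    · rintro ⟨i, _, rfl⟩; exact ⟨i, rfl⟩
    · rintro ⟨i, rfl⟩
      exact ⟨i % n, (Nat.mod_lt _ (by omega)).trans (by omega),
        by rw [h.eq_of_modEq (i % n) i (Nat.mod_modEq i n)]⟩
  · rw [SimpleGraph.Walk.edges_copy, edges_seqWalk]
    simp only [List.mem_map, List.mem_range]
    constructor
    · rintro ⟨i, _, rfl⟩; exact ⟨i, rfl⟩
    · rintro ⟨i, rfl⟩
      exact ⟨i % n, (Nat.mod_lt _ (by omega)),
        by rw [h.eq_of_modEq (i % n) i (Nat.mod_modEq i n)]⟩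

variable [Finite V]

/-- If the boundary of a set of faces is contained in a cycle, then it is empty or contains all the
edges of the cycle. -/
theorem IsCyc.boundary_eq {w : ℕ → G.graph.Dart} {n : ℕ} (h : G.IsCyc w n)
    (φ : G.Face → ZMod 2)
    (hφ : ∀ d, φ (G.leftFace d) ≠ φ (G.leftFace d.symm) → ∃ i, d.edge = (w i).edge) (i j : ℕ) :
    φ (G.leftFace (w i)) + φ (G.leftFace (w i).symm) =
      φ (G.leftFace (w j)) + φ (G.leftFace (w j).symm) := by
  classical
  have key : ∀ i, φ (G.leftFace (w i)) + φ (G.leftFace (w i).symm) =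
      φ (G.leftFace (w (i + 1))) + φ (G.leftFace (w (i + 1)).symm) := by
    intro i
    let _ := Fintype.ofFinite G.graph.Dart
    have h1 := G.sum_fst_boundary φ (w (i + 1)).fst
    have h2 : ∀ d : G.graph.Dart,
        (if d.fst = (w (i + 1)).fst then φ (G.leftFace d) + φ (G.leftFace d.symm) else 0) =
        (if d = w (i + 1) then φ (G.leftFace (w (i + 1))) + φ (G.leftFace (w (i + 1)).symm)
          else 0) +
        (if d = (w i).symm then φ (G.leftFace (w i)) + φ (G.leftFace (w i).symm) else 0) := by
      intro d
      by_cases hd1 : d = w (i + 1)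
      · subst hd1
        simp [h.ne_symm (i + 1) i]
      by_cases hd2 : d = (w i).symm
      · subst hd2
        have : (w i).symm.fst = (w (i + 1)).fst := h.snd_eq i
        rw [if_pos this, if_neg hd1, if_pos rfl, zero_add, SimpleGraph.Dart.symm_symm, add_comm]
      rw [if_neg hd1, if_neg hd2, add_zero]
      split_ifs with hd
      · by_contra hne
        obtain ⟨k, hk⟩ := hφ d fun h3 => hne (by rw [h3]; exact CharTwo.add_self_eq_zero _)
        rcases (SimpleGraph.dart_edge_eq_iff _ _).1 hk with hk | hk
        · rw [hk] at hd
          exact hd1 (hk.trans (h.eq_of_modEq _ _ (h.modEq_of_fst _ _ hd)))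
        · have h4 : (w (k + 1)).fst = (w (i + 1)).fst := by rw [← hd, hk, ← h.snd_eq]; rfl
          have h5 := Nat.ModEq.add_right_cancel' 1 (h.modEq_of_fst _ _ h4)
          exact hd2 (hk.trans (by rw [h.eq_of_modEq _ _ h5]))
      · rfl
    simp_rw [h2, Finset.sum_add_distrib] at h1
    simp only [Finset.sum_ite_eq', Finset.mem_univ, if_true] at h1
    exact (CharTwo.add_eq_zero.1 h1).symm
  have h0 : ∀ i, φ (G.leftFace (w i)) + φ (G.leftFace (w i).symm) =
      φ (G.leftFace (w 0)) + φ (G.leftFace (w 0).symm) := by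
    intro i
    induction i with
    | zero => rfl
    | succ i ih => rw [← key, ih]
  rw [h0, h0 j]

/-- In an inner-chordal plane graph, a cycle of length at least four that bounds the set `φ` of
faces has a chord inside this set. -/
theorem IsCyc.exists_chord {w : ℕ → G.graph.Dart} {n : ℕ} (h : G.IsCyc w n) (hch : G.InnerChordal)
    (hn : 4 ≤ n) (φ : G.Face → ZMod 2) (hout : φ G.outerFace = 0)
    (hφ : ∀ d, φ (G.leftFace d) ≠ φ (G.leftFace d.symm) ↔ ∃ i, d.edge = (w i).edge) :
    ∃ d : G.graph.Dart, (∃ i, d.fst = (w i).fst) ∧ (∃ i, d.snd = (w i).fst) ∧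
      (¬ ∃ i, d.edge = (w i).edge) ∧ φ (G.leftFace d) ≠ 0 ∧ φ (G.leftFace d.symm) ≠ 0 := by
  classical
  obtain ⟨v, C, hC, hlen, hsupp, hedges⟩ := h.exists_isCycle
  obtain ⟨d, hd1, hd2, hd3, hd4, hd5⟩ := hch v C hC (by omega)
  rw [hsupp] at hd1 hd2
  rw [hedges] at hd3
  refine ⟨d, hd1, hd2, hd3, ?_⟩
  let χ : G.Face → ZMod 2 := fun f => if G.FaceOutside C f then 1 else 0
  have hχout : χ G.outerFace = 1 := if_pos Relation.ReflTransGen.refl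
  have hχ : ∀ d, χ (G.leftFace d) ≠ χ (G.leftFace d.symm) → ∃ i, d.edge = (w i).edge := by
    intro d hd
    by_contra hcon
    rw [← hedges] at hcon
    apply hd
    have h1 : G.FaceOutside C (G.leftFace d) → G.FaceOutside C (G.leftFace d.symm) :=
      fun h1 => h1.tail ⟨d, hcon, rfl, rfl⟩
    have h2 : G.FaceOutside C (G.leftFace d.symm) → G.FaceOutside C (G.leftFace d) :=
      fun h1 => h1.tail ⟨d.symm, by rwa [SimpleGraph.Dart.edge_symm], rfl, by
        rw [SimpleGraph.Dart.symm_symm]⟩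
    simp only [χ]
    rw [propext ⟨h1, h2⟩]
  have hb := h.boundary_eq χ hχ
  have h01 : ∀ a : ZMod 2, a ≠ 0 → a = 1 := by decide
  have hval : ∀ f, ¬ G.FaceOutside C f → φ f ≠ 0 := by
    by_cases h0 : χ (G.leftFace (w 0)) + χ (G.leftFace (w 0).symm) = 0
    · have hc := G.eq_of_forall_leftFace χ (fun d => by
        by_contra hne
        obtain ⟨i, hi⟩ := hχ d hne
        have hi0 := (hb i 0).trans h0
        rw [CharTwo.add_eq_zero] at hi0
        rcases (SimpleGraph.dart_edge_eq_iff _ _).1 hi with rfl | rfl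
        · exact hne hi0
        · rw [SimpleGraph.Dart.symm_symm] at hne; exact hne hi0.symm)
      intro f hf
      have h2 := hc f G.outerFace
      rw [hχout] at h2
      simp [χ, hf] at h2
    · have hc := G.eq_of_forall_leftFace (fun f => χ f + φ f) (fun d => by
        by_cases hd : ∃ i, d.edge = (w i).edge
        · have h1 : χ (G.leftFace d) + χ (G.leftFace d.symm) = 1 := by
            obtain ⟨i, hi⟩ := hd
            have hi0 := (hb i 0).trans (h01 _ h0)
            rcases (SimpleGraph.dart_edge_eq_iff _ _).1 hi with rfl | rfl
            · exact hi0
            · rw [SimpleGraph.Dart.symm_symm, add_comm]; exact hi0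
          have h2 := (hφ d).2 hd
          revert h1 h2
          generalize χ (G.leftFace d) = a
          generalize χ (G.leftFace d.symm) = b
          generalize φ (G.leftFace d) = a'
          generalize φ (G.leftFace d.symm) = b'
          revert a b a' b'
          decide
        · have h1 : χ (G.leftFace d) = χ (G.leftFace d.symm) := by
            by_contra hne; exact hd (hχ d hne)
          have h2 : φ (G.leftFace d) = φ (G.leftFace d.symm) := by
            by_contra hne; exact hd ((hφ d).1 hne)
          simp only [h1, h2])
      intro f hf hf0
      have h2 := hc f G.outerFace
      simp only [hχout, hout, hf0] at h2
      simp [χ, hf] at h2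
  exact ⟨hval _ hd4, hval _ hd5⟩

/-- In a biconnected plane graph every face is bounded by a cycle. -/
theorem Biconnected.isCyc_face (hbi : G.Biconnected) (d : G.graph.Dart) :
    G.IsCyc (fun i => (G.facePerm ^ i) d) (Function.minimalPeriod G.facePerm d) where
  three_le := by
    by_contra hlt
    have hpos : 0 < Function.minimalPeriod G.facePerm d :=
      Function.minimalPeriod_pos_of_mem_periodicPts
        (Function.Injective.mem_periodicPts G.facePerm.injective d)
    have hp := Function.iterate_minimalPeriod (f := G.facePerm) (x := d)
    have h12 : Function.minimalPeriod G.facePerm d = 1 ∨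
      Function.minimalPeriod G.facePerm d = 2 := by omega
    rcases h12 with h1 | h1
    · rw [h1] at hp
      have := G.facePerm_fst d
      rw [show G.facePerm d = d from hp] at this
      exact d.fst_ne_snd this
    · rw [h1] at hp
      have h2 : G.facePerm (G.facePerm d) = d := hp
      have h3 : (G.facePerm d) = d.symm := by
        apply SimpleGraph.Dart.ext
        refine Prod.ext (G.facePerm_fst d) ?_
        have := G.facePerm_fst (G.facePerm d)
        rw [h2] at this
        exact this.symm
      apply hbi.leftFace_ne_symm d
      rw [← h3, leftFace_facePerm]
  snd_eq i := by
    simp only [pow_succ', Equiv.Perm.mul_apply, facePerm_fst]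
  eq_of_modEq i j hij := (G.facePerm.pow_apply_eq_iff_modEq d i j).2 hij
  modEq_of_fst i j hij := by
    rw [← G.facePerm.pow_apply_eq_iff_modEq]
    exact hbi.eq_of_leftFace_eq hij (by simp only [leftFace_facePerm_pow])

/-- The inner faces are triangles: a chord inside a longer boundary cycle of a face would have this
face on both sides. -/
theorem Biconnected.facePerm_cube (hbi : G.Biconnected) (hch : G.InnerChordal) {d : G.graph.Dart}
    (hd : G.leftFace d ≠ G.outerFace) : G.facePerm (G.facePerm (G.facePerm d)) = d := by
  classical
  have hcyc := hbi.isCyc_face d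
  have h3 := hcyc.three_le
  by_cases h4 : 4 ≤ Function.minimalPeriod G.facePerm d
  · obtain ⟨x, -, -, -, hx4, hx5⟩ := hcyc.exists_chord hch h4
      (fun f => if f = G.leftFace d then 1 else 0) (if_neg hd.symm) (fun y => by
        constructor
        · intro hy
          have : G.leftFace y = G.leftFace d ∨ G.leftFace y.symm = G.leftFace d := by
            by_contra hcon
            push Not at hcon
            simp [hcon.1, hcon.2] at hy
          rcases this with h1 | h1
          · obtain ⟨i, hi⟩ := G.exists_facePerm_pow h1.symm
            exact ⟨i, by rw [← hi]⟩
          · obtain ⟨i, hi⟩ := G.exists_facePerm_pow h1.symm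
            exact ⟨i, by rw [hi, SimpleGraph.Dart.edge_symm]⟩
        · rintro ⟨i, hi⟩
          have h1 := G.leftFace_facePerm_pow i d
          have h2 := hbi.leftFace_ne_symm ((G.facePerm ^ i) d)
          rw [h1] at h2
          rcases (SimpleGraph.dart_edge_eq_iff _ _).1 hi with rfl | rfl
          · simp [h1, h2.symm]
          · simp [h1, h2.symm])
    simp only [ne_eq, ite_eq_right_iff, one_ne_zero, imp_false, not_not] at hx4 hx5
    exact absurd (hx4.trans hx5.symm) (hbi.leftFace_ne_symm x)
  · have h5 : Function.minimalPeriod G.facePerm d = 3 := by omega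
    have hp := Function.iterate_minimalPeriod (f := G.facePerm) (x := d)
    rw [h5] at hp
    exact hp

theorem rot_eq_of_facePerm_cube {d : G.graph.Dart}
    (hd : G.facePerm (G.facePerm (G.facePerm d)) = d) :
    G.rot d = (G.facePerm (G.facePerm d)).symm := by
  conv_lhs => rw [← hd]
  rw [rot_facePerm]

/-- A set of inner faces that is closed under crossing edges to inner faces contains all of them. -/
theorem Biconnected.forall_mem_of_closed (hbi : G.Biconnected) (A : Set G.Face) (hne : A.Nonempty)
    (hout : G.outerFace ∉ A)
    (hA : ∀ d, G.leftFace d ∈ A → G.leftFace d.symm ≠ G.outerFace → G.leftFace d.symm ∈ A)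
    (f : G.Face) (hf : f ≠ G.outerFace) : f ∈ A := by
  classical
  obtain ⟨d₀, hd₀⟩ := G.exists_leftFace G.outerFace
  have hcyc := hbi.isCyc_face d₀
  have hmem : ∀ d, G.leftFace d = G.outerFace → ∃ i, d = (G.facePerm ^ i) d₀ := by
    intro d hd
    obtain ⟨i, hi⟩ := G.exists_facePerm_pow (hd₀.trans hd.symm)
    exact ⟨i, hi.symm⟩
  let χ : G.Face → ZMod 2 := fun f => if f ∈ A then 1 else 0
  have hχ : ∀ d, G.leftFace d ≠ G.outerFace → G.leftFace d.symm ≠ G.outerFace →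
      χ (G.leftFace d) = χ (G.leftFace d.symm) := by
    intro d h1 h2
    have h3 : G.leftFace d.symm ∈ A → G.leftFace d ∈ A := fun h3 => by
      have := hA d.symm h3
      rw [SimpleGraph.Dart.symm_symm] at this
      exact this h1
    simp only [χ]
    rw [propext ⟨fun h3 => hA d h3 h2, h3⟩]
  have hb := hcyc.boundary_eq χ (fun d hd => by
    by_cases h1 : G.leftFace d = G.outerFace
    · obtain ⟨i, hi⟩ := hmem d h1
      exact ⟨i, by rw [hi]⟩
    · by_cases h2 : G.leftFace d.symm = G.outerFace
      · obtain ⟨i, hi⟩ := hmem _ h2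
        exact ⟨i, by rw [← hi, SimpleGraph.Dart.edge_symm]⟩
      · exact absurd (hχ d h1 h2) hd)
  have hχ0 : χ G.outerFace = 0 := if_neg hout
  have hbd : ∀ d, G.leftFace d = G.outerFace →
      χ (G.leftFace d.symm) = χ (G.leftFace d₀.symm) := by
    intro d hd
    obtain ⟨i, hi⟩ := hmem d hd
    have := hb i 0
    simp only [← hi, pow_zero, Equiv.Perm.coe_one, id_eq, hd, hd₀, hχ0, zero_add] at this
    exact this
  have hc := G.eq_of_forall_leftFace
      (fun f => if f = G.outerFace then χ (G.leftFace d₀.symm) else χ f) (fun d => by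
    have hne := hbi.leftFace_ne_symm d
    by_cases h1 : G.leftFace d = G.outerFace
    · rw [if_pos h1, if_neg (by rw [← h1]; exact hne.symm), hbd d h1]
    · by_cases h2 : G.leftFace d.symm = G.outerFace
      · have := hbd d.symm h2
        rw [SimpleGraph.Dart.symm_symm] at this
        rw [if_neg h1, if_pos h2, this]
      · rw [if_neg h1, if_neg h2, hχ d h1 h2])
  obtain ⟨g, hg⟩ := hne
  have h2 := hc f g
  have hgo : g ≠ G.outerFace := fun h => hout (h ▸ hg)
  simp only [if_neg hf, if_neg hgo] at h2
  by_contra hfA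
  simp [χ, hfA, hg] at h2

/-- In an inner-chordal biconnected plane graph, a vertex that is not on the outer face has degree
three: its neighbours form a cycle, whose chords inside would have to be incident to the vertex. -/
theorem Biconnected.rot_cube (hbi : G.Biconnected) (hch : G.InnerChordal) {d : G.graph.Dart}
    (hd : ¬ G.VertexIncident d.fst G.outerFace) : G.rot (G.rot (G.rot d)) = d := by
  classical
  have hin : ∀ x : G.graph.Dart, x.fst = d.fst → G.leftFace x ≠ G.outerFace :=
    fun x hx h => hd ⟨x, hx, h⟩
  set n := Function.minimalPeriod G.rot d with hn
  let r : ℕ → G.graph.Dart := fun i => (G.rot ^ i) d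
  have hr : ∀ i, (r i).fst = d.fst := fun i => G.rot_pow_fst i d
  have hall : ∀ x : G.graph.Dart, x.fst = d.fst → ∃ i, x = r i := fun x hx => by
    obtain ⟨i, hi⟩ := G.exists_rot_pow hx.symm
    exact ⟨i, hi.symm⟩
  let w : ℕ → G.graph.Dart := fun i => G.facePerm (r i)
  have hwfst : ∀ i, (w i).fst = (r i).snd := fun i => G.facePerm_fst _
  have hrs : ∀ i, r (i + 1) = (G.facePerm (w i)).symm := fun i => by
    simp only [r, w, pow_succ', Equiv.Perm.mul_apply]
    exact rot_eq_of_facePerm_cube (hbi.facePerm_cube hch (hin _ (hr i)))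
  have hwsnd : ∀ i, (w i).snd = (w (i + 1)).fst := fun i => by
    rw [hwfst, hrs, ← G.facePerm_fst]; rfl
  have hmod : ∀ i j, (w i).fst = (w j).fst → i ≡ j [MOD n] := fun i j hij => by
    rw [← G.rot.pow_apply_eq_iff_modEq]
    rw [hwfst, hwfst] at hij
    exact SimpleGraph.Dart.ext _ _ (Prod.ext ((hr i).trans (hr j).symm) hij)
  have hwne : ∀ i, (w i).fst ≠ d.fst := fun i => by
    rw [hwfst, ← hr i]; exact (r i).snd_ne_fst
  let B : G.Face → Prop := fun f => ∃ x : G.graph.Dart, x.fst = d.fst ∧ G.leftFace x = f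
  have hBw : ∀ i, B (G.leftFace (w i)) := fun i => ⟨r i, hr i, by rw [leftFace_facePerm]⟩
  have hB : ∀ y : G.graph.Dart, y.fst ≠ d.fst → y.snd ≠ d.fst → B (G.leftFace y) →
      ∃ i, y = w i := by
    rintro y hy1 hy2 ⟨x, hx, hxy⟩
    obtain ⟨i, rfl⟩ := hall x hx
    refine ⟨i, ?_⟩
    obtain ⟨m, hm⟩ := G.exists_facePerm_pow hxy
    have h3 := hbi.facePerm_cube hch (hin _ (hr i))
    have h3' : Function.IsPeriodicPt G.facePerm 3 (r i) := h3
    have h4 : (G.facePerm ^ (m % 3)) (r i) = y := by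
      rw [← hm, ← Equiv.Perm.iterate_eq_pow, ← Equiv.Perm.iterate_eq_pow]
      exact h3'.iterate_mod_apply m
    have : m % 3 = 0 ∨ m % 3 = 1 ∨ m % 3 = 2 := by omega
    rcases this with h5 | h5 | h5
    · rw [h5] at h4
      exact absurd (by rw [← h4]; exact hr i) hy1
    · rw [h5] at h4
      exact h4.symm
    · rw [h5] at h4
      refine absurd ?_ hy2
      rw [← hr i, ← h3, G.facePerm_fst, ← h4]
      rfl
  have hatv : ∀ y : G.graph.Dart, y.fst = d.fst → B (G.leftFace y) ∧ B (G.leftFace y.symm) :=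
    fun y hy => ⟨⟨y, hy, rfl⟩, ⟨G.rot⁻¹ y, by
      rw [← G.rot_fst, rot_rot_inv, hy], (G.leftFace_symm y).symm⟩⟩
  have hatv' : ∀ y : G.graph.Dart, y.snd = d.fst → B (G.leftFace y) ∧ B (G.leftFace y.symm) :=
    fun y hy => by
      have := hatv y.symm hy
      rw [SimpleGraph.Dart.symm_symm] at this
      exact this.symm
  have hBout : ¬ B G.outerFace := hd
  let φ : G.Face → ZMod 2 := fun f => if B f then 1 else 0
  have hpos : 0 < n := Function.minimalPeriod_pos_of_mem_periodicPts
    (Function.Injective.mem_periodicPts G.rot.injective d)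
  have hp : G.rot^[n] d = d := Function.iterate_minimalPeriod
  have hn1 : n ≠ 1 := fun h1 => by
    rw [h1] at hp
    exact hbi.rot_ne d hp
  have hmodw : ∀ i j, i ≡ j [MOD n] → w i = w j := fun i j hij => by
    rw [← G.rot.pow_apply_eq_iff_modEq] at hij
    simp only [w, r, hij]
  have hn2 : n ≠ 2 := fun h2 => by
    have hsw : ∀ i, (w i).symm = w (i + 1) := fun i => by
      apply SimpleGraph.Dart.ext
      refine Prod.ext (hwsnd i) ?_
      rw [hwsnd (i + 1), hmodw (i + 1 + 1) i (by rw [h2, Nat.ModEq]; omega)]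
      rfl
    have hc := G.eq_of_forall_leftFace φ (fun y => by
      by_cases h1 : y.fst = d.fst
      · simp [φ, (hatv y h1).1, (hatv y h1).2]
      by_cases h2 : y.snd = d.fst
      · simp [φ, (hatv' y h2).1, (hatv' y h2).2]
      have h3 : B (G.leftFace y) → B (G.leftFace y.symm) := fun h3 => by
        obtain ⟨i, rfl⟩ := hB y h1 h2 h3
        rw [hsw]
        exact hBw _
      have h4 : B (G.leftFace y.symm) → B (G.leftFace y) := fun h3 => by
        obtain ⟨i, hi⟩ := hB y.symm h2 h1 h3
        rw [← y.symm_symm, hi, hsw]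
        exact hBw _
      simp only [φ]
      rw [propext ⟨h3, h4⟩])
    have h5 := hc (G.leftFace d) G.outerFace
    simp [φ, hBout, (hatv d rfl).1] at h5
  have hcyc : G.IsCyc w n := ⟨by omega, hwsnd, hmodw, hmod⟩
  by_cases h4 : 4 ≤ n
  · obtain ⟨x, ⟨i, hx1⟩, ⟨j, hx2⟩, hx3, hx4, -⟩ := hcyc.exists_chord hch h4 φ (if_neg hBout)
      (fun y => by
        constructor
        · intro hy
          by_cases h1 : y.fst = d.fst
          · simp [φ, (hatv y h1).1, (hatv y h1).2] at hy
          by_cases h2 : y.snd = d.fst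
          · simp [φ, (hatv' y h2).1, (hatv' y h2).2] at hy
          have : B (G.leftFace y) ∨ B (G.leftFace y.symm) := by
            by_contra hcon
            push Not at hcon
            simp [φ, hcon.1, hcon.2] at hy
          rcases this with h3 | h3
          · obtain ⟨i, rfl⟩ := hB y h1 h2 h3
            exact ⟨i, rfl⟩
          · obtain ⟨i, hi⟩ := hB y.symm h2 h1 h3
            exact ⟨i, by rw [← hi, SimpleGraph.Dart.edge_symm]⟩
        · rintro ⟨i, hi⟩
          have h3 : ¬ B (G.leftFace (w i).symm) := fun h3 => by
            obtain ⟨j, hj⟩ := hB (w i).symm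
              (by change (w i).snd ≠ _; rw [hwsnd]; exact hwne _) (hwne i) h3
            exact hcyc.ne_symm j i hj.symm
          rcases (SimpleGraph.dart_edge_eq_iff _ _).1 hi with rfl | rfl
          · simp [φ, h3, hBw i]
          · simp [φ, h3, hBw i])
    have hBx : B (G.leftFace x) := by
      by_contra h; simp [φ, h] at hx4
    obtain ⟨k, rfl⟩ := hB x (by rw [hx1]; exact hwne i) (by rw [hx2]; exact hwne j) hBx
    exact absurd ⟨k, rfl⟩ hx3
  · have h5 : n = 3 := by omega
    rw [h5] at hp
    exact hp

end PlaneGraph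

/-! ### The system of inner triangles -/

namespace PlaneGraph

variable {V : Type*} (G : PlaneGraph V)

/-- The dart `a → b` has an inner face on its left, and `c` follows `a`, `b` on the boundary of this
face. -/
def Tri (a b c : V) : Prop :=
  ∃ d : G.graph.Dart, d.fst = a ∧ d.snd = b ∧ (G.facePerm d).snd = c ∧
    G.leftFace d ≠ G.outerFace

/-- The vertex `v` lies on the outer face. -/
def Out (v : V) : Prop := G.VertexIncident v G.outerFace

variable {G}

theorem Tri.adj {a b c : V} (h : G.Tri a b c) : G.graph.Adj a b := by
  obtain ⟨d, rfl, rfl, -, -⟩ := h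
  exact d.adj

theorem Tri.adj' {a b c : V} (h : G.Tri a b c) : G.graph.Adj b c := by
  obtain ⟨d, rfl, rfl, rfl, -⟩ := h
  rw [← G.facePerm_fst]
  exact (G.facePerm d).adj

theorem dart_ext {d e : G.graph.Dart} (h1 : d.fst = e.fst) (h2 : d.snd = e.snd) : d = e :=
  SimpleGraph.Dart.ext _ _ (Prod.ext h1 h2)

theorem Tri.unique {a b c c' : V} (h : G.Tri a b c) (h' : G.Tri a b c') : c = c' := by
  obtain ⟨d, rfl, rfl, rfl, -⟩ := h
  obtain ⟨e, he1, he2, rfl, -⟩ := h'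
  rw [dart_ext he1 he2]

theorem exists_tri {d : G.graph.Dart} (h : G.leftFace d ≠ G.outerFace) :
    ∃ c, G.Tri d.fst d.snd c := ⟨_, d, rfl, rfl, rfl, h⟩

theorem Tri.leftFace_ne {a b c : V} (h : G.Tri a b c) {d : G.graph.Dart} (h1 : d.fst = a)
    (h2 : d.snd = b) : G.leftFace d ≠ G.outerFace := by
  obtain ⟨e, he1, he2, -, he⟩ := h
  rwa [dart_ext (h1.trans he1.symm) (h2.trans he2.symm)]

variable [Finite V]

theorem Biconnected.exists_tri_or (hbi : G.Biconnected) {a b : V} (h : G.graph.Adj a b) :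
    (∃ c, G.Tri a b c) ∨ ∃ c, G.Tri b a c := by
  by_cases h1 : G.leftFace ⟨(a, b), h⟩ = G.outerFace
  · right
    exact exists_tri (d := ⟨(b, a), h.symm⟩) fun h2 =>
      hbi.leftFace_ne_symm ⟨(a, b), h⟩ (h1.trans h2.symm)
  · exact Or.inl (exists_tri h1)

theorem Biconnected.exists_inner_dart (hbi : G.Biconnected) (v : V) :
    ∃ d : G.graph.Dart, d.fst = v ∧ G.leftFace d ≠ G.outerFace := by
  obtain ⟨w, hw⟩ : ∃ w, w ≠ v := by
    by_contra hcon
    push Not at hcon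
    have : Subsingleton V := ⟨fun a b => (hcon a).trans (hcon b).symm⟩
    have := Finite.card_le_one_iff_subsingleton.2 this
    have := hbi.1
    omega
  obtain ⟨p⟩ := G.connected.preconnected v w
  cases p with
  | nil => exact absurd rfl hw
  | cons hadj _ =>
    let d : G.graph.Dart := ⟨(v, _), hadj⟩
    by_cases h : G.leftFace d = G.outerFace
    · refine ⟨G.rot d, G.rot_fst d, fun h2 => ?_⟩
      exact hbi.rot_ne d (hbi.eq_of_leftFace_eq (G.rot_fst d) (h2.trans h.symm))
    · exact ⟨d, rfl, h⟩

theorem Biconnected.exists_tri (hbi : G.Biconnected) (v : V) : ∃ a b, G.Tri v a b := by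
  obtain ⟨d, rfl, hd⟩ := hbi.exists_inner_dart v
  obtain ⟨c, hc⟩ := PlaneGraph.exists_tri hd
  exact ⟨_, c, hc⟩

section

variable (hbi : G.Biconnected) (hch : G.InnerChordal)

include hbi hch

theorem Tri.rotate {a b c : V} (h : G.Tri a b c) : G.Tri b c a := by
  obtain ⟨d, rfl, rfl, rfl, hd⟩ := h
  refine ⟨G.facePerm d, G.facePerm_fst d, rfl, ?_, by rwa [leftFace_facePerm]⟩
  rw [← G.facePerm_fst, hbi.facePerm_cube hch hd]

theorem Tri.ne {a b c : V} (h : G.Tri a b c) : a ≠ b ∧ b ≠ c ∧ c ≠ a :=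
  ⟨h.adj.ne, h.adj'.ne, (h.rotate hbi hch).adj'.ne⟩

/-- The rotation at the first vertex of an inner triangle. -/
theorem Tri.rot_eq {a b c : V} (h : G.Tri a b c) {d : G.graph.Dart} (h1 : d.fst = a)
    (h2 : d.snd = b) : (G.rot d).snd = c := by
  obtain ⟨e, he1, he2, rfl, he⟩ := h
  have : d = e := dart_ext (h1.trans he1.symm) (h2.trans he2.symm)
  subst this
  rw [rot_eq_of_facePerm_cube (hbi.facePerm_cube hch he)]
  exact G.facePerm_fst _

/-- A dart with the inner triangle `a b c` on its left is one of its three sides. -/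
theorem Tri.eq_of_leftFace_eq {a b c : V} (h : G.Tri a b c) {d e : G.graph.Dart} (h1 : d.fst = a)
    (h2 : d.snd = b) (he : G.leftFace e = G.leftFace d) :
    (e.fst = a ∧ e.snd = b) ∨ (e.fst = b ∧ e.snd = c) ∨ (e.fst = c ∧ e.snd = a) := by
  have hd := h.leftFace_ne h1 h2
  obtain ⟨d', hd1, hd2, hd3, -⟩ := h
  obtain rfl : d = d' := dart_ext (h1.trans hd1.symm) (h2.trans hd2.symm)
  obtain ⟨m, hm⟩ := G.exists_facePerm_pow he.symm
  have h3 := hbi.facePerm_cube hch hd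
  have h3' : Function.IsPeriodicPt G.facePerm 3 d := h3
  have h4 : (G.facePerm ^ (m % 3)) d = e := by
    rw [← hm, ← Equiv.Perm.iterate_eq_pow, ← Equiv.Perm.iterate_eq_pow]
    exact h3'.iterate_mod_apply m
  have : m % 3 = 0 ∨ m % 3 = 1 ∨ m % 3 = 2 := by omega
  rcases this with h5 | h5 | h5 <;> rw [h5] at h4
  · left
    rw [← h4]
    exact ⟨h1, h2⟩
  · right; left
    rw [← h4]
    exact ⟨(G.facePerm_fst _).trans h2, hd3⟩
  · right; right
    rw [← h4]
    refine ⟨(G.facePerm_fst _).trans hd3, ?_⟩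
    have : (G.facePerm (G.facePerm d)).snd = d.fst := by rw [← G.facePerm_fst, h3]
    exact this.trans h1

/-- The three triangles at a vertex that is not on the outer face. -/
theorem Tri.of_not_out {m a b : V} (h : G.Tri m a b) (hm : ¬ G.Out m) :
    ∃ c, G.Tri m b c ∧ G.Tri m c a ∧ ∀ x, G.graph.Adj m x → x = a ∨ x = b ∨ x = c := by
  have h' := h
  obtain ⟨d, rfl, rfl, -, hd⟩ := h'
  have h3 := hbi.rot_cube hch hm
  have hin : ∀ x : G.graph.Dart, x.fst = d.fst → G.leftFace x ≠ G.outerFace :=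
    fun x hx h => hm ⟨x, hx, h⟩
  have e1 : (G.rot d).fst = d.fst := G.rot_fst d
  have e2 : (G.rot (G.rot d)).fst = d.fst := (G.rot_fst _).trans e1
  have hb := h.rot_eq hbi hch rfl rfl
  obtain ⟨c, hc⟩ := PlaneGraph.exists_tri (hin _ e1)
  obtain ⟨a', ha'⟩ := PlaneGraph.exists_tri (hin _ e2)
  have hc' := hc.rot_eq hbi hch rfl rfl
  have hac := ha'.rot_eq hbi hch rfl rfl
  rw [h3] at hac
  rw [e1, hb] at hc
  rw [e2, hc', ← hac] at ha'
  refine ⟨c, hc, ha', fun x hx => ?_⟩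
  obtain ⟨k, hk⟩ := G.exists_rot_pow (d := d) (e := ⟨(d.fst, x), hx⟩) rfl
  have h3' : Function.IsPeriodicPt G.rot 3 d := h3
  have h4 : (G.rot ^ (k % 3)) d = ⟨(d.fst, x), hx⟩ := by
    rw [← hk, ← Equiv.Perm.iterate_eq_pow, ← Equiv.Perm.iterate_eq_pow]
    exact h3'.iterate_mod_apply k
  have : k % 3 = 0 ∨ k % 3 = 1 ∨ k % 3 = 2 := by omega
  rcases this with h5 | h5 | h5 <;> rw [h5] at h4
  · left
    have := congrArg (fun e : G.graph.Dart => e.snd) h4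
    exact this.symm
  · right; left
    have := congrArg (fun e : G.graph.Dart => e.snd) h4
    exact this.symm.trans hb
  · right; right
    have := congrArg (fun e : G.graph.Dart => e.snd) h4
    exact this.symm.trans hc'

/-- If both `m` and its neighbour `y` are off the outer face, then the remaining two neighbours of
`m` form an edge one of whose sides is a triangle with apex `y`. -/
theorem Tri.of_not_out_of_not_out {p q m y : V} (h : G.Tri p q m) (hm : ¬ G.Out m)
    (hy : G.graph.Adj m y) (hyp : y ≠ p) (hyq : y ≠ q) (hyo : ¬ G.Out y) : G.Tri q p y := by
  obtain ⟨c, hc1, hc2, hc3⟩ := ((h.rotate hbi hch).rotate hbi hch).of_not_out hbi hch hm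
  obtain rfl : y = c := by
    rcases hc3 y hy with h1 | h1 | h1
    · exact absurd h1 hyp
    · exact absurd h1 hyq
    · exact h1
  -- the triangles at `y` on the two sides of the edge `y m`
  have h1 : G.Tri y m q := (hc1.rotate hbi hch).rotate hbi hch
  have h2 : G.Tri y p m := hc2.rotate hbi hch
  obtain ⟨c, hc4, hc5, -⟩ := h1.of_not_out hbi hch hyo
  have h3 : c = p := by
    have hc5' := hc5
    have h2' := h2
    obtain ⟨d, hd1, hd2, -⟩ := hc5'
    obtain ⟨e, he1, he2, -⟩ := h2'
    have h4 := hc5.rot_eq hbi hch hd1 hd2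
    have h5 := h2.rot_eq hbi hch he1 he2
    have : G.rot d = G.rot e := dart_ext
      (by rw [G.rot_fst, G.rot_fst, hd1, he1]) (h4.trans h5.symm)
    rw [← hd2, ← he2, G.rot.injective this]
  rw [h3] at hc4
  exact hc4.rotate hbi hch

/-- A set of inner darts that is closed under moving around triangles and crossing edges. -/
theorem forall_of_closed (A : V → V → Prop) (hA : ∀ u v, A u v → ∃ w, G.Tri u v w)
    (hrot : ∀ u v w, A u v → G.Tri u v w → A v w) (hcross : ∀ u v w, A u v → G.Tri v u w → A v u)
    {u₀ v₀ : V} (h0 : A u₀ v₀) {u v w : V} (h : G.Tri u v w) : A u v := by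
  let S : Set G.Face := {f | ∃ d : G.graph.Dart, G.leftFace d = f ∧ A d.fst d.snd}
  have hS : ∀ d : G.graph.Dart, G.leftFace d ∈ S → A d.fst d.snd := by
    rintro d ⟨e, he, hAe⟩
    obtain ⟨c, hc⟩ := hA _ _ hAe
    have h1 := hrot _ _ _ hAe hc
    have h2 := hrot _ _ _ h1 (hc.rotate hbi hch)
    rcases hc.eq_of_leftFace_eq hbi hch rfl rfl he.symm with ⟨h3, h4⟩ | ⟨h3, h4⟩ | ⟨h3, h4⟩ <;>
      rw [h3, h4] <;> assumption
  obtain ⟨d, rfl, rfl, -, hd⟩ := h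
  apply hS
  refine hbi.forall_mem_of_closed S ?_ ?_ (fun d hd hout => ?_) _ hd
  · obtain ⟨c, hc⟩ := hA _ _ h0
    exact ⟨_, ⟨(u₀, v₀), hc.adj⟩, rfl, h0⟩
  · rintro ⟨e, he, hAe⟩
    obtain ⟨c, hc⟩ := hA _ _ hAe
    exact hc.leftFace_ne rfl rfl he
  · obtain ⟨c, hc⟩ := PlaneGraph.exists_tri hout
    exact ⟨d.symm, rfl, hcross _ _ c (hS d hd) hc⟩

omit hch

/-- Going around a vertex, any two inner faces are connected across edges between inner faces. -/
theorem eq_of_fan {α : Type*} (v : V) (φ : G.Face → α)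
    (hφ : ∀ x : G.graph.Dart, x.fst = v → G.leftFace x ≠ G.outerFace →
      G.leftFace x.symm ≠ G.outerFace → φ (G.leftFace x) = φ (G.leftFace x.symm))
    {x y : G.graph.Dart} (hx : x.fst = v) (hy : y.fst = v) (hx' : G.leftFace x ≠ G.outerFace)
    (hy' : G.leftFace y ≠ G.outerFace) : φ (G.leftFace x) = φ (G.leftFace y) := by
  have step : ∀ x : G.graph.Dart, x.fst = v → G.leftFace x ≠ G.outerFace →
      G.leftFace (G.rot x) ≠ G.outerFace → φ (G.leftFace (G.rot x)) = φ (G.leftFace x) := by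
    intro x hx h1 h2
    have := hφ (G.rot x) ((G.rot_fst x).trans hx) h2 (by rwa [leftFace_rot_symm])
    rwa [leftFace_rot_symm] at this
  by_cases hout : ∃ o : G.graph.Dart, o.fst = v ∧ G.leftFace o = G.outerFace
  · obtain ⟨o, ho1, ho2⟩ := hout
    have key : ∀ x : G.graph.Dart, x.fst = v → G.leftFace x ≠ G.outerFace →
        φ (G.leftFace x) = φ (G.leftFace (G.rot o)) := by
      classical
      intro x hx hx'
      have hex := G.exists_rot_pow (ho1.trans hx.symm)
      set k := Nat.find hex with hk
      have hke : (G.rot ^ k) o = x := Nat.find_spec hex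
      have hmin : ∀ j < k, (G.rot ^ j) o ≠ x := fun j hj => Nat.find_min hex hj
      have hinn : ∀ j, 0 < j → j ≤ k → G.leftFace ((G.rot ^ j) o) ≠ G.outerFace := by
        intro j hj0 hjk hjo
        have hjo' := hbi.eq_of_leftFace_eq (G.rot_pow_fst j o) (hjo.trans ho2.symm)
        apply hmin (k - j) (by omega)
        rw [← hke]
        conv_rhs => rw [show k = (k - j) + j by omega, pow_add, Equiv.Perm.mul_apply, hjo']
      have hind : ∀ j, j + 1 ≤ k → φ (G.leftFace ((G.rot ^ (j + 1)) o)) =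
          φ (G.leftFace (G.rot o)) := by
        intro j
        induction j with
        | zero => intro _; rfl
        | succ j ih =>
          intro hj
          rw [← ih (by omega), pow_succ' _ (j + 1), Equiv.Perm.mul_apply]
          refine step _ ((G.rot_pow_fst _ _).trans ho1) (hinn _ (by omega) (by omega)) ?_
          have := hinn (j + 1 + 1) (by omega) hj
          rwa [pow_succ', Equiv.Perm.mul_apply] at this
      have hk0 : k ≠ 0 := fun h0 => by
        rw [h0] at hke
        apply hx'
        rw [← hke]
        exact ho2
      have := hind (k - 1) (by omega)
      rwa [show k - 1 + 1 = k by omega, hke] at this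
    rw [key x hx hx', key y hy hy']
  · push Not at hout
    obtain ⟨n, rfl⟩ := G.exists_rot_pow (hx.trans hy.symm)
    have : ∀ n : ℕ, φ (G.leftFace ((G.rot ^ n) x)) = φ (G.leftFace x) := by
      intro n
      induction n with
      | zero => rfl
      | succ n ih =>
        rw [← ih, pow_succ', Equiv.Perm.mul_apply]
        refine step _ ((G.rot_pow_fst _ _).trans hx) (hout _ ((G.rot_pow_fst _ _).trans hx))
          (hout _ ?_)
        rw [G.rot_fst, G.rot_pow_fst, hx]
    exact (this n).symm

open scoped Classical in
/-- A chord separates its two faces: no sequence of inner faces leads from one to the other across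
other edges. The chord and an arc of the outer boundary form a closed curve. -/
theorem exists_sep {d : G.graph.Dart} (hd : G.leftFace d ≠ G.outerFace)
    (hd' : G.leftFace d.symm ≠ G.outerFace) (h1 : G.Out d.fst) (h2 : G.Out d.snd) :
    ∃ φ : G.Face → ZMod 2, φ (G.leftFace d) ≠ φ (G.leftFace d.symm) ∧
      ∀ x : G.graph.Dart, x.edge ≠ d.edge → G.leftFace x ≠ G.outerFace →
        G.leftFace x.symm ≠ G.outerFace → φ (G.leftFace x) = φ (G.leftFace x.symm) := by
  let _ := Fintype.ofFinite G.graph.Dart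
  obtain ⟨o, ho1, ho2⟩ := h1
  obtain ⟨o', ho1', ho2'⟩ := h2
  obtain ⟨k, rfl⟩ := G.exists_facePerm_pow (ho2.trans ho2'.symm)
  let c : Sym2 V → ZMod 2 := fun ε => (if ε = d.edge then 1 else 0) +
    ∑ i ∈ Finset.range k, if ε = ((G.facePerm ^ i) o).edge then 1 else 0
  have hsnd : ∀ i, ((G.facePerm ^ i) o).snd = ((G.facePerm ^ (i + 1)) o).fst := fun i => by
    rw [pow_succ', Equiv.Perm.mul_apply, facePerm_fst]
  have hzero : ∀ x : G.graph.Dart, G.leftFace x ≠ G.outerFace →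
      G.leftFace x.symm ≠ G.outerFace →
      ∑ i ∈ Finset.range k, (if x.edge = ((G.facePerm ^ i) o).edge then (1 : ZMod 2) else 0) = 0 := by
    intro x hx hx'
    refine Finset.sum_eq_zero fun i _ => if_neg fun hi => ?_
    have h3 := (G.leftFace_facePerm_pow i o).trans ho2
    rcases (SimpleGraph.dart_edge_eq_iff _ _).1 hi with rfl | rfl
    · exact hx h3
    · rw [SimpleGraph.Dart.symm_symm] at hx'
      exact hx' h3
  obtain ⟨φ, hφ⟩ := G.exists_boundary_eq c (fun v => by
    have h3 : ∀ x : G.graph.Dart, (if x.fst = v then c x.edge else 0) =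
        (if x.fst = v then (if x.edge = d.edge then 1 else 0) else 0) +
        ∑ i ∈ Finset.range k, (if x.fst = v then
          (if x.edge = ((G.facePerm ^ i) o).edge then 1 else 0) else 0) := by
      intro x
      by_cases h : x.fst = v
      · simp only [if_pos h, c]
      · simp only [if_neg h, Finset.sum_const_zero, add_zero]
    simp_rw [h3, Finset.sum_add_distrib]
    rw [Finset.sum_comm]
    simp_rw [sum_fst_edge, hsnd]
    have h4 := CharTwo.sum_range_add_succ
      (fun i => if ((G.facePerm ^ i) o).fst = v then (1 : ZMod 2) else 0) k
    simp_rw [add_comm (if ((G.facePerm ^ (_ + 1)) o).fst = v then (1 : ZMod 2) else 0)] at h4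
    rw [h4]
    simp only [pow_zero, Equiv.Perm.coe_one, id_eq, ho1, ho1']
    rw [add_comm (if d.fst = v then (1 : ZMod 2) else 0)]
    exact CharTwo.add_self_eq_zero _)
  refine ⟨φ, fun h => ?_, fun x hx hx1 hx2 => ?_⟩
  · have h3 := hφ d
    rw [h, CharTwo.add_self_eq_zero] at h3
    simp only [c, if_true, hzero d hd hd'] at h3
    simp at h3
  · have h3 := hφ x
    simp only [c, if_neg hx, hzero x hx1 hx2, add_zero] at h3
    exact CharTwo.add_eq_zero.1 h3

end

/-- A chord `a b` separates the apexes of the two triangles at the chord: they lie on different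
sides of the vertex pair `{a, b}` in the graph. -/
theorem Tri.exists_side (hbi : G.Biconnected) (hch : G.InnerChordal) {a b c c' : V}
    (h : G.Tri a b c) (h' : G.Tri b a c') (ha : G.Out a) (hb : G.Out b) :
    ∃ side : V → ZMod 2, side c ≠ side c' ∧ ∀ u v, G.graph.Adj u v → u ≠ a → u ≠ b → v ≠ a →
      v ≠ b → side u = side v := by
  classical
  let d : G.graph.Dart := ⟨(a, b), h.adj⟩
  obtain ⟨φ, hφ1, hφ2⟩ := exists_sep hbi (d := d) (h.leftFace_ne rfl rfl)
    (h'.leftFace_ne rfl rfl) ha hb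
  choose x hx hx' using hbi.exists_inner_dart
  have hfan : ∀ v, v ≠ a → v ≠ b → ∀ y : G.graph.Dart, y.fst = v → G.leftFace y ≠ G.outerFace →
      φ (G.leftFace y) = φ (G.leftFace (x v)) := by
    intro v hva hvb y hy hy'
    refine eq_of_fan hbi v φ (fun z hz hz1 hz2 => hφ2 z (fun he => ?_) hz1 hz2) hy (hx v) hy' (hx' v)
    rcases (SimpleGraph.dart_edge_eq_iff _ _).1 he with rfl | rfl
    · exact hva hz.symm
    · exact hvb hz.symm
  have hface : ∀ u v w, G.Tri u v w → ∀ y : G.graph.Dart, y.fst = u → y.snd = v →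
      (u ≠ a → u ≠ b → φ (G.leftFace (x u)) = φ (G.leftFace y)) ∧
      (v ≠ a → v ≠ b → φ (G.leftFace (x v)) = φ (G.leftFace y)) ∧
      (w ≠ a → w ≠ b → φ (G.leftFace (x w)) = φ (G.leftFace y)) := by
    intro u v w huvw y hy1 hy2
    have hy := huvw.leftFace_ne hy1 hy2
    refine ⟨fun h1 h2 => ?_, fun h1 h2 => ?_, fun h1 h2 => ?_⟩
    · rw [← hfan u h1 h2 y hy1 hy]
    · rw [← hfan v h1 h2 (G.facePerm y) ((G.facePerm_fst y).trans hy2)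
        (by rwa [leftFace_facePerm]), leftFace_facePerm]
    · obtain ⟨z, hz1, hz2, hz3, -⟩ := huvw
      obtain rfl : y = z := dart_ext (hy1.trans hz1.symm) (hy2.trans hz2.symm)
      rw [← hfan w h1 h2 (G.facePerm (G.facePerm y)) ((G.facePerm_fst _).trans hz3)
        (by rwa [leftFace_facePerm, leftFace_facePerm]), leftFace_facePerm, leftFace_facePerm]
  refine ⟨fun v => φ (G.leftFace (x v)), ?_, ?_⟩
  · have hn := h.ne hbi hch
    have hn' := h'.ne hbi hch
    have h1 := (hface _ _ _ h d rfl rfl).2.2 hn.2.2 hn.2.1.symm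
    have h2 := (hface _ _ _ h' d.symm rfl rfl).2.2 hn'.2.1.symm hn'.2.2
    simp only [h1, h2]
    exact hφ1
  · intro u v huv h1 h2 h3 h4
    rcases hbi.exists_tri_or huv with ⟨w, hw⟩ | ⟨w, hw⟩
    · have := hface _ _ _ hw ⟨(u, v), huv⟩ rfl rfl
      exact (this.1 h1 h2).trans (this.2.1 h3 h4).symm
    · have := hface _ _ _ hw ⟨(v, u), huv.symm⟩ rfl rfl
      exact (this.2.1 h1 h2).trans (this.1 h3 h4).symm

theorem edgeIncident_iff {a b : V} (h : G.graph.Adj a b) (f : G.Face) :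
    G.EdgeIncident s(a, b) f ↔ G.leftFace ⟨(a, b), h⟩ = f ∨ G.leftFace ⟨(b, a), h.symm⟩ = f := by
  constructor
  · rintro ⟨d, hd, rfl⟩
    rcases (SimpleGraph.dart_edge_eq_iff d ⟨(a, b), h⟩).1 hd with rfl | rfl
    · exact Or.inl rfl
    · exact Or.inr rfl
  · rintro (rfl | rfl)
    · exact ⟨_, rfl, rfl⟩
    · exact ⟨⟨(b, a), h.symm⟩, Sym2.eq_swap, rfl⟩

theorem isChord_iff {a b : V} :
    G.IsChord s(a, b) ↔ (∃ c, G.Tri a b c) ∧ (∃ c, G.Tri b a c) ∧ G.Out a ∧ G.Out b := by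
  constructor
  · rintro ⟨h1, h2, h3⟩
    have h1' : G.graph.Adj a b := h1
    rw [edgeIncident_iff h1', not_or] at h2
    exact ⟨exists_tri h2.1, exists_tri h2.2, h3 a (by simp), h3 b (by simp)⟩
  · rintro ⟨⟨c, hc⟩, ⟨c', hc'⟩, h3, h4⟩
    refine ⟨hc.adj, ?_, fun v hv => ?_⟩
    · rw [edgeIncident_iff hc.adj, not_or]
      exact ⟨hc.leftFace_ne rfl rfl, hc'.leftFace_ne rfl rfl⟩
    · rcases Sym2.mem_iff.1 hv with rfl | rfl <;> assumption

/-- Two chords at `r` that share a face are two sides of an inner triangle. -/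
theorem tri_or_of_share_face (hbi : G.Biconnected) (hch : G.InnerChordal) {r s q : V} (hsq : s ≠ q)
    (h1 : G.IsChord s(r, s)) (h2 : G.IsChord s(r, q)) {f : G.Face} (hf1 : G.EdgeIncident s(r, s) f)
    (hf2 : G.EdgeIncident s(r, q) f) : G.Tri r s q ∨ G.Tri r q s := by
  have h1' : G.graph.Adj r s := h1.1
  have h2' : G.graph.Adj r q := h2.1
  rw [isChord_iff] at h1 h2
  obtain ⟨⟨c, hc⟩, ⟨c', hc'⟩, -⟩ := h1
  rw [edgeIncident_iff h1'] at hf1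
  rw [edgeIncident_iff h2'] at hf2
  rcases hf1 with rfl | rfl <;> rcases hf2 with hf | hf
  · rcases hc.eq_of_leftFace_eq hbi hch rfl rfl hf with ⟨h3, h4⟩ | ⟨h3, h4⟩ | ⟨h3, h4⟩
    · exact absurd h4.symm hsq
    · exact absurd h3 h1'.ne
    · exact absurd h4.symm h2'.ne
  · rcases hc.eq_of_leftFace_eq hbi hch rfl rfl hf with ⟨h3, h4⟩ | ⟨h3, h4⟩ | ⟨h3, h4⟩
    · exact absurd h4 h1'.ne
    · exact absurd h3.symm hsq
    · simp only at h3; subst h3; exact Or.inl hc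
  · rcases hc'.eq_of_leftFace_eq hbi hch rfl rfl hf with ⟨h3, h4⟩ | ⟨h3, h4⟩ | ⟨h3, h4⟩
    · exact absurd h3 h1'.ne
    · simp only at h4; subst h4; exact Or.inr (hc'.rotate hbi hch)
    · exact absurd h4.symm hsq
  · rcases hc'.eq_of_leftFace_eq hbi hch rfl rfl hf with ⟨h3, h4⟩ | ⟨h3, h4⟩ | ⟨h3, h4⟩
    · exact absurd h3.symm hsq
    · exact absurd h3 h2'.ne'
    · exact absurd h4 h1'.ne

theorem share_face_of_tri {r s q : V} (hbi : G.Biconnected) (hch : G.InnerChordal)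
    (h : G.Tri r s q) : ∃ f, G.EdgeIncident s(r, s) f ∧ G.EdgeIncident s(r, q) f := by
  have h2 := (h.rotate hbi hch).rotate hbi hch
  obtain ⟨d, rfl, rfl, rfl, hd⟩ := h
  refine ⟨G.leftFace d, ⟨d, rfl, rfl⟩, G.facePerm (G.facePerm d), ?_, ?_⟩
  · have : (G.facePerm (G.facePerm d)).snd = d.fst := by
      rw [← G.facePerm_fst, hbi.facePerm_cube hch hd]
    rw [SimpleGraph.Dart.edge, G.facePerm_fst, this]
    exact Sym2.eq_swap
  · rw [leftFace_facePerm, leftFace_facePerm]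

end PlaneGraph

/-! ### Orientation determinants and triangles in the plane -/

/-- Twice the signed area of the triangle `a b c`; it is positive if `a`, `b`, `c` are in
counterclockwise order. -/
def det3 (a b c : ℂ) : ℝ :=
  (b.re - a.re) * (c.im - a.im) - (b.im - a.im) * (c.re - a.re)

theorem det3_rotate (a b c : ℂ) : det3 b c a = det3 a b c := by simp only [det3]; ring

theorem det3_swap (a b c : ℂ) : det3 b a c = -det3 a b c := by simp only [det3]; ring

theorem det3_swap' (a b c : ℂ) : det3 a c b = -det3 a b c := by simp only [det3]; ring

@[simp] theorem det3_self_left (a b : ℂ) : det3 a a b = 0 := by simp only [det3]; ring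

@[simp] theorem det3_self_right (a b : ℂ) : det3 a b b = 0 := by simp only [det3]; ring

@[simp] theorem det3_self_mid (a b : ℂ) : det3 a b a = 0 := by simp only [det3]; ring

theorem det3_combo (x y p q : ℂ) {s t : ℝ} (h : s + t = 1) :
    det3 x y (s • p + t • q) = s * det3 x y p + t * det3 x y q := by
  obtain rfl : t = 1 - s := by linarith
  simp only [det3, Complex.add_re, Complex.add_im, Complex.smul_re, Complex.smul_im, smul_eq_mul]
  ring

theorem det3_sum (a b c p : ℂ) : det3 b c p + det3 c a p + det3 a b p = det3 a b c := by
  simp only [det3]; ring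

theorem continuous_det3 (a b : ℂ) : Continuous (det3 a b) := by
  unfold det3
  fun_prop

theorem continuous_det3_mid (a c : ℂ) : Continuous (fun b => det3 a b c) := by
  unfold det3
  fun_prop

/-- The barycentric coordinates of a point with respect to a triangle. -/
theorem det3_smul_eq (a b c p : ℂ) :
    det3 a b c • p = det3 b c p • a + det3 c a p • b + det3 a b p • c := by
  apply Complex.ext <;>
  · simp only [det3, Complex.add_re, Complex.add_im, Complex.smul_re, Complex.smul_im, smul_eq_mul]
    ring

theorem convex_det3_nonneg (a b : ℂ) : Convex ℝ {p | 0 ≤ det3 a b p} := by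
  intro p hp q hq s t hs ht hst
  simp only [Set.mem_ofPred_eq] at *
  rw [det3_combo _ _ _ _ hst]
  positivity

theorem convex_det3_pos (a b : ℂ) : Convex ℝ {p | 0 < det3 a b p} := by
  intro p hp q hq s t hs ht hst
  simp only [Set.mem_ofPred_eq] at *
  rw [det3_combo _ _ _ _ hst]
  rcases hs.eq_or_lt with rfl | hs
  · obtain rfl : t = 1 := by linarith
    simpa using hq
  · have := mul_pos hs hp
    have := mul_nonneg ht hq.le
    linarith

theorem collinear_iff_det3 (a b c : ℂ) : Collinear ℝ {a, b, c} ↔ det3 a b c = 0 := by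
  rw [collinear_iff_of_mem (p₀ := a) (by simp)]
  constructor
  · rintro ⟨v, hv⟩
    obtain ⟨r, hr⟩ := hv b (by simp)
    obtain ⟨s, hs⟩ := hv c (by simp)
    rw [hr, hs]
    simp only [det3, vadd_eq_add, Complex.add_re, Complex.add_im, Complex.smul_re, Complex.smul_im,
      smul_eq_mul]
    ring
  · intro h
    by_cases hab : b = a
    · refine ⟨c - a, fun p hp => ?_⟩
      rcases hp with rfl | rfl | rfl
      · exact ⟨0, by simp⟩
      · exact ⟨0, by simp [hab]⟩
      · exact ⟨1, by simp⟩
    · refine ⟨b - a, fun p hp => ?_⟩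
      rcases hp with rfl | rfl | rfl
      · exact ⟨0, by simp⟩
      · exact ⟨1, by simp⟩
      · by_cases hre : b.re - a.re = 0
        · have him : b.im - a.im ≠ 0 := fun him => hab (Complex.ext (by linarith) (by linarith))
          refine ⟨(p.im - a.im) / (b.im - a.im), ?_⟩
          simp only [det3, hre, zero_mul, zero_sub, neg_eq_zero, mul_eq_zero, him, false_or] at h
          apply Complex.ext
          · simp only [vadd_eq_add, Complex.add_re, Complex.smul_re, Complex.sub_re, smul_eq_mul,
              hre]
            linarith
          · simp only [vadd_eq_add, Complex.add_im, Complex.smul_im, Complex.sub_im, smul_eq_mul]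
            field_simp
            ring
        · refine ⟨(p.re - a.re) / (b.re - a.re), ?_⟩
          simp only [det3] at h
          apply Complex.ext
          · simp only [vadd_eq_add, Complex.add_re, Complex.smul_re, Complex.sub_re, smul_eq_mul]
            field_simp
            ring
          · simp only [vadd_eq_add, Complex.add_im, Complex.smul_im, Complex.sub_im, smul_eq_mul]
            field_simp
            linarith

/-- The closed triangle with corners `a`, `b`, `c`. -/
def triHull (a b c : ℂ) : Set ℂ := convexHull ℝ {a, b, c}

theorem convex_triHull (a b c : ℂ) : Convex ℝ (triHull a b c) := convex_convexHull ℝ _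

theorem left_mem_triHull (a b c : ℂ) : a ∈ triHull a b c := subset_convexHull ℝ _ (by simp)

theorem mid_mem_triHull (a b c : ℂ) : b ∈ triHull a b c := subset_convexHull ℝ _ (by simp)

theorem right_mem_triHull (a b c : ℂ) : c ∈ triHull a b c := subset_convexHull ℝ _ (by simp)

theorem triHull_rotate (a b c : ℂ) : triHull b c a = triHull a b c := by
  unfold triHull
  congr 1
  ext x
  simp only [Set.mem_insert_iff, Set.mem_singleton_iff]
  tauto

theorem triHull_swap (a b c : ℂ) : triHull b a c = triHull a b c := by
  unfold triHull
  rw [Set.insert_comm]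

theorem triHull_subset {a b c : ℂ} {s : Set ℂ} (hs : Convex ℝ s) (ha : a ∈ s) (hb : b ∈ s)
    (hc : c ∈ s) : triHull a b c ⊆ s := by
  refine convexHull_min ?_ hs
  rintro x (rfl | rfl | rfl) <;> assumption

theorem isCompact_triHull (a b c : ℂ) : IsCompact (triHull a b c) :=
  (Set.toFinite ({a, b, c} : Set ℂ)).isCompact_convexHull ℝ

theorem isClosed_triHull (a b c : ℂ) : IsClosed (triHull a b c) := (isCompact_triHull a b c).isClosed

theorem Convex.triple_mem {s : Set ℂ} (hs : Convex ℝ s) {a b c : ℂ} (ha : a ∈ s) (hb : b ∈ s)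
    (hc : c ∈ s) {x y z : ℝ} (hx : 0 ≤ x) (hy : 0 ≤ y) (hz : 0 ≤ z) (h : x + y + z = 1) :
    x • a + y • b + z • c ∈ s := by
  have := hs.sum_mem (t := (Finset.univ : Finset (Fin 3))) (w := ![x, y, z]) (z := ![a, b, c])
    (by intro i _; fin_cases i <;> simpa) (by simpa [Fin.sum_univ_three] using h)
    (by intro i _; fin_cases i <;> simpa)
  simpa [Fin.sum_univ_three] using this

theorem mem_triHull_iff {a b c : ℂ} (h : 0 < det3 a b c) (p : ℂ) :
    p ∈ triHull a b c ↔ 0 ≤ det3 a b p ∧ 0 ≤ det3 b c p ∧ 0 ≤ det3 c a p := by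
  constructor
  · intro hp
    refine ⟨triHull_subset (convex_det3_nonneg a b) ?_ ?_ ?_ hp,
      triHull_subset (convex_det3_nonneg b c) ?_ ?_ ?_ hp,
      triHull_subset (convex_det3_nonneg c a) ?_ ?_ ?_ hp⟩ <;>
    simp only [Set.mem_ofPred_eq, det3_self_mid, det3_self_right, le_refl]
    · exact h.le
    · rw [det3_rotate]; exact h.le
    · rw [← det3_rotate]; exact h.le
  · rintro ⟨h1, h2, h3⟩
    have hsum := det3_sum a b c p
    have hp : p = (det3 b c p / det3 a b c) • a + (det3 c a p / det3 a b c) • b +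
        (det3 a b p / det3 a b c) • c := by
      have := det3_smul_eq a b c p
      have h4 : p = (det3 a b c)⁻¹ • (det3 a b c • p) := by
        rw [smul_smul, inv_mul_cancel₀ h.ne', one_smul]
      conv_lhs => rw [h4, this]
      simp only [smul_add, smul_smul, div_eq_inv_mul]
    rw [hp]
    refine (convex_triHull a b c).triple_mem (left_mem_triHull a b c) (mid_mem_triHull a b c)
      (right_mem_triHull a b c) (div_nonneg h2 h.le) (div_nonneg h3 h.le) (div_nonneg h1 h.le) ?_
    rw [← add_div, ← add_div, hsum, div_self h.ne']

theorem segment_subset_triHull (a b c : ℂ) : segment ℝ a b ⊆ triHull a b c :=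
  (convex_triHull a b c).segment_subset (left_mem_triHull a b c) (mid_mem_triHull a b c)

theorem mem_segment_of_det3_eq_zero {a b c p : ℂ} (h : 0 < det3 a b c) (h0 : det3 a b p = 0)
    (h1 : 0 ≤ det3 b c p) (h2 : 0 ≤ det3 c a p) : p ∈ segment ℝ a b := by
  have hsum := det3_sum a b c p
  rw [h0, add_zero] at hsum
  refine ⟨det3 b c p / det3 a b c, det3 c a p / det3 a b c, by positivity, by positivity, ?_, ?_⟩
  · rw [← add_div, hsum, div_self h.ne']
  · have := det3_smul_eq a b c p
    rw [h0, zero_smul, add_zero] at this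
    have h4 : p = (det3 a b c)⁻¹ • (det3 a b c • p) := by
      rw [smul_smul, inv_mul_cancel₀ h.ne', one_smul]
    conv_rhs => rw [h4, this]
    simp only [smul_add, smul_smul, div_eq_inv_mul]

/-- A connected set that meets a triangle but none of its sides lies inside the triangle. -/
theorem IsPreconnected.subset_interior_triangle {S : Set ℂ} (hS : IsPreconnected S) {a b c : ℂ}
    (h : 0 < det3 a b c) (hab : Disjoint S (segment ℝ a b)) (hbc : Disjoint S (segment ℝ b c))
    (hca : Disjoint S (segment ℝ c a)) (hne : (S ∩ triHull a b c).Nonempty) :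
    S ⊆ {p | 0 < det3 a b p ∧ 0 < det3 b c p ∧ 0 < det3 c a p} := by
  have hbc' : 0 < det3 b c a := by rw [det3_rotate]; exact h
  have hca' : 0 < det3 c a b := by rw [← det3_rotate]; exact h
  have hpos : ∀ p ∈ S, 0 ≤ det3 a b p → 0 ≤ det3 b c p → 0 ≤ det3 c a p →
      0 < det3 a b p ∧ 0 < det3 b c p ∧ 0 < det3 c a p := by
    intro p hp h1 h2 h3
    refine ⟨h1.lt_of_ne fun h0 => ?_, h2.lt_of_ne fun h0 => ?_, h3.lt_of_ne fun h0 => ?_⟩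
    · exact Set.disjoint_left.1 hab hp (mem_segment_of_det3_eq_zero h h0.symm h2 h3)
    · exact Set.disjoint_left.1 hbc hp (mem_segment_of_det3_eq_zero hbc' h0.symm h3 h1)
    · exact Set.disjoint_left.1 hca hp (mem_segment_of_det3_eq_zero hca' h0.symm h1 h2)
  have hopen : IsOpen {p | 0 < det3 a b p ∧ 0 < det3 b c p ∧ 0 < det3 c a p} :=
    (isOpen_lt continuous_const (continuous_det3 a b)).inter
      ((isOpen_lt continuous_const (continuous_det3 b c)).inter
        (isOpen_lt continuous_const (continuous_det3 c a)))
  refine IsPreconnected.subset_left_of_subset_union hopen (isClosed_triHull a b c).isOpen_compl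
    ?_ (fun p hp => ?_) ?_ hS
  · rw [Set.disjoint_left]
    rintro p ⟨h1, h2, h3⟩ h4
    exact h4 ((mem_triHull_iff h p).2 ⟨h1.le, h2.le, h3.le⟩)
  · by_cases h4 : p ∈ triHull a b c
    · obtain ⟨h1, h2, h3⟩ := (mem_triHull_iff h p).1 h4
      exact Or.inl (hpos p hp h1 h2 h3)
    · exact Or.inr h4
  · obtain ⟨p, hp, hp'⟩ := hne
    obtain ⟨h1, h2, h3⟩ := (mem_triHull_iff h p).1 hp'
    exact ⟨p, hp, hpos p hp h1 h2 h3⟩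

/-- The segments `p q` and `r s` meet if each of them has its ends on different sides of the
other. -/
theorem segment_inter_nonempty {p q r s : ℂ} (h1 : det3 p q r * det3 p q s < 0)
    (h2 : det3 r s p * det3 r s q < 0) : (segment ℝ p q ∩ segment ℝ r s).Nonempty := by
  have hid : det3 p q r - det3 p q s = det3 r s p * -1 + det3 r s q := by simp only [det3]; ring
  have hpos : ∀ x y : ℝ, x * y < 0 → 0 < x / (x - y) ∧ 0 < -y / (x - y) ∧
      x / (x - y) + -y / (x - y) = 1 := by
    intro x y hxy
    have hne : x - y ≠ 0 := fun h => by
      obtain rfl : x = y := by linarith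
      nlinarith [mul_self_nonneg x]
    refine ⟨?_, ?_, by rw [← add_div]; exact div_self hne⟩
    · have : x / (x - y) = (x * (x - y)) / (x - y) ^ 2 := by field_simp
      rw [this]
      have : 0 < x * (x - y) := by nlinarith [mul_self_nonneg x]
      positivity
    · have : -y / (x - y) = (-y * (x - y)) / (x - y) ^ 2 := by field_simp
      rw [this]
      have : 0 < -y * (x - y) := by nlinarith [mul_self_nonneg y]
      positivity
  obtain ⟨a1, a2, a3⟩ := hpos _ _ h1
  obtain ⟨b1, b2, b3⟩ := hpos _ _ h2
  have hn1 : det3 p q r - det3 p q s ≠ 0 := fun h => by simp [h] at a1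
  have hn2 : det3 r s p - det3 r s q ≠ 0 := fun h => by simp [h] at b1
  refine ⟨(-det3 p q s / (det3 p q r - det3 p q s)) • r +
    (det3 p q r / (det3 p q r - det3 p q s)) • s,
    ⟨-det3 r s q / (det3 r s p - det3 r s q), det3 r s p / (det3 r s p - det3 r s q), b2.le, b1.le,
      by linarith, ?_⟩, ⟨_, _, a2.le, a1.le, by linarith, rfl⟩⟩
  have e : det3 p q r - det3 p q s = -(det3 r s p - det3 r s q) := by rw [hid]; ring
  rw [e]
  apply Complex.ext <;>
  · simp only [Complex.add_re, Complex.add_im, Complex.smul_re, Complex.smul_im, smul_eq_mul]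
    field_simp
    simp only [det3]
    ring

/-- The points of a triangle whose sides are drawn are not in the outer face. -/
theorem disjoint_drawnOuterFace {V : Type*} {H : SimpleGraph V} {pos : V → ℂ} {a b c : V}
    (hab : H.Adj a b) (hbc : H.Adj b c) (hca : H.Adj c a) (h : det3 (pos a) (pos b) (pos c) ≠ 0)
    {p : ℂ} (hp : p ∈ triHull (pos a) (pos b) (pos c)) : p ∉ drawnOuterFace H pos := by
  wlog h' : 0 < det3 (pos a) (pos b) (pos c) generalizing a b
  · refine this hab.symm hca.symm hbc.symm ?_ ?_ ?_
    · rw [det3_swap]; exact neg_ne_zero.2 h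
    · rw [triHull_swap]; exact hp
    · rw [det3_swap]
      have := lt_of_le_of_ne (not_lt.1 h') h
      linarith
  rintro ⟨hpD, hub⟩
  apply hub
  have hsub : ∀ {u v : V}, H.Adj u v →
      Disjoint (connectedComponentIn (drawnSet H pos)ᶜ p) (segment ℝ (pos u) (pos v)) := by
    intro u v huv
    rw [Set.disjoint_left]
    intro q hq hq'
    refine connectedComponentIn_subset _ _ hq (Or.inr ?_)
    exact Set.mem_iUnion.2 ⟨⟨(u, v), huv⟩, hq'⟩
  have := isPreconnected_connectedComponentIn.subset_interior_triangle h' (hsub hab) (hsub hbc)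
    (hsub hca) ⟨p, mem_connectedComponentIn hpD, hp⟩
  refine (isCompact_triHull (pos a) (pos b) (pos c)).isBounded.subset fun q hq => ?_
  obtain ⟨h1, h2, h3⟩ := this hq
  exact (mem_triHull_iff h' q).2 ⟨h1.le, h2.le, h3.le⟩

/-! ### From a representation to an orientation -/

namespace PlaneGraph

variable {V : Type*} {G : PlaneGraph V} [Finite V]

section

variable (hbi : G.Biconnected) (hch : G.InnerChordal)

include hbi hch

/-- The apexes of the two triangles at a chord are not adjacent. -/
theorem Tri.not_adj_apex {a b c c' : V} (h : G.Tri a b c) (h' : G.Tri b a c') (ha : G.Out a)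
    (hb : G.Out b) : c ≠ c' ∧ ¬ G.graph.Adj c c' := by
  obtain ⟨side, hs1, hs2⟩ := h.exists_side hbi hch h' ha hb
  refine ⟨fun h => hs1 (by rw [h]), fun hadj => hs1 (hs2 _ _ hadj ?_ ?_ ?_ ?_)⟩
  · exact (h.ne hbi hch).2.2
  · exact (h.ne hbi hch).2.1.symm
  · exact (h'.ne hbi hch).2.1.symm
  · exact (h'.ne hbi hch).2.2

theorem Tri.exists_side' {a b c : V} (h : G.Tri a b c) (ha : G.Out a) (hb : G.Out b) :
    ∃ side : V → ZMod 2, (∀ c', G.Tri b a c' → side c ≠ side c') ∧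
      ∀ u v, G.graph.Adj u v → u ≠ a → u ≠ b → v ≠ a → v ≠ b → side u = side v := by
  by_cases h1 : ∃ c', G.Tri b a c'
  · obtain ⟨c', hc'⟩ := h1
    obtain ⟨side, hs1, hs2⟩ := h.exists_side hbi hch hc' ha hb
    exact ⟨side, fun x hx => by rwa [hx.unique hc'], hs2⟩
  · exact ⟨0, fun x hx => absurd ⟨x, hx⟩ h1, fun _ _ _ _ _ _ _ => rfl⟩

/-- No vertex is adjacent to all corners of an inner face whose corners are on the outer face. -/
theorem Tri.not_adj_all {a b c z : V} (h : G.Tri a b c) (ha : G.Out a) (hb : G.Out b)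
    (hc : G.Out c) (hza : G.graph.Adj z a) (hzb : G.graph.Adj z b) (hzc : G.graph.Adj z c) :
    False := by
  have hbc := h.rotate hbi hch
  have hca := hbc.rotate hbi hch
  obtain ⟨s₁, s₁n, s₁e⟩ := h.exists_side' hbi hch ha hb
  obtain ⟨s₂, s₂n, s₂e⟩ := hbc.exists_side' hbi hch hb hc
  obtain ⟨s₃, s₃n, s₃e⟩ := hca.exists_side' hbi hch hc ha
  obtain ⟨nab, nbc, nca⟩ := h.ne hbi hch
  -- `good s p q r` says that the face `u v w` lies on the same side of `p q` as `r`
  let good1 : (V → ZMod 2) → V → V → V → V → Prop := fun s p q r t =>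
    t ≠ p → t ≠ q → s t = s r
  let good : (V → ZMod 2) → V → V → V → V → V → V → Prop := fun s p q r u v w =>
    good1 s p q r u ∧ good1 s p q r v ∧ good1 s p q r w
  let A : V → V → Prop := fun u v => ∃ w, G.Tri u v w ∧ good s₁ a b c u v w ∧
    good s₂ b c a u v w ∧ good s₃ c a b u v w ∧
    ¬ (u = a ∧ v = b) ∧ ¬ (u = b ∧ v = c) ∧ ¬ (u = c ∧ v = a)
  have hgood : ∀ (s : V → ZMod 2) (p q r : V), (∀ c', G.Tri q p c' → s r ≠ s c') →
      (∀ u v, G.graph.Adj u v → u ≠ p → u ≠ q → v ≠ p → v ≠ q → s u = s v) →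
      ∀ u v w w', G.Tri u v w → G.Tri v u w' → ¬ (u = p ∧ v = q) → good s p q r u v w →
      ¬ (v = p ∧ u = q) ∧ good s p q r v u w' := by
    rintro s p q r hn he u v w w' h1 h2 h3 ⟨g1, g2, g3⟩
    have n1 := h1.ne hbi hch
    have n2 := h2.ne hbi hch
    have h4 : ¬ (v = p ∧ u = q) := by
      rintro ⟨rfl, rfl⟩
      exact hn w h1 (g3 n1.2.1.symm n1.2.2).symm
    refine ⟨h4, g2, g1, fun hp hq => ?_⟩
    by_cases hu : u = p ∨ u = q
    · have hv : v ≠ p ∧ v ≠ q := by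
        constructor
        · rintro rfl
          rcases hu with rfl | rfl
          · exact n1.1 rfl
          · exact h4 ⟨rfl, rfl⟩
        · rintro rfl
          rcases hu with rfl | rfl
          · exact h3 ⟨rfl, rfl⟩
          · exact n1.1 rfl
      rw [← g2 hv.1 hv.2]
      exact he _ _ ((h2.rotate hbi hch).rotate hbi hch).adj hp hq hv.1 hv.2
    · push Not at hu
      rw [← g1 hu.1 hu.2]
      exact he _ _ (h2.rotate hbi hch).adj.symm hp hq hu.1 hu.2
  obtain ⟨u₀, v₀, h0⟩ := hbi.exists_tri z
  have hA0 : A z u₀ := by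
    have hz : ∀ (s : V → ZMod 2) (p q r : V), G.graph.Adj z p → G.graph.Adj z q →
        G.graph.Adj z r → r ≠ p → r ≠ q →
        (∀ u v, G.graph.Adj u v → u ≠ p → u ≠ q → v ≠ p → v ≠ q → s u = s v) →
        good s p q r z u₀ v₀ := by
      intro s p q r hp hq hr hrp hrq he
      have hzr := he z r hr hp.ne hq.ne hrp hrq
      refine ⟨fun _ _ => hzr, fun h1 h2 => ?_, fun h1 h2 => ?_⟩
      · rw [← hzr]; exact (he _ _ h0.adj hp.ne hq.ne h1 h2).symm
      · rw [← hzr]; exact he _ _ (h0.rotate hbi hch).adj' h1 h2 hp.ne hq.ne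
    refine ⟨v₀, h0, hz s₁ a b c hza hzb hzc nca nbc.symm s₁e,
      hz s₂ b c a hzb hzc hza nab nca.symm s₂e, hz s₃ c a b hzc hza hzb nbc nab.symm s₃e,
      fun h => hza.ne h.1, fun h => hzb.ne h.1, fun h => hzc.ne h.1⟩
  have := forall_of_closed hbi hch A (fun u v ⟨w, hw, _⟩ => ⟨w, hw⟩) ?_ ?_ hA0 h
  · obtain ⟨w, -, -, -, -, h1, -⟩ := this
    exact h1 ⟨rfl, rfl⟩
  · rintro u v w ⟨w', hw', ⟨g1, g2, g3⟩, ⟨k1, k2, k3⟩, ⟨m1, m2, m3⟩, x1, x2, x3⟩ hw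
    obtain rfl := hw.unique hw'
    refine ⟨u, hw.rotate hbi hch, ⟨g2, g3, g1⟩, ⟨k2, k3, k1⟩, ⟨m2, m3, m1⟩, ?_, ?_, ?_⟩
    · rintro ⟨rfl, rfl⟩
      exact x3 ⟨(hw.rotate hbi hch).unique h, rfl⟩
    · rintro ⟨rfl, rfl⟩
      exact x1 ⟨(hw.rotate hbi hch).unique hbc, rfl⟩
    · rintro ⟨rfl, rfl⟩
      exact x2 ⟨(hw.rotate hbi hch).unique hca, rfl⟩
  · rintro u v w ⟨w', hw', g, k, m, x1, x2, x3⟩ hw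
    obtain ⟨y1, g'⟩ := hgood s₁ a b c s₁n s₁e u v w' w hw' hw x1 g
    obtain ⟨y2, k'⟩ := hgood s₂ b c a s₂n s₂e u v w' w hw' hw x2 k
    obtain ⟨y3, m'⟩ := hgood s₃ c a b s₃n s₃e u v w' w hw' hw x3 m
    exact ⟨w, hw, g', k', m', y1, y2, y3⟩

/-- If the triangles at `a` close up around `a` after three steps, then `a` is not on the outer
face. -/
theorem not_out_of_cyclic {a b₁ b₂ b₃ : V} (h₁ : G.Tri a b₁ b₂) (h₂ : G.Tri a b₂ b₃)
    (h₃ : G.Tri a b₃ b₁) : ¬ G.Out a := by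
  rintro ⟨o, rfl, ho⟩
  obtain ⟨k, hk⟩ := G.exists_rot_pow (d := ⟨(o.fst, b₁), h₁.adj⟩) (e := o) rfl
  have key : ∀ k : ℕ, ((G.rot ^ k) ⟨(o.fst, b₁), h₁.adj⟩).snd = b₁ ∨
      ((G.rot ^ k) ⟨(o.fst, b₁), h₁.adj⟩).snd = b₂ ∨
      ((G.rot ^ k) ⟨(o.fst, b₁), h₁.adj⟩).snd = b₃ := by
    intro k
    induction k with
    | zero => exact Or.inl rfl
    | succ k ih =>
      have hf := G.rot_pow_fst k ⟨(o.fst, b₁), h₁.adj⟩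
      rw [pow_succ', Equiv.Perm.mul_apply]
      rcases ih with h | h | h
      · exact Or.inr (Or.inl (h₁.rot_eq hbi hch hf h))
      · exact Or.inr (Or.inr (h₂.rot_eq hbi hch hf h))
      · exact Or.inl (h₃.rot_eq hbi hch hf h)
  have := key k
  rw [hk] at this
  rcases this with h | h | h
  · exact h₁.leftFace_ne rfl h ho
  · exact h₂.leftFace_ne rfl h ho
  · exact h₃.leftFace_ne rfl h ho

end

end PlaneGraph

/-! ### Points inside drawn triangles -/

section

variable {V : Type*} {H : SimpleGraph V} {pos : V → ℂ}

theorem IsOutsideObstacleRep.det3_ne (h : IsOutsideObstacleRep H pos) {u v w : V} (huv : u ≠ v)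
    (huw : u ≠ w) (hvw : v ≠ w) : det3 (pos u) (pos v) (pos w) ≠ 0 := by
  rw [Ne, ← collinear_iff_det3]
  exact h.general_position u v w huv huw hvw

theorem IsOutsideObstacleRep.adj_of_mem (h : IsOutsideObstacleRep H pos) {a b c u v : V}
    (hab : H.Adj a b) (hbc : H.Adj b c) (hca : H.Adj c a) (huv : u ≠ v)
    (hu : pos u ∈ triHull (pos a) (pos b) (pos c)) (hv : pos v ∈ triHull (pos a) (pos b) (pos c)) :
    H.Adj u v := by
  by_contra hn
  obtain ⟨p, hp, hp'⟩ := h.nonedge u v huv hn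
  exact disjoint_drawnOuterFace hab hbc hca (h.det3_ne hab.ne hca.ne' hbc.ne)
    ((convex_triHull _ _ _).segment_subset hu hv hp) hp'

theorem IsCrossingFree.inter_eq_empty (h : IsCrossingFree H pos) {a b c d : V} (hab : H.Adj a b)
    (hcd : H.Adj c d) (hac : a ≠ c) (had : a ≠ d) (hbc : b ≠ c) (hbd : b ≠ d) :
    ¬ (segment ℝ (pos a) (pos b) ∩ segment ℝ (pos c) (pos d)).Nonempty := by
  rintro ⟨p, hp⟩
  obtain ⟨v, ⟨hv1, hv2⟩, -⟩ := h a b c d hab hcd (by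
    intro he
    rcases Sym2.eq_iff.1 he with h1 | h1
    · exact hac h1.1
    · exact had h1.1) hp
  rcases hv1 with rfl | rfl <;> rcases hv2 with h2 | h2
  · exact hac h2
  · exact had h2
  · exact hbc h2
  · exact hbd h2

/-- `z` lies in the open angle at `a` between `b` and `w`. -/
def InAngle (a b w z : ℂ) : Prop :=
  0 < det3 a b w * det3 a b z ∧ 0 < det3 a b w * det3 a z w

/-- A neighbour of the corner `a` of a drawn triangle that lies in the angle of the triangle at `a`
lies in the triangle, since the edge leading to it does not cross the opposite side. -/
theorem IsPlaneOutsideObstacleRep.mem_triHull (h : IsPlaneOutsideObstacleRep H pos) {a b w z : V}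
    (hab : H.Adj a b) (hbw : H.Adj b w) (hwa : H.Adj w a) (haz : H.Adj a z) (hzb : z ≠ b)
    (hzw : z ≠ w) (hz : InAngle (pos a) (pos b) (pos w) (pos z)) :
    pos z ∈ triHull (pos a) (pos b) (pos w) := by
  wlog h' : 0 < det3 (pos a) (pos b) (pos w) generalizing b w
  · have h2 := this hwa.symm hbw.symm hab.symm hzw hzb ?_ ?_
    · rwa [triHull_rotate, triHull_swap] at h2
    · obtain ⟨h1, h2⟩ := hz
      rw [det3_swap'] at h1 h2
      refine ⟨?_, ?_⟩
      · rw [det3_swap' (pos a) (pos z) (pos w)]; linarith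
      · rw [det3_swap' (pos a) (pos b) (pos z)]; linarith
    · rw [det3_swap']
      have := lt_of_le_of_ne (not_lt.1 h') (h.1.det3_ne hab.ne hwa.ne' hbw.ne)
      linarith
  obtain ⟨h1, h2⟩ := hz
  have h1 := (pos_iff_pos_of_mul_pos h1).1 h'
  have h2 := (pos_iff_pos_of_mul_pos h2).1 h'
  rw [mem_triHull_iff h']
  refine ⟨h1.le, ?_, by rw [det3_rotate, ← det3_rotate, ← det3_rotate]; exact h2.le⟩
  by_contra h3
  push Not at h3
  refine h.2.inter_eq_empty haz hbw hab.ne hwa.ne' hzb hzw (segment_inter_nonempty ?_ ?_)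
  · rw [det3_swap' (pos a) (pos b) (pos z)]
    nlinarith
  · rw [det3_rotate]; nlinarith

/-- A neighbour of a vertex inside a drawn triangle is inside the triangle or one of its
corners. -/
theorem IsPlaneOutsideObstacleRep.mem_triHull_of_adj (h : IsPlaneOutsideObstacleRep H pos)
    {a b w z y : V} (hab : H.Adj a b) (hbw : H.Adj b w) (hwa : H.Adj w a)
    (hz : pos z ∈ triHull (pos a) (pos b) (pos w)) (hza : z ≠ a) (hzb : z ≠ b) (hzw : z ≠ w)
    (hzy : H.Adj z y) (hya : y ≠ a) (hyb : y ≠ b) (hyw : y ≠ w) :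
    pos y ∈ triHull (pos a) (pos b) (pos w) := by
  wlog h' : 0 < det3 (pos a) (pos b) (pos w) generalizing a b
  · rw [← triHull_swap]
    refine this hab.symm hwa.symm hbw.symm ?_ hzb hza hyb hya ?_
    · rwa [triHull_swap]
    · rw [det3_swap]
      have := lt_of_le_of_ne (not_lt.1 h') (h.1.det3_ne hab.ne hwa.ne' hbw.ne)
      linarith
  have hdis : ∀ {u v : V}, H.Adj u v → z ≠ u → z ≠ v → y ≠ u → y ≠ v →
      Disjoint (segment ℝ (pos z) (pos y)) (segment ℝ (pos u) (pos v)) := by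
    intro u v huv h1 h2 h3 h4
    rw [Set.disjoint_iff_inter_eq_empty, ← Set.not_nonempty_iff_eq_empty]
    exact h.2.inter_eq_empty hzy huv h1 h2 h3 h4
  have := (convex_segment (𝕜 := ℝ) (pos z) (pos y)).isPreconnected.subset_interior_triangle h'
    (hdis hab hza hzb hya hyb) (hdis hbw hzb hzw hyb hyw) (hdis hwa hzw hza hyw hya)
    ⟨pos z, left_mem_segment ℝ _ _, hz⟩
  obtain ⟨h1, h2, h3⟩ := this (right_mem_segment ℝ _ _)
  exact (mem_triHull_iff h' _).2 ⟨h1.le, h2.le, h3.le⟩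

end

/-! ### The orientation defined by a representation -/

/-- The point `a` lies in the interior of the triangle `b x y`. For the two triangles `a b x` and
`a b y` at a chord `a b` this says that their angles at `a` add up to more than `π`. -/
def Pivot (a b x y : ℂ) : Prop :=
  0 < det3 a b x * det3 a x y ∧ 0 < det3 a b x * det3 a y b

theorem mem_segment_of_mem_segment {x y : ℂ} {s t s' t' : ℝ} (hs : s + t = 1)
    (ht' : 0 ≤ t') (hst' : s' + t' = 1) (h : t' ≤ t) :
    s' • x + t' • y ∈ segment ℝ x (s • x + t • y) := by
  rcases (ht'.trans h).eq_or_lt with h0 | h0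
  · obtain rfl : t' = 0 := by linarith
    obtain rfl : s' = 1 := by linarith
    simpa using left_mem_segment ℝ x _
  · have hdiv : t' / t ≤ 1 := (div_le_one h0).2 h
    refine ⟨1 - t' / t, t' / t, by linarith, by positivity, by ring, ?_⟩
    rw [smul_add, smul_smul, smul_smul, ← add_assoc, ← add_smul, div_mul_cancel₀ _ h0.ne']
    congr 2
    obtain rfl : s = 1 - t := by linarith
    obtain rfl : s' = 1 - t' := by linarith
    field_simp
    ring

theorem segment_subset_union {x y p : ℂ} (hp : p ∈ segment ℝ x y) :
    segment ℝ x y ⊆ segment ℝ x p ∪ segment ℝ p y := by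
  obtain ⟨s, t, hs, ht, hst, rfl⟩ := hp
  rintro _ ⟨s', t', hs', ht', hst', rfl⟩
  rcases le_total t' t with h | h
  · exact Or.inl (mem_segment_of_mem_segment hst ht' hst' h)
  · right
    rw [segment_symm, add_comm (s' • x), add_comm (s • x)]
    exact mem_segment_of_mem_segment (by linarith) hs' (by linarith) (by linarith)

theorem Pivot.not_swap {a b x y : ℂ} (h : Pivot a b x y) : ¬ Pivot b a x y := by
  rintro ⟨h3, h4⟩
  obtain ⟨h1, h2⟩ := h
  have e1 : det3 b a x = -det3 a b x := det3_swap a b x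
  have e2 : det3 a y b = -det3 a b y := det3_swap' a b y
  have e4 : det3 b x y = det3 a b x + det3 a x y - det3 a b y := by simp only [det3]; ring
  rw [e1, e4] at h3
  rw [e2] at h2
  nlinarith [mul_self_nonneg (det3 a b x)]

theorem Pivot.symm {a b x y : ℂ} (h : Pivot a b x y) : Pivot a b y x := by
  obtain ⟨h1, h2⟩ := h
  rw [det3_swap' a b y] at h2
  have h3 : det3 a b y * det3 a x y < 0 := by
    by_contra h3
    push Not at h3
    have := mul_pos h1 h2
    have : 0 ≤ (det3 a b x) ^ 2 * (det3 a b y * det3 a x y) := by positivity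
    nlinarith
  refine ⟨?_, ?_⟩
  · rw [det3_swap' a x y]; linarith
  · rw [det3_swap' a b x]; linarith

/-- Four points in general position such that neither `x` and `y` are hidden from each other by
convexity nor the sides of the triangles `a b x`, `a b y` cross: `a` or `b` is a reflex corner of
the quadrilateral `a x b y`. -/
theorem pivot_or_pivot {a b x y : ℂ} (hA : det3 a b x ≠ 0) (hB : det3 a b y ≠ 0)
    (hC : det3 a x y ≠ 0) (hD : det3 b x y ≠ 0)
    (h1 : ¬ (segment ℝ a b ∩ segment ℝ x y).Nonempty)
    (h2 : ¬ (segment ℝ a x ∩ segment ℝ b y).Nonempty)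
    (h3 : ¬ (segment ℝ a y ∩ segment ℝ b x).Nonempty)
    (h4 : x ∉ triHull a b y) (h5 : y ∉ triHull a b x) : Pivot a b x y ∨ Pivot b a x y := by
  wlog hpos : 0 < det3 a b x generalizing a b
  · have n1 := det3_swap a b x
    have n2 := det3_swap a b y
    have := this (a := b) (b := a) (fun h => hA (by linarith)) (fun h => hB (by linarith)) hD hC
      (by rwa [segment_symm]) (by rwa [Set.inter_comm]) (by rwa [Set.inter_comm])
      (by rwa [triHull_swap]) (by rwa [triHull_swap])
      (by linarith [lt_of_le_of_ne (not_lt.1 hpos) hA])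
    exact this.symm
  have e1 : det3 b a x = -det3 a b x := det3_swap a b x
  have e2 : det3 a y b = -det3 a b y := det3_swap' a b y
  have e3 : det3 b y a = det3 a b y := det3_rotate a b y
  have e4 : det3 b x y = det3 a b x + det3 a x y - det3 a b y := by simp only [det3]; ring
  have e5 : det3 x y a = det3 a x y := det3_rotate a x y
  have e6 : det3 x y b = det3 b x y := det3_rotate b x y
  have e7 : det3 a x b = -det3 a b x := det3_swap' a b x
  have e8 : det3 b y x = -det3 b x y := det3_swap' b x y
  have e9 : det3 a y x = -det3 a x y := det3_swap' a x y
  have e10 : det3 b x a = det3 a b x := det3_rotate a b x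
  have e11 : det3 y a x = det3 a x y := by simp only [det3]; ring
  have e12 : det3 x a y = -det3 a x y := det3_swap a x y
  rcases lt_or_gt_of_ne hB with hB' | hB'
  · rcases lt_or_gt_of_ne hC with hC' | hC'
    · rcases lt_or_gt_of_ne hD with hD' | hD'
      · right
        refine ⟨?_, ?_⟩
        · rw [e1]; nlinarith
        · rw [e1, e3]; nlinarith
      · exact absurd (segment_inter_nonempty (by nlinarith) (by rw [e5, e6]; nlinarith)) h1
    · left
      refine ⟨by positivity, ?_⟩
      rw [e2]; nlinarith
  · exfalso
    rcases lt_or_gt_of_ne hC with hC' | hC' <;> rcases lt_or_gt_of_ne hD with hD' | hD'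
    · exact h3 (segment_inter_nonempty (by rw [e2, e9]; nlinarith) (by rw [e10]; nlinarith))
    · exact h5 ((mem_triHull_iff hpos y).2 ⟨hB'.le, hD'.le, by rw [e12]; linarith⟩)
    · exact h4 ((mem_triHull_iff hB' x).2 ⟨hpos.le, by rw [e8]; linarith, by rw [e11]; exact hC'.le⟩)
    · exact h2 (segment_inter_nonempty (by rw [e7]; nlinarith) (by rw [e3, e8]; nlinarith))

/-- If `a` is inside the triangle `b x y`, then the directions at `a` outside the angles `b a x` and
`b a y` are in the angle `x a y`. -/
theorem Pivot.inAngle {a b x y z : ℂ} (h : Pivot a b x y) (hb : det3 a b z ≠ 0)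
    (h1 : ¬ InAngle a b x z) (h2 : ¬ InAngle a b y z)
    (hx : det3 a x z ≠ 0) (hy : det3 a y z ≠ 0) :
    0 < det3 a x y * det3 a x z ∧ 0 < det3 a x y * det3 a z y := by
  obtain ⟨p1, p2⟩ := h
  unfold InAngle at h1 h2
  have hid : det3 a x y * det3 a b z + det3 a y b * det3 a x z + det3 a b x * det3 a y z = 0 := by
    simp only [det3]; ring
  have e1 : det3 a z x = -det3 a x z := det3_swap' a x z
  have e2 : det3 a z y = -det3 a y z := det3_swap' a y z
  have e3 : det3 a b y = -det3 a y b := det3_swap' a y b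
  rw [e1] at h1
  rw [e2, e3] at h2
  rw [e2]
  rcases lt_trichotomy (det3 a b x) 0 with hs | hs | hs
  · have c1 : det3 a x y < 0 := by by_contra hh; push Not at hh; nlinarith
    have c2 : det3 a y b < 0 := by by_contra hh; push Not at hh; nlinarith
    rcases lt_or_gt_of_ne hx with hx' | hx' <;> rcases lt_or_gt_of_ne hy with hy' | hy' <;>
      rcases lt_or_gt_of_ne hb with hb' | hb'
    · exfalso; nlinarith
    · exfalso; exact h2 ⟨by nlinarith, by nlinarith⟩
    · exact ⟨by nlinarith, by nlinarith⟩
    · exact ⟨by nlinarith, by nlinarith⟩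
    · exfalso; exact h1 ⟨by nlinarith, by nlinarith⟩
    · exfalso; exact h2 ⟨by nlinarith, by nlinarith⟩
    · exfalso; exact h1 ⟨by nlinarith, by nlinarith⟩
    · exfalso; nlinarith
  · rw [hs, zero_mul] at p1; exact absurd p1 (lt_irrefl _)
  · have c1 : 0 < det3 a x y := by by_contra hh; push Not at hh; nlinarith
    have c2 : 0 < det3 a y b := by by_contra hh; push Not at hh; nlinarith
    rcases lt_or_gt_of_ne hx with hx' | hx' <;> rcases lt_or_gt_of_ne hy with hy' | hy' <;>
      rcases lt_or_gt_of_ne hb with hb' | hb'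
    · exfalso; nlinarith
    · exfalso; exact h1 ⟨by nlinarith, by nlinarith⟩
    · exfalso; exact h2 ⟨by nlinarith, by nlinarith⟩
    · exfalso; exact h1 ⟨by nlinarith, by nlinarith⟩
    · exact ⟨by nlinarith, by nlinarith⟩
    · exact ⟨by nlinarith, by nlinarith⟩
    · exfalso; exact h2 ⟨by nlinarith, by nlinarith⟩
    · exfalso; nlinarith

/-- If `a` is inside the triangle `b x y`, then `b`, `x`, `y` are not all in an angle at `a`. -/
theorem Pivot.false_of_angle {a b x y u v : ℂ} (h : Pivot a b x y)
    (hb : 0 < det3 a u v * (det3 a u b + det3 a b v))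
    (hx : 0 < det3 a u v * (det3 a u x + det3 a x v))
    (hy : 0 < det3 a u v * (det3 a u y + det3 a y v)) : False := by
  obtain ⟨p1, p2⟩ := h
  have hid : det3 a x y * (det3 a u v * (det3 a u b + det3 a b v)) +
      det3 a y b * (det3 a u v * (det3 a u x + det3 a x v)) +
      det3 a b x * (det3 a u v * (det3 a u y + det3 a y v)) = 0 := by
    simp only [det3]; ring
  set B := det3 a u v * (det3 a u b + det3 a b v)
  set X := det3 a u v * (det3 a u x + det3 a x v)
  set Y := det3 a u v * (det3 a u y + det3 a y v)
  have h1 := mul_pos p1 hb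
  have h2 := mul_pos p2 hx
  have h3 : 0 ≤ det3 a b x * det3 a b x * Y := mul_nonneg (mul_self_nonneg _) hy.le
  have : det3 a b x * (det3 a x y * B + det3 a y b * X + det3 a b x * Y) = 0 := by
    rw [hid, mul_zero]
  nlinarith

namespace PlaneGraph

variable {V : Type*} {G : PlaneGraph V} [Finite V] {pos : V → ℂ}

section

variable (hbi : G.Biconnected) (hch : G.InnerChordal)
  (h : IsPlaneOutsideObstacleRep G.graph pos)

include hbi hch h

/-- The triangles at a chord have a reflex corner at one of the ends of the chord. -/
theorem pivot_or_of_chord {a b x y : V} (hx : G.Tri a b x) (hy : G.Tri b a y) (ha : G.Out a)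
    (hb : G.Out b) : Pivot (pos a) (pos b) (pos x) (pos y) ∨
      Pivot (pos b) (pos a) (pos x) (pos y) := by
  obtain ⟨hxy, hnadj⟩ := hx.not_adj_apex hbi hch hy ha hb
  have nx := hx.ne hbi hch
  have ny := hy.ne hbi hch
  have axy : G.graph.Adj a b := hx.adj
  have abx : G.graph.Adj b x := hx.adj'
  have axa : G.graph.Adj x a := (hx.rotate hbi hch).adj'
  have aay : G.graph.Adj a y := hy.adj'
  have ayb : G.graph.Adj y b := (hy.rotate hbi hch).adj'
  have hA := h.1.det3_ne nx.1 nx.2.2.symm nx.2.1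
  have hB := h.1.det3_ne nx.1 ny.2.1 ny.2.2.symm
  refine pivot_or_pivot hA hB (h.1.det3_ne nx.2.2.symm ny.2.1 hxy)
    (h.1.det3_ne nx.2.1 ny.2.2.symm hxy) ?_ ?_ ?_ ?_ ?_
  · rintro ⟨p, hp1, hp2⟩
    obtain ⟨q, hq, hq'⟩ := h.1.nonedge x y hxy hnadj
    -- the segment `x y` is covered by the two triangles at the chord
    have hsub : segment ℝ (pos x) (pos y) ⊆
        segment ℝ (pos x) p ∪ segment ℝ p (pos y) := segment_subset_union hp2
    rcases hsub hq with hq1 | hq1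
    · exact disjoint_drawnOuterFace axy abx axa hA ((convex_triHull _ _ _).segment_subset
        (right_mem_triHull _ _ _) (segment_subset_triHull _ _ _ hp1) hq1) hq'
    · exact disjoint_drawnOuterFace axy ayb.symm aay.symm hB
        ((convex_triHull _ _ _).segment_subset (segment_subset_triHull _ _ _ hp1)
        (right_mem_triHull _ _ _) hq1) hq'
  · exact h.2.inter_eq_empty axa.symm ayb.symm nx.1 ny.2.1 nx.2.1.symm hxy
  · exact h.2.inter_eq_empty aay abx nx.1 nx.2.2.symm ny.2.2 hxy.symm
  · exact fun hmem => hnadj (h.1.adj_of_mem axy ayb.symm aay.symm hxy hmem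
      (right_mem_triHull _ _ _))
  · exact fun hmem => hnadj (h.1.adj_of_mem axy abx axa hxy (right_mem_triHull _ _ _) hmem)

/-- The situation at a neighbour `z` of `a` that is drawn inside the face `a b w` with `w` not on
the outer face: the edge `a z` is not a chord. -/
theorem false_of_mem_triHull {a b w z w₂ : V} (hab : G.graph.Adj a b) (hbw : G.graph.Adj b w)
    (hwa : G.graph.Adj w a) (hz : pos z ∈ triHull (pos a) (pos b) (pos w)) (hzb : z ≠ b)
    (ha : G.Out a) (hzo : G.Out z)
    (hw : (G.Tri z a w ∧ G.Tri a z w₂) ∨ (G.Tri a z w ∧ G.Tri z a w₂)) : False := by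
  have key : w ≠ w₂ ∧ ¬ G.graph.Adj w w₂ ∧ G.graph.Adj z w₂ ∧ w₂ ≠ a ∧ z ≠ a ∧ z ≠ w := by
    rcases hw with ⟨h1, h2⟩ | ⟨h1, h2⟩
    · obtain ⟨k1, k2⟩ := h1.not_adj_apex hbi hch h2 hzo ha
      exact ⟨k1, k2, h2.adj', (h2.ne hbi hch).2.2, h2.adj.ne', (h1.ne hbi hch).2.2.symm⟩
    · obtain ⟨k1, k2⟩ := h1.not_adj_apex hbi hch h2 ha hzo
      exact ⟨k1, k2, (h2.rotate hbi hch).adj'.symm, (h2.ne hbi hch).2.1.symm, h2.adj.ne,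
        (h1.ne hbi hch).2.1⟩
  obtain ⟨k1, k2, k3, k4, k5, k6⟩ := key
  have k7 : w₂ ≠ b := by
    rintro rfl
    exact k2 hbw.symm
  exact k2 (h.1.adj_of_mem hab hbw hwa k1 (right_mem_triHull _ _ _)
    (h.mem_triHull_of_adj hab hbw hwa hz k5 hzb k6 k3 k4 k7 k1.symm))

/-- If the chords `a b` and `a b'` do not share a face, then no corner of a triangle at `a b'` is
in the angle at `a` of a triangle at `a b`. -/
theorem not_inAngle_of_chord {a b w b' x' y' z : V} (hw : G.Tri a b w ∨ G.Tri b a w)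
    (ha : G.Out a) (hb : G.Out b) (hb' : G.Out b') (hx' : G.Tri a b' x') (hy' : G.Tri b' a y')
    (hbb' : b' ≠ b) (hwb' : w ≠ b') (hz : z = b' ∨ z = x' ∨ z = y') (hzw : z ≠ w) (hzb : z ≠ b) :
    ¬ InAngle (pos a) (pos b) (pos w) (pos z) := by
  intro hang
  have key : G.graph.Adj a b ∧ G.graph.Adj b w ∧ G.graph.Adj w a := by
    rcases hw with hw | hw
    · exact ⟨hw.adj, hw.adj', (hw.rotate hbi hch).adj'⟩
    · exact ⟨hw.adj.symm, (hw.rotate hbi hch).adj'.symm, hw.adj'.symm⟩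
  obtain ⟨hab, hbw, hwa⟩ := key
  have haz : G.graph.Adj a z := by
    rcases hz with rfl | rfl | rfl
    · exact hx'.adj
    · exact (hx'.rotate hbi hch).adj'.symm
    · exact hy'.adj'
  have hmem := h.mem_triHull hab hbw hwa haz hzb hzw hang
  have hzw' : G.graph.Adj z w :=
    h.1.adj_of_mem hab hbw hwa hzw hmem (right_mem_triHull _ _ _)
  have hzb' : G.graph.Adj z b :=
    h.1.adj_of_mem hab hbw hwa hzb hmem (mid_mem_triHull _ _ _)
  by_cases hwo : G.Out w
  · rcases hw with hw | hw
    · exact hw.not_adj_all hbi hch ha hb hwo haz.symm hzb' hzw'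
    · exact hw.not_adj_all hbi hch hb ha hwo hzb' haz.symm hzw'
  -- now `w` has degree three and `a z w` is one of the triangles at `w`
  have hside : G.Tri z a w ∨ G.Tri a z w := by
    rcases hw with hw | hw
    · obtain ⟨c, hc1, hc2, hc3⟩ := ((hw.rotate hbi hch).rotate hbi hch).of_not_out hbi hch hwo
      obtain rfl : z = c := by
        rcases hc3 z hzw'.symm with h1 | h1 | h1
        · exact absurd h1 haz.ne'
        · exact absurd h1 hzb
        · exact h1
      exact Or.inl (hc2.rotate hbi hch)
    · obtain ⟨c, hc1, hc2, hc3⟩ := ((hw.rotate hbi hch).rotate hbi hch).of_not_out hbi hch hwo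
      obtain rfl : z = c := by
        rcases hc3 z hzw'.symm with h1 | h1 | h1
        · exact absurd h1 hzb
        · exact absurd h1 haz.ne'
        · exact h1
      exact Or.inr (hc1.rotate hbi hch)
  have hout : ∀ {p q : V}, G.Tri z p q → (p = a ∧ q = b') ∨ (p = b' ∧ q = a) → G.Out z := by
    intro p q hpq hpq'
    by_contra hzo
    obtain ⟨c, -, -, hc⟩ := hpq.of_not_out hbi hch hzo
    have h1 := hc b hzb'
    have h2 := hc w hzw'
    have h3 : b ≠ w := hbw.ne
    have h4 : b ≠ a := hab.ne'
    have h5 : w ≠ a := hwa.ne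
    rcases hpq' with ⟨rfl, rfl⟩ | ⟨rfl, rfl⟩
    · have h6 : b = c := (h1.resolve_left h4).resolve_left hbb'.symm
      have h7 : w = c := (h2.resolve_left h5).resolve_left hwb'
      exact h3 (h6.trans h7.symm)
    · have h6 : b = c := (h1.resolve_left hbb'.symm).resolve_left h4
      have h7 : w = c := (h2.resolve_left hwb').resolve_left h5
      exact h3 (h6.trans h7.symm)
  rcases hz with rfl | rfl | rfl
  · rcases hside with h1 | h1
    · exact false_of_mem_triHull hbi hch h hab hbw hwa hmem hzb ha hb' (Or.inl ⟨h1, hx'⟩)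
    · exact false_of_mem_triHull hbi hch h hab hbw hwa hmem hzb ha hb' (Or.inr ⟨h1, hy'⟩)
  · have h2 : G.Tri z a b' := (hx'.rotate hbi hch).rotate hbi hch
    rcases hside with h1 | h1
    · exact hwb' (h1.unique h2)
    · exact false_of_mem_triHull hbi hch h hab hbw hwa hmem hzb ha (hout h2 (Or.inl ⟨rfl, rfl⟩))
        (Or.inr ⟨h1, h2⟩)
  · have h2 : G.Tri a z b' := hy'.rotate hbi hch
    rcases hside with h1 | h1
    · exact false_of_mem_triHull hbi hch h hab hbw hwa hmem hzb ha
        (hout (h2.rotate hbi hch) (Or.inr ⟨rfl, rfl⟩)) (Or.inl ⟨h1, h2⟩)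
    · exact hwb' (h1.unique h2)

/-- Two chords with a reflex corner at a common end `a` share a face: otherwise the triangles at one
of them lie in an angle less than `π` left free by the triangles at the other one. -/
theorem tri_or_of_pivot {a b x y b' x' y' : V} (hbb' : b' ≠ b) (hx : G.Tri a b x)
    (hy : G.Tri b a y) (hx' : G.Tri a b' x') (hy' : G.Tri b' a y') (ha : G.Out a) (hb : G.Out b)
    (hb' : G.Out b') (hp : Pivot (pos a) (pos b) (pos x) (pos y))
    (hp' : Pivot (pos a) (pos b') (pos x') (pos y')) : G.Tri a b b' ∨ G.Tri a b' b := by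
  by_contra hcon
  push Not at hcon
  obtain ⟨n1, n2⟩ := hcon
  have hxb' : x ≠ b' := by rintro rfl; exact n1 hx
  have hyb' : y ≠ b' := by rintro rfl; exact n2 (hy.rotate hbi hch)
  have hx'b : x' ≠ b := by rintro rfl; exact n2 hx'
  have hy'b : y' ≠ b := by rintro rfl; exact n1 (hy'.rotate hbi hch)
  have hxy : x ≠ y := (hx.not_adj_apex hbi hch hy ha hb).1
  have hxya : det3 (pos a) (pos x) (pos y) ≠ 0 :=
    h.1.det3_ne (hx.ne hbi hch).2.2.symm (hy.ne hbi hch).2.1 hxy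
  have key : ∀ z, (z = b' ∨ z = x' ∨ z = y') → 0 < det3 (pos a) (pos x) (pos y) *
      (det3 (pos a) (pos x) (pos z) + det3 (pos a) (pos z) (pos y)) := by
    intro z hz
    by_cases hzx : z = x
    · subst hzx
      rw [det3_self_right, zero_add]
      exact mul_self_pos.2 hxya
    by_cases hzy : z = y
    · subst hzy
      rw [det3_self_right, add_zero]
      exact mul_self_pos.2 hxya
    have hzb : z ≠ b := by rcases hz with rfl | rfl | rfl <;> assumption
    have hza : a ≠ z := by
      rcases hz with rfl | rfl | rfl
      · exact hx'.adj.ne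
      · exact (hx'.ne hbi hch).2.2.symm
      · exact (hy'.ne hbi hch).2.1
    have h1 := not_inAngle_of_chord hbi hch h (Or.inl hx) ha hb hb' hx' hy' hbb' hxb' hz hzx hzb
    have h2 := not_inAngle_of_chord hbi hch h (Or.inr hy) ha hb hb' hx' hy' hbb' hyb' hz hzy hzb
    obtain ⟨h3, h4⟩ := hp.inAngle (h.1.det3_ne hx.adj.ne hza hzb.symm) h1 h2
      (h.1.det3_ne (hx.ne hbi hch).2.2.symm hza (Ne.symm hzx))
      (h.1.det3_ne (hy.ne hbi hch).2.1 hza (Ne.symm hzy))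
    rw [mul_add]
    exact add_pos h3 h4
  exact hp'.false_of_angle (key _ (Or.inl rfl)) (key _ (Or.inr (Or.inl rfl)))
    (key _ (Or.inr (Or.inr rfl)))

/-- Every chord is oriented towards its reflex end. -/
theorem exists_orientation_of_rep :
    ∃ A : Set G.graph.Dart, G.IsOutsideObstacleOrientation A := by
  let A : Set G.graph.Dart := {d | ∃ x y, G.Tri d.snd d.fst x ∧ G.Tri d.fst d.snd y ∧
    G.Out d.fst ∧ G.Out d.snd ∧ Pivot (pos d.snd) (pos d.fst) (pos x) (pos y)}
  have hor : G.IsChordOrientation A := by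
    constructor
    · rintro d ⟨x, y, hx, hy, h1, h2, -⟩
      exact isChord_iff.2 ⟨⟨y, hy⟩, ⟨x, hx⟩, h1, h2⟩
    · intro d hd
      obtain ⟨⟨y, hy⟩, ⟨x, hx⟩, h1, h2⟩ := isChord_iff.1 hd
      constructor
      · rintro ⟨x', y', hx', hy', -, -, hp⟩ ⟨y'', x'', hy'', hx'', -, -, hp'⟩
        obtain rfl := hx'.unique hx''
        obtain rfl := hy'.unique hy''
        exact hp.not_swap hp'.symm
      · intro hns
        rcases pivot_or_of_chord hbi hch h hx hy h2 h1 with hp | hp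
        · exact ⟨x, y, hx, hy, h1, h2, hp⟩
        · exact absurd ⟨y, x, hy, hx, h2, h1, hp.symm⟩ hns
  have hshare : ∀ v, ∀ d ∈ G.incoming A v, ∀ e ∈ G.incoming A v, d ≠ e →
      G.Tri v d.fst e.fst ∨ G.Tri v e.fst d.fst := by
    rintro v d ⟨⟨x, y, hx, hy, h1, h2, hp⟩, rfl⟩ e ⟨⟨x', y', hx', hy', h1', h2', hp'⟩, he⟩ hde
    rw [he] at hx' hy' hp'
    exact tri_or_of_pivot hbi hch h (fun hfst => hde (dart_ext hfst.symm he.symm)) hx hy hx' hy' h2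
      h1 h1' hp hp'
  refine ⟨A, hor, fun v => ?_, fun v _ d hd e he hde => ?_⟩
  · by_contra hcon
    push Not at hcon
    obtain ⟨d, hd, e, he, f, hf, hde, hdf, hef⟩ := (Set.two_lt_ncard (Set.toFinite _)).1 hcon
    have hv : G.Out v := by
      obtain ⟨⟨x, y, -, -, -, h2, -⟩, rfl⟩ := hd
      exact h2
    have nfst : ∀ {d e : G.graph.Dart}, d ∈ G.incoming A v → e ∈ G.incoming A v → d ≠ e →
        d.fst ≠ e.fst := fun hd he hde hfst => hde (dart_ext hfst (hd.2.trans he.2.symm))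
    have n1 := nfst hd he hde
    have n2 := nfst hd hf hdf
    have n3 := nfst he hf hef
    have s1 := hshare v d hd e he hde
    have s2 := hshare v e he f hf hef
    have s3 := hshare v d hd f hf hdf
    have inj : ∀ {p q r : V}, G.Tri v p r → G.Tri v q r → p = q := fun hp hq => by
      have h1 := (hp.rotate hbi hch).rotate hbi hch
      have h2 := (hq.rotate hbi hch).rotate hbi hch
      exact h1.unique h2
    rcases s1 with s1 | s1 <;> rcases s2 with s2 | s2 <;> rcases s3 with s3 | s3
    · exact n3 (s1.unique s3)
    · exact not_out_of_cyclic hbi hch s1 s2 s3 hv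
    · exact n3 (s1.unique s3)
    · exact n2 (inj s1 s2)
    · exact n2 (s1.unique s2)
    · exact n2 (s1.unique s2)
    · exact not_out_of_cyclic hbi hch s1 s3 s2 hv
    · exact n1 (s2.unique s3).symm
  · have hd' := hor.1 d hd.1
    have he' := hor.1 e he.1
    have e1 : d.edge = s(v, d.fst) := by rw [← hd.2]; exact Sym2.eq_swap
    have e2 : e.edge = s(v, e.fst) := by rw [← he.2]; exact Sym2.eq_swap
    rw [e1, e2]
    rcases hshare v d hd e he hde with h1 | h1
    · exact share_face_of_tri hbi hch h1
    · obtain ⟨f, hf1, hf2⟩ := share_face_of_tri hbi hch h1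
      exact ⟨f, hf2, hf1⟩

end

end PlaneGraph

/-! ### Cells: the triangles spanned by vertices of the outer face -/

namespace PlaneGraph

variable {V : Type*} (G : PlaneGraph V)

/-- The vertex `m` is off the outer face, and `a`, `b`, `c` are its neighbours, in counterclockwise
order. -/
def Ctr (m a b c : V) : Prop :=
  ¬ G.Out m ∧ G.Tri a b m ∧ G.Tri b c m ∧ G.Tri c a m

/-- The vertices `a`, `b`, `c` of the outer face are, in counterclockwise order, the corners of an
inner face or the neighbours of a vertex off the outer face. The cells triangulate the outer
polygon of `G`. -/
def Cell (a b c : V) : Prop :=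
  G.Out a ∧ G.Out b ∧ G.Out c ∧ (G.Tri a b c ∨ ∃ m, G.Ctr m a b c)

/-- The vertex `x` is a corner of the triangle `a b c` or its centre. -/
def InCell (x a b c : V) : Prop := x = a ∨ x = b ∨ x = c ∨ G.Ctr x a b c

variable {G} [Finite V]

theorem InCell.rotate {x a b c : V} (h : G.InCell x a b c) : G.InCell x b c a := by
  rcases h with h | h | h | ⟨h, h1, h2, h3⟩
  · exact Or.inr (Or.inr (Or.inl h))
  · exact Or.inl h
  · exact Or.inr (Or.inl h)
  · exact Or.inr (Or.inr (Or.inr ⟨h, h2, h3, h1⟩))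

theorem inCell_rotate {x a b c : V} : G.InCell x b c a ↔ G.InCell x a b c :=
  ⟨fun h => h.rotate.rotate, fun h => h.rotate⟩

theorem InCell.eq_of_out {x a b c : V} (h : G.InCell x a b c) (hx : G.Out x) :
    x = a ∨ x = b ∨ x = c := by
  rcases h with h | h | h | h
  · exact Or.inl h
  · exact Or.inr (Or.inl h)
  · exact Or.inr (Or.inr h)
  · exact absurd hx h.1

theorem Ctr.rotate {m a b c : V} (h : G.Ctr m a b c) : G.Ctr m b c a := ⟨h.1, h.2.2.1, h.2.2.2, h.2.1⟩

section

variable (hbi : G.Biconnected) (hch : G.InnerChordal)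

include hbi hch

theorem Cell.rotate {a b c : V} (h : G.Cell a b c) : G.Cell b c a := by
  obtain ⟨ha, hb, hc, h | ⟨m, h⟩⟩ := h
  · exact ⟨hb, hc, ha, Or.inl (h.rotate hbi hch)⟩
  · exact ⟨hb, hc, ha, Or.inr ⟨m, h.rotate⟩⟩

theorem Ctr.unique {m a b c c' : V} (h : G.Ctr m a b c) (h' : G.Ctr m a b c') : c = c' := by
  have h1 := ((h.2.2.1.rotate hbi hch).rotate hbi hch).unique
    ((h'.2.2.1.rotate hbi hch).rotate hbi hch)
  exact h1

theorem Cell.unique {a b c c' : V} (h : G.Cell a b c) (h' : G.Cell a b c') : c = c' := by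
  obtain ⟨-, -, hc, h | ⟨m, h⟩⟩ := h <;> obtain ⟨-, -, hc', h' | ⟨m', h'⟩⟩ := h'
  · exact h.unique h'
  · rw [h.unique h'.2.1] at hc
    exact absurd hc h'.1
  · rw [h'.unique h.2.1] at hc'
    exact absurd hc' h.1
  · rw [h.2.1.unique h'.2.1] at h
    exact h.unique hbi hch h'

theorem Cell.adj {a b c : V} (h : G.Cell a b c) : G.graph.Adj a b := by
  obtain ⟨-, -, -, h | ⟨m, h⟩⟩ := h
  · exact h.adj
  · exact h.2.1.adj

theorem Cell.adj' {a b c : V} (h : G.Cell a b c) : G.graph.Adj b c :=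
  (h.rotate hbi hch).adj hbi hch

theorem Cell.adj'' {a b c : V} (h : G.Cell a b c) : G.graph.Adj c a :=
  (h.rotate hbi hch).adj' hbi hch

/-- The inner triangle at an edge between vertices of the outer face lies in a cell. -/
theorem Tri.exists_cell {a b w : V} (h : G.Tri a b w) (ha : G.Out a) (hb : G.Out b) :
    ∃ c, G.Cell a b c ∧ (w = c ∨ G.Ctr w a b c) := by
  by_cases hw : G.Out w
  · exact ⟨w, ⟨ha, hb, hw, Or.inl h⟩, Or.inl rfl⟩
  obtain ⟨c, hc1, hc2, -⟩ := ((h.rotate hbi hch).rotate hbi hch).of_not_out hbi hch hw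
  have hctr : G.Ctr w a b c := ⟨hw, h, hc1.rotate hbi hch, hc2.rotate hbi hch⟩
  refine ⟨c, ⟨ha, hb, ?_, Or.inr ⟨w, hctr⟩⟩, Or.inr hctr⟩
  by_contra hc
  have h1 := h.of_not_out_of_not_out hbi hch hw (hc1.rotate hbi hch).adj'.symm
    (hc2.ne hbi hch).2.1 (hc1.ne hbi hch).2.1.symm hc
  exact not_out_of_cyclic hbi hch h ((hc2.rotate hbi hch).rotate hbi hch)
    ((h1.rotate hbi hch)) ha

theorem Ctr.adj {m a b c x : V} (h : G.Ctr m a b c) :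
    G.graph.Adj m x ↔ x = a ∨ x = b ∨ x = c := by
  constructor
  · intro hx
    obtain ⟨c', h1, -, h2⟩ := ((h.2.1.rotate hbi hch).rotate hbi hch).of_not_out hbi hch h.1
    have h3 := (h.2.2.1.rotate hbi hch).rotate hbi hch
    rw [h3.unique h1]
    exact h2 x hx
  · rintro (rfl | rfl | rfl)
    · exact (h.2.1.rotate hbi hch).adj'
    · exact (h.2.2.1.rotate hbi hch).adj'
    · exact (h.2.2.2.rotate hbi hch).adj'

/-- Two triples of neighbours of the same centre agree up to rotation. -/
theorem Ctr.eq_or {m a b c a' b' c' : V} (h : G.Ctr m a b c) (h' : G.Ctr m a' b' c') :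
    (a' = a ∧ b' = b ∧ c' = c) ∨ (a' = b ∧ b' = c ∧ c' = a) ∨ (a' = c ∧ b' = a ∧ c' = b) := by
  have key : ∀ {a b c b' c' : V}, G.Ctr m a b c → G.Ctr m a b' c' → b' = b ∧ c' = c := by
    intro a b c b' c' h h'
    have h1 := (h.2.1.rotate hbi hch).rotate hbi hch
    have h2 := (h'.2.1.rotate hbi hch).rotate hbi hch
    obtain rfl := h1.unique h2
    exact ⟨rfl, (h.unique hbi hch h').symm⟩
  rcases (h.adj hbi hch).1 ((h'.adj hbi hch).2 (Or.inl rfl)) with rfl | rfl | rfl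
  · exact Or.inl ⟨rfl, key h h'⟩
  · exact Or.inr (Or.inl ⟨rfl, key h.rotate h'⟩)
  · exact Or.inr (Or.inr ⟨rfl, key h.rotate.rotate h'⟩)

/-- Two cells on the two sides of an edge are on different sides of this edge in the graph. -/
theorem Cell.exists_side {a b c c' : V} (h : G.Cell a b c) (h' : G.Cell b a c') :
    ∃ side : V → ZMod 2, side c ≠ side c' ∧ ∀ u v, G.graph.Adj u v → u ≠ a → u ≠ b → v ≠ a →
      v ≠ b → side u = side v := by
  have key : ∀ {a b c : V}, G.Cell a b c → ∃ w, G.Tri a b w ∧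
      ∀ side : V → ZMod 2, (∀ u v, G.graph.Adj u v → u ≠ a → u ≠ b → v ≠ a →
      v ≠ b → side u = side v) → side c = side w := by
    rintro a b c hcell
    have h1 := (hcell.adj' hbi hch).ne'
    have h2 := (hcell.adj'' hbi hch).ne
    obtain ⟨ha, hb, hc, h | ⟨m, h⟩⟩ := hcell
    · exact ⟨c, h, fun _ _ => rfl⟩
    · refine ⟨m, h.2.1, fun side hs => hs _ _ ((h.adj hbi hch).2 (by simp)).symm h2 h1 ?_ ?_⟩
      · rintro rfl; exact h.1 ha
      · rintro rfl; exact h.1 hb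
  obtain ⟨w, hw, hws⟩ := key h
  obtain ⟨w', hw', hws'⟩ := key h'
  obtain ⟨side, hs1, hs2⟩ := hw.exists_side hbi hch hw' h.1 h.2.1
  refine ⟨side, ?_, hs2⟩
  rw [hws side hs2, hws' side fun u v huv h1 h2 h3 h4 => hs2 u v huv h2 h1 h4 h3]
  exact hs1

theorem Cell.not_swap {a b c : V} (h : G.Cell a b c) : ¬ G.Cell b a c := fun h' => by
  obtain ⟨side, hs, -⟩ := h.exists_side hbi hch h'
  exact hs rfl

theorem isChord_iff_cell {a b : V} :
    G.IsChord s(a, b) ↔ (∃ c, G.Cell a b c) ∧ ∃ c, G.Cell b a c := by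
  rw [isChord_iff]
  have key : ∀ {a b c : V}, G.Cell a b c → ∃ w, G.Tri a b w := by
    rintro a b c ⟨-, -, -, h | ⟨m, h⟩⟩
    exacts [⟨c, h⟩, ⟨m, h.2.1⟩]
  constructor
  · rintro ⟨⟨w, hw⟩, ⟨w', hw'⟩, ha, hb⟩
    obtain ⟨c, hc, -⟩ := hw.exists_cell hbi hch ha hb
    obtain ⟨c', hc', -⟩ := hw'.exists_cell hbi hch hb ha
    exact ⟨⟨c, hc⟩, c', hc'⟩
  · rintro ⟨⟨c, hc⟩, c', hc'⟩
    exact ⟨key hc, key hc', hc.1, hc.2.1⟩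

end

variable (G) in
/-- The triangle `a b c` is a cell in one of the two orientations: counterclockwise if `σ = 1`, and
clockwise if `σ = -1`. -/
def SCell (σ : ℝ) (a b c : V) : Prop := (σ = 1 ∧ G.Cell a b c) ∨ (σ = -1 ∧ G.Cell b a c)

section

variable (hbi : G.Biconnected) (hch : G.InnerChordal) {σ : ℝ} {a b c c' : V}

theorem SCell.swap (h : G.SCell σ a b c) : G.SCell (-σ) b a c := by
  rcases h with ⟨rfl, h⟩ | ⟨rfl, h⟩
  · exact Or.inr ⟨rfl, h⟩
  · exact Or.inl ⟨neg_neg 1, h⟩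

theorem SCell.sign (h : G.SCell σ a b c) : σ = 1 ∨ σ = -1 := h.imp And.left And.left

theorem SCell.out (h : G.SCell σ a b c) : G.Out a ∧ G.Out b ∧ G.Out c := by
  rcases h with ⟨-, h⟩ | ⟨-, h⟩
  exacts [⟨h.1, h.2.1, h.2.2.1⟩, ⟨h.2.1, h.1, h.2.2.1⟩]

include hbi hch

theorem SCell.rotate (h : G.SCell σ a b c) : G.SCell σ b c a := by
  rcases h with ⟨rfl, h⟩ | ⟨rfl, h⟩
  · exact Or.inl ⟨rfl, h.rotate hbi hch⟩
  · exact Or.inr ⟨rfl, (h.rotate hbi hch).rotate hbi hch⟩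

/-- The same triangle at another corner, with the opposite orientation. -/
theorem SCell.swap' (h : G.SCell σ a b c) : G.SCell (-σ) a c b :=
  ((h.rotate hbi hch).rotate hbi hch).swap

theorem SCell.unique (h : G.SCell σ a b c) (h' : G.SCell σ a b c') : c = c' := by
  rcases h with ⟨rfl, h⟩ | ⟨rfl, h⟩ <;> rcases h' with ⟨h1, h'⟩ | ⟨h1, h'⟩
  · exact h.unique hbi hch h'
  · norm_num at h1
  · norm_num at h1
  · exact h.unique hbi hch h'

theorem SCell.adj (h : G.SCell σ a b c) : G.graph.Adj a b := by
  rcases h with ⟨rfl, h⟩ | ⟨rfl, h⟩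
  exacts [h.adj hbi hch, (h.adj hbi hch).symm]

theorem SCell.exists_side (h : G.SCell σ a b c) (h' : G.SCell (-σ) a b c') :
    ∃ side : V → ZMod 2, side c ≠ side c' ∧ ∀ u v, G.graph.Adj u v → u ≠ a → u ≠ b → v ≠ a →
      v ≠ b → side u = side v := by
  rcases h with ⟨rfl, h⟩ | ⟨rfl, h⟩ <;> rcases h' with ⟨h1, h'⟩ | ⟨h1, h'⟩
  · norm_num at h1
  · exact h.exists_side hbi hch h'
  · obtain ⟨side, h1, h2⟩ := h.exists_side hbi hch h'
    exact ⟨side, h1, fun u v huv e1 e2 e3 e4 => h2 u v huv e2 e1 e4 e3⟩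
  · norm_num at h1

theorem SCell.not_neg (h : G.SCell σ a b c) : ¬ G.SCell (-σ) a b c := fun h' => by
  obtain ⟨side, hs, -⟩ := h.exists_side hbi hch h'
  exact hs rfl

theorem SCell.isChord (h : G.SCell σ a b c) (h' : G.SCell (-σ) a b c') : G.IsChord s(a, b) := by
  rw [isChord_iff_cell hbi hch]
  rcases h with ⟨rfl, h⟩ | ⟨rfl, h⟩ <;> rcases h' with ⟨h1, h'⟩ | ⟨h1, h'⟩
  · norm_num at h1
  · exact ⟨⟨_, h⟩, _, h'⟩
  · exact ⟨⟨_, h'⟩, _, h⟩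
  · norm_num at h1

end

end PlaneGraph

/-! ### Attaching a thin triangle to a planar region -/

theorem convex_det3_neg (a b : ℂ) : Convex ℝ {p | det3 a b p < 0} := by
  have : {p | det3 a b p < 0} = {p | 0 < det3 b a p} := by
    ext p
    simp only [Set.mem_ofPred_eq, det3_swap a b p, neg_pos]
  rw [this]
  exact convex_det3_pos b a

theorem exists_mem_segment_of_mem_triHull {a b c p : ℂ} (hp : p ∈ triHull a b c) :
    ∃ q ∈ segment ℝ b c, p ∈ segment ℝ a q := by
  unfold triHull at hp
  rw [convexHull_insert (by simp), convexHull_pair, mem_convexJoin] at hp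
  obtain ⟨x, rfl, q, hq, hp⟩ := hp
  exact ⟨q, hq, hp⟩

/-- A point of a triangle `a b c` that is not strictly on the same side of a line through `a` as `b`
and `c` is the corner `a`. -/
theorem eq_of_mem_triHull_of_neg {a b c p q : ℂ} {σ : ℝ} (hb : σ * det3 a q b < 0)
    (hc : σ * det3 a q c < 0) (hp : p ∈ triHull a b c) (h : 0 ≤ σ * det3 a q p) : p = a := by
  obtain ⟨_, ⟨s, t, hs, ht, hst, rfl⟩, ⟨s', t', hs', ht', hst', rfl⟩⟩ :=
    exists_mem_segment_of_mem_triHull hp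
  rw [det3_combo _ _ _ _ hst', det3_combo _ _ _ _ hst, det3_self_mid] at h
  have h1 : s * (σ * det3 a q b) + t * (σ * det3 a q c) < 0 := by
    rcases hs.eq_or_lt with rfl | hs
    · obtain rfl : t = 1 := by linarith
      linarith
    · have := mul_neg_of_pos_of_neg hs hb
      have := mul_nonpos_of_nonneg_of_nonpos ht hc.le
      linarith
  have h2 : t' = 0 := by
    by_contra h3
    have := mul_neg_of_pos_of_neg (lt_of_le_of_ne ht' (Ne.symm h3)) h1
    nlinarith
  subst h2
  obtain rfl : s' = 1 := by linarith
  simp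

theorem mem_segment_of_mem_triHull {r s x y p : ℂ} {σ : ℝ} (hx : 0 < σ * det3 r s x)
    (hy : σ * det3 r s y < 0) (hp : p ∈ triHull r s x) (hp' : p ∈ triHull r s y) :
    p ∈ segment ℝ r s := by
  rw [← triHull_rotate, ← triHull_rotate] at hp hp'
  obtain ⟨q, hq, ⟨s', t', hs', ht', hst', rfl⟩⟩ := exists_mem_segment_of_mem_triHull hp
  obtain ⟨q', hq', ⟨s₁, t₁, hs₁, ht₁, hst₁, h1⟩⟩ := exists_mem_segment_of_mem_triHull hp'
  have hz : ∀ q ∈ segment ℝ r s, det3 r s q = 0 := by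
    rintro _ ⟨u, v, -, -, huv, rfl⟩
    rw [det3_combo _ _ _ _ huv]
    simp
  have h2 : det3 r s (s₁ • y + t₁ • q') = det3 r s (s' • x + t' • q) := by rw [h1]
  rw [det3_combo _ _ _ _ hst₁, det3_combo _ _ _ _ hst', hz q hq, hz q' hq'] at h2
  have h3 : s' = 0 := by
    by_contra h3
    have h4 := mul_pos (lt_of_le_of_ne hs' (Ne.symm h3)) hx
    have h5 := mul_nonpos_of_nonneg_of_nonpos hs₁ hy.le
    have : σ * (s₁ * det3 r s y + t₁ * 0) = σ * (s' * det3 r s x + t' * 0) := by rw [h2]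
    nlinarith
  subst h3
  obtain rfl : t' = 1 := by linarith
  simpa using hq

/-- If the direction from the corner `s` to `r` belongs to the angle of the triangle `s b c`, then
the segment `s r` starts inside the triangle. -/
theorem exists_mem_segment_mem_triHull {s b c r : ℂ} (h : 0 < det3 s b c) (hr : r ≠ s)
    (h1 : 0 ≤ det3 s b r) (h2 : 0 ≤ det3 s r c) : ∃ p ∈ segment ℝ s r, p ≠ s ∧ p ∈ triHull s b c := by
  have hcont : Tendsto (fun t : ℝ => (1 - t) * det3 b c s + t * det3 b c r) (𝓝[>] 0)
      (𝓝 (det3 b c s)) := by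
    have : Continuous (fun t : ℝ => (1 - t) * det3 b c s + t * det3 b c r) := by fun_prop
    have h3 := this.tendsto 0
    simp only [sub_zero, one_mul, zero_mul, add_zero] at h3
    exact h3.mono_left nhdsWithin_le_nhds
  have h3 : 0 < det3 b c s := by rw [det3_rotate]; exact h
  obtain ⟨t, ht, ht0, ht1⟩ := ((hcont.eventually (lt_mem_nhds h3)).and
    (Ioo_mem_nhdsGT (zero_lt_one' ℝ))).exists
  refine ⟨(1 - t) • s + t • r, ⟨1 - t, t, by linarith, ht0.le, by ring, rfl⟩, ?_, ?_⟩
  · intro h4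
    have h5 : t • (r - s) = 0 := by
      rw [smul_sub]
      rw [sub_smul, one_smul] at h4
      linear_combination h4
    rcases smul_eq_zero.1 h5 with h6 | h6
    · exact ht0.ne' h6
    · exact hr (sub_eq_zero.1 h6)
  · rw [mem_triHull_iff h]
    have e : (1 - t) + t = 1 := by ring
    rw [det3_combo _ _ _ _ e, det3_combo _ _ _ _ e, det3_combo _ _ _ _ e, det3_self_mid,
      det3_self_right, ← det3_rotate c s r]
    refine ⟨?_, ht.le, ?_⟩ <;>
    · rw [mul_zero, zero_add]
      positivity

/-- A thin triangle over the segment `r s` with apex near `r` is close to this segment. -/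
theorem eventually_disjoint_triHull {r s : ℂ} {K : Set ℂ} (hK : IsClosed K)
    (h : Disjoint K (segment ℝ r s)) : ∀ᶠ y in 𝓝 r, Disjoint K (triHull r s y) := by
  have hc : IsCompact (segment ℝ r s) := by
    rw [← convexHull_pair]
    exact (Set.toFinite _).isCompact_convexHull ℝ
  obtain ⟨δ, hδ, hsub⟩ := hc.exists_thickening_subset_open hK.isOpen_compl
    (Set.subset_compl_iff_disjoint_left.2 h)
  filter_upwards [Metric.ball_mem_nhds r hδ] with y hy
  rw [← Set.subset_compl_iff_disjoint_left]
  refine (triHull_subset ((convex_segment r s).thickening δ) ?_ ?_ ?_).trans hsub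
  · exact Metric.self_subset_thickening hδ _ (left_mem_segment ℝ r s)
  · exact Metric.self_subset_thickening hδ _ (right_mem_segment ℝ r s)
  · exact Metric.mem_thickening_iff.2 ⟨r, left_mem_segment ℝ r s, hy⟩

theorem isOpen_det3_ne (a b : ℂ) : IsOpen {y | det3 a b y ≠ 0} :=
  isOpen_ne_fun (continuous_det3 a b) continuous_const

/-- An open set contains points in general position. -/
theorem exists_mem_forall_det3_ne {W : Set ℂ} (hW : IsOpen W) (hne : W.Nonempty)
    {L : Set (ℂ × ℂ)} (hL : L.Finite) (hL' : ∀ l ∈ L, l.1 ≠ l.2) :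
    ∃ y ∈ W, ∀ l ∈ L, det3 l.1 l.2 y ≠ 0 := by
  induction L, hL using Set.Finite.induction_on generalizing W with
  | empty =>
    obtain ⟨y, hy⟩ := hne
    exact ⟨y, hy, by simp⟩
  | @insert l L _ _ ih =>
    have h1 : (W ∩ {y | det3 l.1 l.2 y ≠ 0}).Nonempty := by
      obtain ⟨y, hy⟩ := hne
      by_cases h0 : det3 l.1 l.2 y = 0
      · have hcont : Tendsto (fun t : ℝ => y + t • (Complex.I * (l.2 - l.1))) (𝓝[>] 0) (𝓝 y) := by
          have : Continuous (fun t : ℝ => y + t • (Complex.I * (l.2 - l.1))) := by fun_prop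
          have h3 := this.tendsto 0
          simp only [zero_smul, add_zero] at h3
          exact h3.mono_left nhdsWithin_le_nhds
        obtain ⟨t, ht, ht0⟩ := ((hcont.eventually (hW.mem_nhds hy)).and self_mem_nhdsWithin).exists
        refine ⟨_, ht, ?_⟩
        have e : det3 l.1 l.2 (y + t • (Complex.I * (l.2 - l.1))) =
            det3 l.1 l.2 y + t * Complex.normSq (l.2 - l.1) := by
          simp only [det3, Complex.normSq_apply, Complex.add_re, Complex.add_im, Complex.smul_re,
            Complex.smul_im, Complex.mul_re, Complex.mul_im, Complex.I_re, Complex.I_im,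
            Complex.sub_re, Complex.sub_im, smul_eq_mul]
          ring
        rw [Set.mem_ofPred_eq, e, h0, zero_add]
        refine mul_ne_zero (ne_of_gt ht0) ?_
        rw [Ne, Complex.normSq_eq_zero, sub_eq_zero]
        exact (hL' l (by simp)).symm
      · exact ⟨y, hy, h0⟩
    obtain ⟨y, ⟨hy1, hy2⟩, hy3⟩ := ih (hW.inter (isOpen_det3_ne _ _)) h1
      fun l hl => hL' l (Set.mem_insert_of_mem _ hl)
    refine ⟨y, hy1, fun l' hl' => ?_⟩
    rcases hl' with rfl | hl'
    · exact hy2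
    · exact hy3 l' hl'

/-- Removing a closed set `K` from an open set `U` keeps it connected if the part of `K` in `U` has
a neighbourhood `W` such that `W \ K` is connected. -/
theorem IsPreconnected.diff_of_collar {E : Type*} [TopologicalSpace E] {U K W : Set E}
    (hU : IsPreconnected U) (hUo : IsOpen U) (hK : IsClosed K) (hW : IsOpen W) (hKW : U ∩ K ⊆ W)
    (hWU : W ⊆ U) (hWK : IsPreconnected (W \ K)) : IsPreconnected (U \ K) := by
  have key : ∀ X Y : Set E, IsOpen X → IsOpen Y → U \ K ⊆ X ∪ Y → ((U \ K) ∩ X).Nonempty →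
      ((U \ K) ∩ Y).Nonempty → W \ K ⊆ X → ((U \ K) ∩ (X ∩ Y)).Nonempty := by
    rintro X Y hX hY hXY ⟨x, hx, hxX⟩ ⟨y, hy, hyY⟩ hWX
    obtain ⟨p, hpU, hp1, hp2, hp3⟩ := hU ((X ∩ (U \ K)) ∪ W) (Y ∩ (U \ K))
      ((hX.inter (hUo.sdiff hK)).union hW) (hY.inter (hUo.sdiff hK)) (fun p hp => by
        by_cases hpK : p ∈ K
        · exact Or.inl (Or.inr (hKW ⟨hp, hpK⟩))
        · rcases hXY ⟨hp, hpK⟩ with h | h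
          · exact Or.inl (Or.inl ⟨h, hp, hpK⟩)
          · exact Or.inr ⟨h, hp, hpK⟩)
      ⟨x, hx.1, Or.inl ⟨hxX, hx⟩⟩ ⟨y, hy.1, hyY, hy⟩
    rcases hp1 with hp1 | hp1
    · exact ⟨p, hp3, hp1.1, hp2⟩
    · exact ⟨p, hp3, hWX ⟨hp1, hp3.2⟩, hp2⟩
  intro X Y hX hY hXY hx hy
  have hsub : W \ K ⊆ X ∪ Y := fun p hp => hXY ⟨hWU hp.1, hp.2⟩
  by_cases h1 : ((W \ K) ∩ Y).Nonempty
  · by_cases h2 : ((W \ K) ∩ X).Nonempty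
    · obtain ⟨p, hp, hp'⟩ := hWK X Y hX hY hsub h2 h1
      exact ⟨p, ⟨hWU hp.1, hp.2⟩, hp'⟩
    · rw [Set.inter_comm X Y]
      refine key Y X hY hX (by rwa [Set.union_comm]) hy hx fun p hp => ?_
      exact (hsub hp).resolve_left fun h => h2 ⟨p, hp, h⟩
  · exact key X Y hX hY hXY hx hy fun p hp => (hsub hp).resolve_right fun h => h1 ⟨p, hp, h⟩

/-- The interior of the triangle `a b c` if the corners are in counterclockwise order. -/
def openTri (a b c : ℂ) : Set ℂ := {p | 0 < det3 a b p ∧ 0 < det3 b c p ∧ 0 < det3 c a p}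

theorem isOpen_openTri (a b c : ℂ) : IsOpen (openTri a b c) :=
  (isOpen_lt continuous_const (continuous_det3 a b)).inter
    ((isOpen_lt continuous_const (continuous_det3 b c)).inter
      (isOpen_lt continuous_const (continuous_det3 c a)))

theorem convex_openTri (a b c : ℂ) : Convex ℝ (openTri a b c) :=
  (convex_det3_pos a b).inter ((convex_det3_pos b c).inter (convex_det3_pos c a))

theorem det3_pos_of_mem_openTri {a b c p : ℂ} (hp : p ∈ openTri a b c) : 0 < det3 a b c := by
  obtain ⟨h1, h2, h3⟩ := hp
  have := det3_sum a b c p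
  linarith

theorem openTri_subset_triHull (a b c : ℂ) : openTri a b c ⊆ triHull a b c := fun p hp =>
  (mem_triHull_iff (det3_pos_of_mem_openTri hp) p).2 ⟨hp.1.le, hp.2.1.le, hp.2.2.le⟩

/-- The interior of a triangle comes arbitrarily close to the corners. -/
theorem openTri_inter_nonempty {a b c : ℂ} (h : 0 < det3 a b c) {U : Set ℂ} (hU : U ∈ 𝓝 c) :
    (openTri a b c ∩ U).Nonempty := by
  have hcont : Tendsto (fun t : ℝ => (1 - t) • c + t • ((1 / 2 : ℝ) • a + (1 / 2 : ℝ) • b))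
      (𝓝[>] 0) (𝓝 c) := by
    have : Continuous (fun t : ℝ => (1 - t) • c + t • ((1 / 2 : ℝ) • a + (1 / 2 : ℝ) • b)) := by
      fun_prop
    have h3 := this.tendsto 0
    simp only [sub_zero, one_smul, zero_smul, add_zero] at h3
    exact h3.mono_left nhdsWithin_le_nhds
  obtain ⟨t, ht, ht0, ht1⟩ := ((hcont.eventually hU).and (Ioo_mem_nhdsGT (zero_lt_one' ℝ))).exists
  refine ⟨_, ⟨?_, ?_, ?_⟩, ht⟩ <;>
  · rw [det3_combo _ _ _ _ (by ring), det3_combo _ _ _ _ (by norm_num)]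
    simp only [det3_self_mid, det3_self_right, det3_rotate b c a, det3_rotate a b c, mul_zero,
      add_zero, zero_add]
    have : 0 < 1 - t := by linarith
    positivity

/-- The complement of a triangle is connected. -/
theorem isPreconnected_compl_triHull {a b c : ℂ} (h : 0 < det3 a b c) :
    IsPreconnected (triHull a b c)ᶜ := by
  have e : (triHull a b c)ᶜ = ({p | det3 a b p < 0} ∪ {p | det3 b c p < 0}) ∪
      {p | det3 c a p < 0} := by
    ext p
    rw [Set.mem_compl_iff, mem_triHull_iff h]
    simp only [Set.mem_union, Set.mem_ofPred_eq, ← not_le]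
    tauto
  have hm : ∀ {a b c : ℂ}, 0 < det3 a b c →
      (({p | det3 a b p < 0} : Set ℂ) ∩ {p | det3 b c p < 0}).Nonempty := by
    intro a b c h
    refine ⟨(2 : ℝ) • b + (-1 : ℝ) • ((1 / 2 : ℝ) • a + (1 / 2 : ℝ) • c), ?_, ?_⟩ <;>
    · rw [Set.mem_ofPred_eq, det3_combo _ _ _ _ (by norm_num), det3_combo _ _ _ _ (by norm_num)]
      simp only [det3_self_mid, det3_self_right, det3_rotate a b c]
      linarith
  rw [e]
  have h2 : 0 < det3 b c a := by rw [det3_rotate]; exact h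
  refine IsPreconnected.union' ?_ (IsPreconnected.union' (hm h) (convex_det3_neg a b).isPreconnected
    (convex_det3_neg b c).isPreconnected) (convex_det3_neg c a).isPreconnected
  obtain ⟨p, hp1, hp2⟩ := hm h2
  exact ⟨p, Or.inr hp1, hp2⟩

/-- Attaching a triangle `r s y` to a closed set `P` along the edge `r s` keeps the complement
connected. The larger triangle `r s y'`, which is still disjoint from `P` apart from the edge, provides
a connected collar around the two free sides. -/
theorem IsPreconnected.compl_union_triHull {P : Set ℂ} (hPc : IsClosed P)
    (hP : IsPreconnected Pᶜ) {r s y y' : ℂ} (hrs : segment ℝ r s ⊆ P)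
    (hy' : triHull r s y' ∩ P ⊆ segment ℝ r s) (hy : y ∈ openTri r s y') :
    IsPreconnected (P ∪ triHull r s y)ᶜ := by
  obtain ⟨hy1, hy2, hy3⟩ := id hy
  have hd := det3_pos_of_mem_openTri hy
  have e : (P ∪ triHull r s y)ᶜ = Pᶜ \ triHull r s y := by
    rw [Set.compl_union]; rfl
  have e1 : det3 s y y' = -det3 s y' y := det3_swap' s y' y
  have e2 : det3 y r y' = -det3 y' r y := by simp only [det3]; ring
  rw [e]
  refine hP.diff_of_collar hPc.isOpen_compl (isClosed_triHull r s y) (isOpen_openTri r s y') ?_ ?_ ?_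
  · rintro p ⟨hp, hpT⟩
    rw [← triHull_rotate, ← triHull_rotate] at hpT
    obtain ⟨_, ⟨u, v, hu, hv, huv, rfl⟩, ⟨w, t, hw, ht, hwt, rfl⟩⟩ :=
      exists_mem_segment_of_mem_triHull hpT
    have hw' : 0 < w := by
      refine lt_of_le_of_ne hw fun h0 => hp (hrs ?_)
      subst h0
      obtain rfl : t = 1 := by linarith
      rw [zero_smul, zero_add, one_smul]
      exact ⟨u, v, hu, hv, huv, rfl⟩
    have hd2 : 0 < det3 s y' r := by rw [det3_rotate]; exact hd
    have hd3 : 0 < det3 y' r s := by rw [← det3_rotate]; exact hd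
    refine ⟨?_, ?_, ?_⟩ <;>
    · rw [det3_combo _ _ _ _ hwt, det3_combo _ _ _ _ huv]
      simp only [det3_self_mid, det3_self_right, mul_zero, add_zero, zero_add]
      positivity
  · intro p hp hpP
    have := hy' ⟨openTri_subset_triHull _ _ _ hp, hpP⟩
    obtain ⟨u, v, -, -, huv, rfl⟩ := this
    have h1 := hp.1
    rw [det3_combo _ _ _ _ huv] at h1
    simp at h1
  · have e3 : openTri r s y' \ triHull r s y = (openTri r s y' ∩ {p | det3 s y p < 0}) ∪
        (openTri r s y' ∩ {p | det3 y r p < 0}) := by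
      ext p
      simp only [Set.mem_sdiff, Set.mem_union, Set.mem_inter_iff, mem_triHull_iff hy1,
        Set.mem_ofPred_eq, ← not_le]
      constructor
      · rintro ⟨h1, h2⟩
        have := h1.1.le
        tauto
      · rintro (⟨h1, h2⟩ | ⟨h1, h2⟩) <;> exact ⟨h1, by tauto⟩
    rw [e3]
    refine IsPreconnected.union' ?_ ((convex_openTri _ _ _).inter (convex_det3_neg s y)).isPreconnected
      ((convex_openTri _ _ _).inter (convex_det3_neg y r)).isPreconnected
    refine ⟨(1 / 2 : ℝ) • y + (1 / 2 : ℝ) • y', ⟨⟨?_, ?_, ?_⟩, ?_⟩, ⟨⟨?_, ?_, ?_⟩, ?_⟩⟩ <;>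
    · try rw [Set.mem_ofPred_eq]
      rw [det3_combo _ _ _ _ (by norm_num)]
      try simp only [det3_self_mid, det3_self_right, e1, e2]
      linarith

/-! ### Patches: unions of cells -/

namespace PlaneGraph

variable {V : Type*} (G : PlaneGraph V)

/-- The triangle `a b c` is a cell with corners in `S`. -/
def CellIn (S : Set V) (a b c : V) : Prop := a ∈ S ∧ b ∈ S ∧ c ∈ S ∧ G.Cell a b c

/-- The vertex set `S` is the union of cells and their centres, where the cells with corners in `S`
form a connected part of the triangulated outer polygon. The connectedness is expressed by
`side_eq`: an edge at which a cell is missing does not separate the vertices of `S`. The condition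
`corner` says that a cell with missing cells at two of its edges `u v` and `u w` is the only cell of
the patch at their common corner `u`. -/
structure IsPatch (S : Set V) : Prop where
  exists_cell : ∀ u v, u ∈ S → v ∈ S → G.graph.Adj u v →
    ∃ a b c, G.CellIn S a b c ∧ G.InCell u a b c ∧ G.InCell v a b c
  exists_adj : ∀ u ∈ S, ∃ v ∈ S, G.graph.Adj u v
  ctr_mem : ∀ m a b c, G.Cell a b c → G.Ctr m a b c → (m ∈ S ↔ a ∈ S ∧ b ∈ S ∧ c ∈ S)
  side_eq : ∀ a b c, G.Cell a b c → c ∉ S → ∀ side : V → ZMod 2,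
    (∀ u v, G.graph.Adj u v → u ≠ a → u ≠ b → v ≠ a → v ≠ b → side u = side v) →
    ∀ u ∈ S, ∀ v ∈ S, u ≠ a → u ≠ b → v ≠ a → v ≠ b → side u = side v
  corner : ∀ σ u v w, G.SCell σ u v w → u ∈ S → v ∈ S → w ∈ S →
    (∃ c, c ∉ S ∧ G.SCell (-σ) u v c) → (∃ c, c ∉ S ∧ G.SCell σ u w c) →
    ∀ x ∈ S, G.graph.Adj u x → x = v ∨ x = w ∨ G.Ctr x u v w ∨ G.Ctr x u w v

/-- The patch `S` together with the vertices of the cell `p q z` at its edge `p q`. -/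
def extend (S : Set V) (p q z : V) : Set V := {v | v ∈ S ∨ v = z ∨ G.Ctr v p q z}

variable {G} [Finite V]

theorem subset_extend (S : Set V) (p q z : V) : S ⊆ G.extend S p q z := fun _ h => Or.inl h

section

variable (hbi : G.Biconnected) (hch : G.InnerChordal)

include hbi hch

theorem CellIn.rotate {S : Set V} {a b c : V} (h : G.CellIn S a b c) : G.CellIn S b c a :=
  ⟨h.2.1, h.2.2.1, h.1, h.2.2.2.rotate hbi hch⟩

theorem IsPatch.exists_ctr {S : Set V} (hS : G.IsPatch S) {m : V} (hm : m ∈ S) (h : ¬ G.Out m) :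
    ∃ a b c, G.CellIn S a b c ∧ G.Ctr m a b c := by
  obtain ⟨v, hv, hadj⟩ := hS.exists_adj m hm
  obtain ⟨a, b, c, hc, h1, -⟩ := hS.exists_cell m v hm hv hadj
  refine ⟨a, b, c, hc, ?_⟩
  rcases h1 with rfl | rfl | rfl | h1
  · exact absurd hc.2.2.2.1 h
  · exact absurd hc.2.2.2.2.1 h
  · exact absurd hc.2.2.2.2.2.1 h
  · exact h1

section

variable {S : Set V} (hS : G.IsPatch S) {p q z x : V} (hp : p ∈ S) (hq : q ∈ S) (hz : z ∉ S)
  (hx : x ∈ S) (hcz : G.Cell p q z) (hcx : G.Cell q p x)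

include hS hp hq hz hx hcz hcx

/-- The new corner of an attached cell is adjacent to no other vertex of the patch than the ends of
the edge at which the cell is attached. -/
theorem IsPatch.eq_or_eq {w : V} (hw : w ∈ S) (h : G.graph.Adj z w) : w = p ∨ w = q := by
  by_contra hcon
  push Not at hcon
  obtain ⟨side, h1, h2⟩ := hcz.exists_side hbi hch hcx
  have e1 := h2 z w h (hcz.adj'' hbi hch).ne (hcz.adj' hbi hch).ne' hcon.1 hcon.2
  have e2 := hS.side_eq p q z hcz hz side h2 w hw x hx hcon.1 hcon.2 (hcx.adj' hbi hch).ne'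
    (hcx.adj'' hbi hch).ne
  exact h1 (e1.trans e2)

theorem IsPatch.ctr_not_mem {m : V} (hm : G.Ctr m p q z) : m ∉ S := fun h =>
  hz ((hS.ctr_mem m p q z hcz hm).1 h).2.2

/-- The only cell that is added to the patch is the attached one. -/
theorem IsPatch.cellIn_extend {a b c : V} (h : G.CellIn (G.extend S p q z) a b c) :
    G.CellIn S a b c ∨ (a = p ∧ b = q ∧ c = z) ∨ (a = q ∧ b = z ∧ c = p) ∨
      (a = z ∧ b = p ∧ c = q) := by
  have key : ∀ {a b}, G.CellIn (G.extend S p q z) a b z → a = p ∧ b = q := by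
    rintro a b ⟨ha, hb, -, hab⟩
    have ha' : a ∈ S := by
      rcases ha with h1 | rfl | h1
      · exact h1
      · exact absurd rfl (hab.adj'' hbi hch).ne
      · exact absurd hab.1 h1.1
    have hb' : b ∈ S := by
      rcases hb with h1 | rfl | h1
      · exact h1
      · exact absurd rfl (hab.adj' hbi hch).ne
      · exact absurd hab.2.1 h1.1
    rcases hS.eq_or_eq hbi hch hp hq hz hx hcz hcx ha' (hab.adj'' hbi hch) with rfl | rfl <;>
      rcases hS.eq_or_eq hbi hch hp hq hz hx hcz hcx hb' (hab.adj' hbi hch).symm with rfl | rfl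
    · exact absurd rfl (hab.adj hbi hch).ne
    · exact ⟨rfl, rfl⟩
    · exact absurd hab (hcz.not_swap hbi hch)
    · exact absurd rfl (hab.adj hbi hch).ne
  have mem : ∀ {y}, y ∈ G.extend S p q z → G.Out y → y ∈ S ∨ y = z := by
    rintro y (h1 | h1 | h1) hy
    · exact Or.inl h1
    · exact Or.inr h1
    · exact absurd hy h1.1
  rcases mem h.1 h.2.2.2.1 with h1 | rfl
  · rcases mem h.2.1 h.2.2.2.2.1 with h2 | rfl
    · rcases mem h.2.2.1 h.2.2.2.2.2.1 with h3 | rfl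
      · exact Or.inl ⟨h1, h2, h3, h.2.2.2⟩
      · obtain ⟨rfl, rfl⟩ := key h
        exact Or.inr (Or.inl ⟨rfl, rfl, rfl⟩)
    · obtain ⟨rfl, rfl⟩ := key ((h.rotate hbi hch).rotate hbi hch)
      exact Or.inr (Or.inr (Or.inl ⟨rfl, rfl, rfl⟩))
  · obtain ⟨rfl, rfl⟩ := key (h.rotate hbi hch)
    exact Or.inr (Or.inr (Or.inr ⟨rfl, rfl, rfl⟩))

theorem IsPatch.cellIn_extend_self : G.CellIn (G.extend S p q z) p q z :=
  ⟨Or.inl hp, Or.inl hq, Or.inr (Or.inl rfl), hcz⟩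

/-- A new edge lies in the attached cell. -/
theorem IsPatch.inCell_of_adj {u v : V} (hu : u ∈ G.extend S p q z) (hv : v ∈ G.extend S p q z)
    (h : G.graph.Adj u v) (hn : ¬ (u ∈ S ∧ v ∈ S)) : G.InCell u p q z ∧ G.InCell v p q z := by
  have key : ∀ {u v : V}, u ∈ G.extend S p q z → v ∈ G.extend S p q z → G.graph.Adj u v → u ∉ S →
      G.InCell u p q z ∧ G.InCell v p q z := by
    intro u v hu hv h hu'
    rcases hu with hu | rfl | hu
    · exact absurd hu hu'
    · refine ⟨Or.inr (Or.inr (Or.inl rfl)), ?_⟩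
      rcases hv with hv | rfl | hv
      · rcases hS.eq_or_eq hbi hch hp hq hz hx hcz hcx hv h with h1 | h1
        · exact Or.inl h1
        · exact Or.inr (Or.inl h1)
      · exact absurd rfl h.ne
      · exact Or.inr (Or.inr (Or.inr hv))
    · refine ⟨Or.inr (Or.inr (Or.inr hu)), ?_⟩
      rcases (hu.adj hbi hch).1 h with h1 | h1 | h1
      · exact Or.inl h1
      · exact Or.inr (Or.inl h1)
      · exact Or.inr (Or.inr (Or.inl h1))
  by_cases hu' : u ∈ S
  · have hv' : v ∉ S := fun hv' => hn ⟨hu', hv'⟩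
    exact (key hv hu h.symm hv').symm
  · exact key hu hv h hu'

theorem IsPatch.scell_mem {τ : ℝ} {c : V} (h : G.SCell τ p q c ∨ G.SCell τ q p c) :
    c ∈ G.extend S p q z := by
  have key : ∀ {τ : ℝ}, G.SCell τ p q c → c ∈ G.extend S p q z := by
    rintro τ (⟨-, h⟩ | ⟨-, h⟩)
    · exact Or.inr (Or.inl (h.unique hbi hch hcz))
    · rw [h.unique hbi hch hcx]
      exact Or.inl hx
  rcases h with h | h
  · exact key h
  · exact key h.swap

/-- Attaching a cell to a patch gives a patch. -/
theorem IsPatch.extend : G.IsPatch (G.extend S p q z) where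
  exists_cell u v hu hv h := by
    by_cases hn : u ∈ S ∧ v ∈ S
    · obtain ⟨a, b, c, ⟨h1, h2, h3, h4⟩, h5⟩ := hS.exists_cell u v hn.1 hn.2 h
      exact ⟨a, b, c, ⟨Or.inl h1, Or.inl h2, Or.inl h3, h4⟩, h5⟩
    · exact ⟨p, q, z, hS.cellIn_extend_self hbi hch hp hq hz hx hcz hcx,
        hS.inCell_of_adj hbi hch hp hq hz hx hcz hcx hu hv h hn⟩
  exists_adj u hu := by
    rcases hu with hu | rfl | hu
    · obtain ⟨v, hv, h⟩ := hS.exists_adj u hu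
      exact ⟨v, Or.inl hv, h⟩
    · exact ⟨p, Or.inl hp, hcz.adj'' hbi hch⟩
    · exact ⟨p, Or.inl hp, (hu.adj hbi hch).2 (Or.inl rfl)⟩
  ctr_mem m a b c hc hm := by
    constructor
    · rintro (h | rfl | h)
      · obtain ⟨h1, h2, h3⟩ := (hS.ctr_mem m a b c hc hm).1 h
        exact ⟨Or.inl h1, Or.inl h2, Or.inl h3⟩
      · exact absurd hcz.2.2.1 hm.1
      · have h1 : p ∈ G.extend S p q z := Or.inl hp
        have h2 : q ∈ G.extend S p q z := Or.inl hq
        have h3 : z ∈ G.extend S p q z := Or.inr (Or.inl rfl)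
        rcases h.eq_or hbi hch hm with ⟨rfl, rfl, rfl⟩ | ⟨rfl, rfl, rfl⟩ | ⟨rfl, rfl, rfl⟩ <;>
          simp only [h1, h2, h3, and_self]
    · rintro ⟨h1, h2, h3⟩
      rcases hS.cellIn_extend hbi hch hp hq hz hx hcz hcx ⟨h1, h2, h3, hc⟩ with
        h | ⟨rfl, rfl, rfl⟩ | ⟨rfl, rfl, rfl⟩ | ⟨rfl, rfl, rfl⟩
      · exact Or.inl ((hS.ctr_mem m a b c hc hm).2 ⟨h.1, h.2.1, h.2.2.1⟩)
      · exact Or.inr (Or.inr hm)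
      · exact Or.inr (Or.inr hm.rotate.rotate)
      · exact Or.inr (Or.inr hm.rotate)
  side_eq a b c hc hcS side hside := by
    -- every vertex of the larger patch is on the side of a vertex of `S`
    have hne : ¬ ((p = a ∨ p = b) ∧ (q = a ∨ q = b)) := by
      rintro ⟨rfl | rfl, rfl | rfl⟩
      · exact (hcz.adj hbi hch).ne rfl
      · exact hcS (hS.scell_mem hbi hch hp hq hz hx hcz hcx (τ := 1) (Or.inl (Or.inl ⟨rfl, hc⟩)))
      · exact hcS (hS.scell_mem hbi hch hp hq hz hx hcz hcx (τ := 1) (Or.inr (Or.inl ⟨rfl, hc⟩)))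
      · exact (hcz.adj hbi hch).ne rfl
    have key : ∀ u ∈ G.extend S p q z, u ≠ a → u ≠ b →
        ∃ u' ∈ S, u' ≠ a ∧ u' ≠ b ∧ side u = side u' := by
      intro u hu hua hub
      by_cases hu' : u ∈ S
      · exact ⟨u, hu', hua, hub, rfl⟩
      · have hup : G.graph.Adj u p ∧ G.graph.Adj u q := by
          rcases hu with hu | rfl | hu
          · exact absurd hu hu'
          · exact ⟨hcz.adj'' hbi hch, (hcz.adj' hbi hch).symm⟩
          · exact ⟨(hu.adj hbi hch).2 (by simp), (hu.adj hbi hch).2 (by simp)⟩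
        by_cases hpab : p = a ∨ p = b
        · have hqab : ¬ (q = a ∨ q = b) := fun h => hne ⟨hpab, h⟩
          push Not at hqab
          exact ⟨q, hq, hqab.1, hqab.2, hside _ _ hup.2 hua hub hqab.1 hqab.2⟩
        · push Not at hpab
          exact ⟨p, hp, hpab.1, hpab.2, hside _ _ hup.1 hua hub hpab.1 hpab.2⟩
    intro u hu v hv hua hub hva hvb
    obtain ⟨u', hu', h1, h2, h3⟩ := key u hu hua hub
    obtain ⟨v', hv', h4, h5, h6⟩ := key v hv hva hvb
    rw [h3, h6]
    exact hS.side_eq a b c hc (fun h => hcS (Or.inl h)) side hside u' hu' v' hv' h1 h2 h4 h5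
  corner σ u v w hc hu hv hw hbv hbw y hy hadj := by
    obtain ⟨c, hcS, hc1⟩ := hbv
    obtain ⟨d, hdS, hd1⟩ := hbw
    obtain ⟨hou, hov, how⟩ := hc.out
    -- the edge at which the cell is attached is not an edge at the corner
    have hnp : u = p → q ≠ v ∧ q ≠ w := by
      rintro rfl
      refine ⟨?_, ?_⟩ <;> rintro rfl
      · exact hcS (hS.scell_mem hbi hch hp hq hz hx hcz hcx (Or.inl hc1))
      · exact hdS (hS.scell_mem hbi hch hp hq hz hx hcz hcx (Or.inl hd1))
    have hnq : u = q → p ≠ v ∧ p ≠ w := by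
      rintro rfl
      refine ⟨?_, ?_⟩ <;> rintro rfl
      · exact hcS (hS.scell_mem hbi hch hp hq hz hx hcz hcx (Or.inr hc1))
      · exact hdS (hS.scell_mem hbi hch hp hq hz hx hcz hcx (Or.inr hd1))
    have hcell : G.CellIn (G.extend S p q z) u v w ∨ G.CellIn (G.extend S p q z) v u w := by
      rcases hc with ⟨-, h⟩ | ⟨-, h⟩
      · exact Or.inl ⟨hu, hv, hw, h⟩
      · exact Or.inr ⟨hv, hu, hw, h⟩
    have hcase : (u ∈ S ∧ v ∈ S ∧ w ∈ S) ∨ (u = z ∧ ((v = p ∧ w = q) ∨ (v = q ∧ w = p))) := by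
      rcases hcell with h | h
      · rcases hS.cellIn_extend hbi hch hp hq hz hx hcz hcx h with
          h | ⟨h1, h2, h3⟩ | ⟨h1, h2, h3⟩ | ⟨h1, h2, h3⟩
        · exact Or.inl ⟨h.1, h.2.1, h.2.2.1⟩
        · exact absurd h2.symm (hnp h1).1
        · exact absurd h3.symm (hnq h1).2
        · exact Or.inr ⟨h1, Or.inl ⟨h2, h3⟩⟩
      · rcases hS.cellIn_extend hbi hch hp hq hz hx hcz hcx h with
          h | ⟨h1, h2, h3⟩ | ⟨h1, h2, h3⟩ | ⟨h1, h2, h3⟩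
        · exact Or.inl ⟨h.2.1, h.1, h.2.2.1⟩
        · exact absurd h1.symm (hnq h2).1
        · exact Or.inr ⟨h2, Or.inr ⟨h1, h3⟩⟩
        · exact absurd h3.symm (hnp h2).2
    rcases hcase with ⟨hu', hv', hw'⟩ | ⟨rfl, h⟩
    · have hold := hS.corner σ u v w hc hu' hv' hw' ⟨c, fun h => hcS (Or.inl h), hc1⟩
        ⟨d, fun h => hdS (Or.inl h), hd1⟩
      by_cases hy' : y ∈ S
      · exact hold y hy' hadj
      · exfalso
        have hupq : u = p ∨ u = q := by
          rcases hy with hy | rfl | hy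
          · exact absurd hy hy'
          · exact hS.eq_or_eq hbi hch hp hq hz hx hcz hcx hu' hadj.symm
          · rcases (hy.adj hbi hch).1 hadj.symm with h | h | h
            · exact Or.inl h
            · exact Or.inr h
            · rw [h] at hu'
              exact absurd hu' hz
        rcases hupq with rfl | rfl
        · rcases hold q hq (hcz.adj hbi hch) with h | h | h | h
          · exact (hnp rfl).1 h
          · exact (hnp rfl).2 h
          · exact h.1 hcz.2.1
          · exact h.1 hcz.2.1
        · rcases hold p hp (hcz.adj hbi hch).symm with h | h | h | h
          · exact (hnq rfl).1 h
          · exact (hnq rfl).2 h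
          · exact h.1 hcz.1
          · exact h.1 hcz.1
    · have hin := (hS.inCell_of_adj hbi hch hp hq hz hx hcz hcx hu hy hadj fun h => hz h.1).2
      have := hadj.ne'
      rcases hin with rfl | rfl | rfl | hin
      · rcases h with ⟨rfl, rfl⟩ | ⟨rfl, rfl⟩ <;> simp
      · rcases h with ⟨rfl, rfl⟩ | ⟨rfl, rfl⟩ <;> simp
      · exact absurd rfl this
      · rcases h with ⟨rfl, rfl⟩ | ⟨rfl, rfl⟩
        · exact Or.inr (Or.inr (Or.inl hin.rotate.rotate))
        · exact Or.inr (Or.inr (Or.inr hin.rotate.rotate))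

end

theorem Cell.eq_or {p q z a b c : V} (h : G.Cell p q z) (h' : G.CellIn {v | G.InCell v p q z} a b c) :
    (a = p ∧ b = q ∧ c = z) ∨ (a = q ∧ b = z ∧ c = p) ∨ (a = z ∧ b = p ∧ c = q) := by
  obtain ⟨ha, hb, hc, hcell⟩ := h'
  have h1 := (hcell.adj hbi hch).ne
  have h2 := (hcell.adj' hbi hch).ne
  have h3 := (hcell.adj'' hbi hch).ne
  have h4 := h.not_swap hbi hch
  have h5 := (h.rotate hbi hch).not_swap hbi hch
  have h6 := ((h.rotate hbi hch).rotate hbi hch).not_swap hbi hch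
  rcases InCell.eq_of_out ha hcell.1 with rfl | rfl | rfl <;>
    rcases InCell.eq_of_out hb hcell.2.1 with rfl | rfl | rfl <;>
    rcases InCell.eq_of_out hc hcell.2.2.1 with rfl | rfl | rfl <;>
    first
    | exact absurd rfl h1
    | exact absurd rfl h2
    | exact absurd rfl h3
    | exact absurd hcell h4
    | exact absurd hcell h5
    | exact absurd hcell h6
    | simp

theorem InCell.adj {p q z u v : V} (h : G.Cell p q z) (hu : G.InCell u p q z)
    (hv : G.InCell v p q z) (huv : u ≠ v) : G.graph.Adj u v := by
  have h1 := h.adj hbi hch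
  have h2 := h.adj' hbi hch
  have h3 := h.adj'' hbi hch
  have key : ∀ {u v : V}, G.Ctr u p q z → G.InCell v p q z → u ≠ v → G.graph.Adj u v := by
    intro u v hu hv huv
    rcases hv with hv | hv | hv | hv
    · exact (hu.adj hbi hch).2 (Or.inl hv)
    · exact (hu.adj hbi hch).2 (Or.inr (Or.inl hv))
    · exact (hu.adj hbi hch).2 (Or.inr (Or.inr hv))
    · exact absurd (hu.2.1.unique hv.2.1) huv
  rcases id hu with hu' | hu' | hu' | hu'
  on_goal 4 => exact key hu' hv huv
  all_goals
    rcases id hv with hv' | hv' | hv' | hv'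
    on_goal 4 => exact (key hv' hu huv.symm).symm
    all_goals
      subst hu' hv'
      first
      | exact absurd rfl huv
      | assumption
      | exact h1.symm
      | exact h2.symm
      | exact h3.symm

/-- A single cell is a patch. -/
theorem Cell.isPatch {p q z : V} (h : G.Cell p q z) : G.IsPatch {v | G.InCell v p q z} where
  exists_cell u v hu hv _ := ⟨p, q, z, ⟨Or.inl rfl, Or.inr (Or.inl rfl), Or.inr (Or.inr (Or.inl rfl)),
    h⟩, hu, hv⟩
  exists_adj u hu := by
    rcases hu with rfl | rfl | rfl | hu
    · exact ⟨q, Or.inr (Or.inl rfl), h.adj hbi hch⟩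
    · exact ⟨z, Or.inr (Or.inr (Or.inl rfl)), h.adj' hbi hch⟩
    · exact ⟨p, Or.inl rfl, h.adj'' hbi hch⟩
    · exact ⟨p, Or.inl rfl, (hu.adj hbi hch).2 (Or.inl rfl)⟩
  ctr_mem m a b c hc hm := by
    constructor
    · intro hmS
      rcases hmS with rfl | rfl | rfl | hm'
      · exact absurd h.1 hm.1
      · exact absurd h.2.1 hm.1
      · exact absurd h.2.2.1 hm.1
      · rcases hm'.eq_or hbi hch hm with ⟨rfl, rfl, rfl⟩ | ⟨rfl, rfl, rfl⟩ | ⟨rfl, rfl, rfl⟩ <;>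
          simp [InCell]
    · rintro ⟨h1, h2, h3⟩
      refine Or.inr (Or.inr (Or.inr ?_))
      rcases h.eq_or hbi hch ⟨h1, h2, h3, hc⟩ with ⟨rfl, rfl, rfl⟩ | ⟨rfl, rfl, rfl⟩ | ⟨rfl, rfl, rfl⟩
      exacts [hm, hm.rotate.rotate, hm.rotate]
  side_eq a b c hc hcS side hside u hu v hv hua hub hva hvb := by
    by_cases huv : u = v
    · rw [huv]
    · exact hside u v (InCell.adj hbi hch h hu hv huv) hua hub hva hvb
  corner σ u v w hc hu hv hw hbv hbw y hy hadj := by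
    have hne := hadj.ne'
    rcases hc with ⟨-, hc⟩ | ⟨-, hc⟩
    · have hy' : G.InCell y u v w := by
        rcases h.eq_or hbi hch ⟨hu, hv, hw, hc⟩ with
          ⟨rfl, rfl, rfl⟩ | ⟨rfl, rfl, rfl⟩ | ⟨rfl, rfl, rfl⟩
        exacts [hy, hy.rotate, hy.rotate.rotate]
      rcases hy' with h1 | h1 | h1 | h1
      · exact absurd h1 hne
      · exact Or.inl h1
      · exact Or.inr (Or.inl h1)
      · exact Or.inr (Or.inr (Or.inl h1))
    · have hy' : G.InCell y v u w := by
        rcases h.eq_or hbi hch ⟨hv, hu, hw, hc⟩ with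
          ⟨rfl, rfl, rfl⟩ | ⟨rfl, rfl, rfl⟩ | ⟨rfl, rfl, rfl⟩
        exacts [hy, hy.rotate, hy.rotate.rotate]
      rcases hy' with h1 | h1 | h1 | h1
      · exact Or.inl h1
      · exact absurd h1 hne
      · exact Or.inr (Or.inl h1)
      · exact Or.inr (Or.inr (Or.inr h1.rotate))

end

end PlaneGraph

/-! ### Drawings of patches -/

theorem det3_eq_zero_of_mem_segment {a b p : ℂ} (h : p ∈ segment ℝ a b) : det3 a b p = 0 := by
  obtain ⟨s, t, -, -, hst, rfl⟩ := h
  rw [det3_combo _ _ _ _ hst]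
  simp

/-- Two segments from the same point in different directions have only this point in common. -/
theorem eq_of_mem_segment_of_mem_segment {x a b p : ℂ} (h : det3 x a b ≠ 0)
    (ha : p ∈ segment ℝ x a) (hb : p ∈ segment ℝ x b) : p = x := by
  have h1 := det3_eq_zero_of_mem_segment ha
  obtain ⟨s, t, -, -, hst, rfl⟩ := hb
  rw [det3_combo _ _ _ _ hst, det3_self_mid, mul_zero, zero_add] at h1
  rcases mul_eq_zero.1 h1 with rfl | h1
  · obtain rfl : s = 1 := by linarith
    simp
  · exact absurd h1 h

theorem disjoint_segment_of_det3_pos {a b x y p : ℂ} (hx : 0 < det3 a b x) (hy : 0 < det3 a b y)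
    (hp : p ∈ segment ℝ a b) : p ∉ segment ℝ x y := by
  intro hp'
  have h1 := det3_eq_zero_of_mem_segment hp
  have h2 := (convex_det3_pos a b).segment_subset hx hy hp'
  rw [Set.mem_ofPred_eq, h1] at h2
  exact lt_irrefl _ h2

namespace PlaneGraph

variable {V : Type*} (G : PlaneGraph V)

/-- The part of the plane covered by the cells with corners in `S`. -/
def region (S : Set V) (pos : V → ℂ) : Set ℂ :=
  ⋃ t ∈ {t : V × V × V | G.CellIn S t.1 t.2.1 t.2.2}, triHull (pos t.1) (pos t.2.1) (pos t.2.2)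

/-- The positions `pos` are a drawing of the patch `S` that represents the induced subgraph on `S`:
non-adjacent vertices of `S` see the complement of the drawn cells, which is connected. The
condition `meet` says that the cells and edges do not overlap. -/
structure IsDrawing (S : Set V) (pos : V → ℂ) : Prop where
  inj : ∀ u ∈ S, ∀ v ∈ S, pos u = pos v → u = v
  det3_ne : ∀ u ∈ S, ∀ v ∈ S, ∀ w ∈ S, u ≠ v → u ≠ w → v ≠ w →
    det3 (pos u) (pos v) (pos w) ≠ 0
  cell_pos : ∀ a b c, G.CellIn S a b c → 0 < det3 (pos a) (pos b) (pos c)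
  ctr_pos : ∀ m a b c, G.CellIn S a b c → G.Ctr m a b c → 0 < det3 (pos a) (pos b) (pos m)
  meet : ∀ u ∈ S, ∀ v ∈ S, G.graph.Adj u v → ∀ a b c, G.CellIn S a b c →
    ¬ (G.InCell u a b c ∧ G.InCell v a b c) → ∀ p ∈ segment ℝ (pos u) (pos v),
    p ∈ triHull (pos a) (pos b) (pos c) → ∃ x, (x = u ∨ x = v) ∧ G.InCell x a b c ∧ p = pos x
  conn : IsPreconnected (G.region S pos)ᶜ
  nonedge : ∀ u ∈ S, ∀ v ∈ S, u ≠ v → ¬ G.graph.Adj u v →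
    ∃ p ∈ segment ℝ (pos u) (pos v), p ∉ G.region S pos

variable {G}

theorem mem_region {S : Set V} {pos : V → ℂ} {p : ℂ} :
    p ∈ G.region S pos ↔ ∃ a b c, G.CellIn S a b c ∧ p ∈ triHull (pos a) (pos b) (pos c) := by
  simp only [region, Set.mem_iUnion, Set.mem_ofPred_eq, exists_prop, Prod.exists]

variable [Finite V]

theorem isCompact_region (S : Set V) (pos : V → ℂ) : IsCompact (G.region S pos) :=
  (Set.toFinite _).isCompact_biUnion fun _ _ => isCompact_triHull _ _ _

section

variable (hbi : G.Biconnected) (hch : G.InnerChordal)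

include hbi hch

section

variable {S : Set V} {pos : V → ℂ} (hS : G.IsPatch S) (hD : G.IsDrawing S pos)

include hD

theorem IsDrawing.ctr_mem_openTri {a b c m : V} (h : G.CellIn S a b c) (hm : G.Ctr m a b c) :
    pos m ∈ openTri (pos a) (pos b) (pos c) :=
  have h' := h.rotate hbi hch
  ⟨hD.ctr_pos m a b c h hm, hD.ctr_pos m b c a h' hm.rotate,
    hD.ctr_pos m c a b (h'.rotate hbi hch) hm.rotate.rotate⟩

theorem IsDrawing.mem_triHull_of_inCell {a b c x : V} (h : G.CellIn S a b c)
    (hx : G.InCell x a b c) : pos x ∈ triHull (pos a) (pos b) (pos c) := by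
  rcases hx with rfl | rfl | rfl | hx
  · exact left_mem_triHull _ _ _
  · exact mid_mem_triHull _ _ _
  · exact right_mem_triHull _ _ _
  · exact openTri_subset_triHull _ _ _ (hD.ctr_mem_openTri hbi hch h hx)

include hS

theorem IsDrawing.inCell_of_mem_triHull {a b c u : V} (h : G.CellIn S a b c) (hu : u ∈ S)
    (hp : pos u ∈ triHull (pos a) (pos b) (pos c)) : G.InCell u a b c := by
  by_contra hn
  obtain ⟨v, hv, hadj⟩ := hS.exists_adj u hu
  obtain ⟨x, hx, hx', he⟩ := hD.meet u hu v hv hadj a b c h (fun h => hn h.1) _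
    (left_mem_segment ℝ _ _) hp
  have hxS : x ∈ S := by rcases hx with rfl | rfl <;> assumption
  rw [hD.inj u hu x hxS he] at hn
  exact hn hx'

theorem IsDrawing.segment_subset_region {u v : V} (hu : u ∈ S) (hv : v ∈ S)
    (h : G.graph.Adj u v) : segment ℝ (pos u) (pos v) ⊆ G.region S pos := by
  obtain ⟨a, b, c, hc, h1, h2⟩ := hS.exists_cell u v hu hv h
  intro p hp
  exact mem_region.2 ⟨a, b, c, hc, (convex_triHull _ _ _).segment_subset
    (hD.mem_triHull_of_inCell hbi hch hc h1) (hD.mem_triHull_of_inCell hbi hch hc h2) hp⟩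

omit hbi hch hS in
theorem IsDrawing.eq_or_eq_of_mem_segment {u v w : V} (hu : u ∈ S) (hv : v ∈ S) (hw : w ∈ S)
    (huv : u ≠ v) (h : pos w ∈ segment ℝ (pos u) (pos v)) : w = u ∨ w = v := by
  by_contra hcon
  push Not at hcon
  exact hD.det3_ne u hu v hv w hw huv hcon.1.symm hcon.2.symm (det3_eq_zero_of_mem_segment h)

omit hS in
/-- Among the six edges spanned by the corners and the centre of a cell, two without a common
vertex do not cross. -/
theorem IsDrawing.not_mem_of_inCell {a b c u v x y : V} (h : G.CellIn S a b c)
    (hu : G.InCell u a b c) (hv : G.InCell v a b c) (hx : G.InCell x a b c) (hy : G.InCell y a b c)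
    (huv : u ≠ v) (hux : u ≠ x) (huy : u ≠ y) (hvx : v ≠ x) (hvy : v ≠ y) (hxy : x ≠ y) {p : ℂ}
    (hp : p ∈ segment ℝ (pos u) (pos v)) : p ∉ segment ℝ (pos x) (pos y) := by
  -- the edge opposite to an edge at the centre is a side of the cell
  have key : ∀ {m w x y : V}, G.Ctr m a b c → G.InCell w a b c → G.InCell x a b c →
      G.InCell y a b c → m ≠ w → m ≠ x → m ≠ y → w ≠ x → w ≠ y → x ≠ y →
      ∀ p ∈ segment ℝ (pos x) (pos y), p ∉ segment ℝ (pos m) (pos w) := by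
    intro m w x y hm hw hx hy h1 h2 h3 h4 h5 h6 p hp
    have corner : ∀ {x : V}, G.InCell x a b c → m ≠ x → x = a ∨ x = b ∨ x = c := by
      rintro x (h | h | h | h) hmx
      · exact Or.inl h
      · exact Or.inr (Or.inl h)
      · exact Or.inr (Or.inr h)
      · exact absurd (hm.2.1.unique h.2.1) hmx
    have main : ∀ {a b c : V}, G.CellIn S a b c → G.Ctr m a b c →
        (∀ p ∈ segment ℝ (pos a) (pos b), p ∉ segment ℝ (pos m) (pos c)) ∧
        ∀ p ∈ segment ℝ (pos b) (pos a), p ∉ segment ℝ (pos m) (pos c) := by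
      intro a b c hc hm
      have h : ∀ p ∈ segment ℝ (pos a) (pos b), p ∉ segment ℝ (pos m) (pos c) := fun p hp =>
        disjoint_segment_of_det3_pos (hD.ctr_pos m a b c hc hm) (hD.cell_pos a b c hc) hp
      exact ⟨h, by rwa [segment_symm]⟩
    have hr := h.rotate hbi hch
    have hrr := hr.rotate hbi hch
    rcases corner hw h1 with rfl | rfl | rfl <;> rcases corner hx h2 with rfl | rfl | rfl <;>
      rcases corner hy h3 with rfl | rfl | rfl <;>
      first
      | exact absurd rfl h4
      | exact absurd rfl h5
      | exact absurd rfl h6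
      | exact (main h hm).1 p hp
      | exact (main h hm).2 p hp
      | exact (main hr hm.rotate).1 p hp
      | exact (main hr hm.rotate).2 p hp
      | exact (main hrr hm.rotate.rotate).1 p hp
      | exact (main hrr hm.rotate.rotate).2 p hp
  intro hp'
  by_cases hum : G.Ctr u a b c
  · exact key hum hv hx hy huv hux huy hvx hvy hxy p hp' hp
  by_cases hvm : G.Ctr v a b c
  · exact key hvm hu hx hy huv.symm hvx hvy hux huy hxy p hp' (by rwa [segment_symm])
  by_cases hxm : G.Ctr x a b c
  · exact key hxm hy hu hv hxy hux.symm hvx.symm huy.symm hvy.symm huv p hp hp'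
  by_cases hym : G.Ctr y a b c
  · exact key hym hx hu hv hxy.symm huy.symm hvy.symm hux.symm hvx.symm huv p hp
      (by rwa [segment_symm])
  have e : ∀ {x : V}, G.InCell x a b c → ¬ G.Ctr x a b c → x = a ∨ x = b ∨ x = c := by
    rintro x (h | h | h | h) hx
    · exact Or.inl h
    · exact Or.inr (Or.inl h)
    · exact Or.inr (Or.inr h)
    · exact absurd h hx
  rcases e hu hum with rfl | rfl | rfl <;> rcases e hv hvm with rfl | rfl | rfl <;>
    rcases e hx hxm with rfl | rfl | rfl <;> first
      | exact absurd rfl huv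
      | exact absurd rfl hux
      | exact absurd rfl hvx
      | (rcases e hy hym with rfl | rfl | rfl <;> first
          | exact absurd rfl huy
          | exact absurd rfl hvy
          | exact absurd rfl hxy)

/-- Edges of the patch meet only in common ends. -/
theorem IsDrawing.crossing_free {u v x y : V} (hu : u ∈ S) (hv : v ∈ S) (hx : x ∈ S) (hy : y ∈ S)
    (huv : G.graph.Adj u v) (hxy : G.graph.Adj x y) (hne : ¬ ((u = x ∧ v = y) ∨ (u = y ∧ v = x)))
    {p : ℂ} (hp : p ∈ segment ℝ (pos u) (pos v)) (hp' : p ∈ segment ℝ (pos x) (pos y)) :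
    ∃ w, (w = u ∨ w = v) ∧ (w = x ∨ w = y) ∧ p = pos w := by
  have share : ∀ {u v y : V}, u ∈ S → v ∈ S → y ∈ S → u ≠ v → u ≠ y → v ≠ y →
      p ∈ segment ℝ (pos u) (pos v) → p ∈ segment ℝ (pos u) (pos y) → p = pos u :=
    fun hu hv hy h1 h2 h3 => eq_of_mem_segment_of_mem_segment (hD.det3_ne _ hu _ hv _ hy h1 h2 h3)
  have hps : p ∈ segment ℝ (pos v) (pos u) := by rwa [segment_symm]
  have hps' : p ∈ segment ℝ (pos y) (pos x) := by rwa [segment_symm]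
  by_cases hux : u = x
  · subst hux
    exact ⟨u, Or.inl rfl, Or.inl rfl,
      share hu hv hy huv.ne hxy.ne (fun h => hne (Or.inl ⟨rfl, h⟩)) hp hp'⟩
  by_cases huy : u = y
  · subst huy
    exact ⟨u, Or.inl rfl, Or.inr rfl,
      share hu hv hx huv.ne hxy.ne' (fun h => hne (Or.inr ⟨rfl, h⟩)) hp hps'⟩
  by_cases hvx : v = x
  · subst hvx
    exact ⟨v, Or.inr rfl, Or.inl rfl, share hv hu hy huv.ne' hxy.ne huy hps hp'⟩
  by_cases hvy : v = y
  · subst hvy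
    exact ⟨v, Or.inr rfl, Or.inr rfl, share hv hu hx huv.ne' hxy.ne' hux hps hps'⟩
  obtain ⟨a, b, c, hc, h1, h2⟩ := hS.exists_cell x y hx hy hxy
  by_cases hin : G.InCell u a b c ∧ G.InCell v a b c
  · exact absurd hp' (hD.not_mem_of_inCell hbi hch hc hin.1 hin.2 h1 h2 huv.ne hux huy hvx hvy
      hxy.ne hp)
  · obtain ⟨w, hw, hw', rfl⟩ := hD.meet u hu v hv huv a b c hc hin p hp
      ((convex_triHull _ _ _).segment_subset (hD.mem_triHull_of_inCell hbi hch hc h1)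
        (hD.mem_triHull_of_inCell hbi hch hc h2) hp')
    have hwS : w ∈ S := by rcases hw with rfl | rfl <;> assumption
    exact ⟨w, hw, hD.eq_or_eq_of_mem_segment hx hy hwS hxy.ne hp', rfl⟩

end

section

variable {S : Set V} {pos pos' : V → ℂ} (hS : G.IsPatch S) (hD : G.IsDrawing S pos)
  {p q z x : V} (hp : p ∈ S) (hq : q ∈ S) (hz : z ∉ S) (hx : x ∈ S) (hcz : G.Cell p q z)
  (hcx : G.Cell q p x) (hpos : ∀ v ∈ S, pos' v = pos v)

include hS hp hq hz hx hcz hcx hpos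

theorem region_extend : G.region (G.extend S p q z) pos' =
    G.region S pos ∪ triHull (pos p) (pos q) (pos' z) := by
  ext w
  rw [Set.mem_union, mem_region, mem_region]
  constructor
  · rintro ⟨a, b, c, hc, hw⟩
    rcases hS.cellIn_extend hbi hch hp hq hz hx hcz hcx hc with
      h | ⟨rfl, rfl, rfl⟩ | ⟨rfl, rfl, rfl⟩ | ⟨rfl, rfl, rfl⟩
    · refine Or.inl ⟨a, b, c, h, ?_⟩
      rwa [hpos a h.1, hpos b h.2.1, hpos c h.2.2.1] at hw
    · rw [hpos _ hp, hpos _ hq] at hw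
      exact Or.inr hw
    · rw [hpos _ hp, hpos _ hq, triHull_rotate] at hw
      exact Or.inr hw
    · rw [hpos _ hp, hpos _ hq, ← triHull_rotate] at hw
      exact Or.inr hw
  · rintro (⟨a, b, c, h, hw⟩ | hw)
    · refine ⟨a, b, c, ⟨Or.inl h.1, Or.inl h.2.1, Or.inl h.2.2.1, h.2.2.2⟩, ?_⟩
      rwa [hpos a h.1, hpos b h.2.1, hpos c h.2.2.1]
    · refine ⟨p, q, z, hS.cellIn_extend_self hbi hch hp hq hz hx hcz hcx, ?_⟩
      rwa [hpos p hp, hpos q hq]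

include hD

/-- A drawing of a patch is extended to an attached cell if the new triangle meets the drawn cells
only in the edge at which it is attached, and the required pairs still see the complement. -/
theorem IsDrawing.extend (hT : triHull (pos p) (pos q) (pos' z) ∩ G.region S pos ⊆
      segment ℝ (pos p) (pos q))
    (hzpos : 0 < det3 (pos p) (pos q) (pos' z))
    (hzgen : ∀ u ∈ S, ∀ v ∈ S, u ≠ v → det3 (pos u) (pos v) (pos' z) ≠ 0)
    (hm : ∀ m, G.Ctr m p q z → pos' m ∈ openTri (pos p) (pos q) (pos' z))
    (hmgen : ∀ m, G.Ctr m p q z → ∀ u ∈ S, ∀ v ∈ S, u ≠ v → det3 (pos u) (pos v) (pos' m) ≠ 0)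
    (hmgen' : ∀ m, G.Ctr m p q z → ∀ u ∈ S, det3 (pos u) (pos' z) (pos' m) ≠ 0)
    (hconn : IsPreconnected (G.region S pos ∪ triHull (pos p) (pos q) (pos' z))ᶜ)
    (hold : ∀ u ∈ S, ∀ v ∈ S, u ≠ v → ¬ G.graph.Adj u v → ∃ w ∈ segment ℝ (pos u) (pos v),
      w ∉ G.region S pos ∪ triHull (pos p) (pos q) (pos' z))
    (hznon : ∀ v ∈ S, v ≠ p → v ≠ q → ∃ w ∈ segment ℝ (pos' z) (pos v),
      w ∉ G.region S pos ∪ triHull (pos p) (pos q) (pos' z))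
    (hmnon : ∀ m, G.Ctr m p q z → ∀ v ∈ S, v ≠ p → v ≠ q → ∃ w ∈ segment ℝ (pos' m) (pos v),
      w ∉ G.region S pos ∪ triHull (pos p) (pos q) (pos' z)) :
    G.IsDrawing (G.extend S p q z) pos' where
  inj := by
    have hpq := (hcz.adj hbi hch).ne
    have other : ∀ u, ∃ v ∈ S, u ≠ v := fun u => by
      by_cases h : u = p
      · exact ⟨q, hq, by rwa [h]⟩
      · exact ⟨p, hp, h⟩
    have h1 : ∀ u ∈ S, pos u ≠ pos' z := fun u hu h => by
      obtain ⟨v, hv, huv⟩ := other u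
      refine hzgen u hu v hv huv ?_
      rw [← h, det3_self_mid]
    have h2 : ∀ m, G.Ctr m p q z → ∀ u ∈ S, pos u ≠ pos' m := fun m hm u hu h => by
      obtain ⟨v, hv, huv⟩ := other u
      refine hmgen m hm u hu v hv huv ?_
      rw [← h, det3_self_mid]
    have h3 : ∀ m, G.Ctr m p q z → pos' z ≠ pos' m := fun m hm h => by
      refine hmgen' m hm p hp ?_
      rw [← h, det3_self_right]
    rintro u (hu | rfl | hu) v (hv | rfl | hv) h
    · rw [hpos u hu, hpos v hv] at h
      exact hD.inj u hu v hv h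
    · rw [hpos u hu] at h
      exact absurd h (h1 u hu)
    · rw [hpos u hu] at h
      exact absurd h (h2 v hv u hu)
    · rw [hpos v hv] at h
      exact absurd h.symm (h1 v hv)
    · rfl
    · exact absurd h (h3 v hv)
    · rw [hpos v hv] at h
      exact absurd h.symm (h2 u hu v hv)
    · exact absurd h.symm (h3 u hu)
    · exact hu.2.1.unique hv.2.1
  det3_ne := by
    have rot : ∀ {a b c : ℂ}, det3 a b c ≠ 0 → det3 b c a ≠ 0 := fun h => by rwa [det3_rotate]
    have swap : ∀ {a b c : ℂ}, det3 a b c ≠ 0 → det3 b a c ≠ 0 := fun h => by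
      rwa [det3_swap, neg_ne_zero]
    have hz2 : ∀ u ∈ S, ∀ v ∈ S, u ≠ v → det3 (pos' u) (pos' v) (pos' z) ≠ 0 := fun u hu v hv h => by
      rw [hpos u hu, hpos v hv]
      exact hzgen u hu v hv h
    have hm2 : ∀ m, G.Ctr m p q z → ∀ u ∈ S, ∀ v ∈ S, u ≠ v →
        det3 (pos' u) (pos' v) (pos' m) ≠ 0 := fun m hm u hu v hv h => by
      rw [hpos u hu, hpos v hv]
      exact hmgen m hm u hu v hv h
    have hmz : ∀ m, G.Ctr m p q z → ∀ u ∈ S, det3 (pos' u) (pos' z) (pos' m) ≠ 0 :=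
      fun m hm u hu => by
      rw [hpos u hu]
      exact hmgen' m hm u hu
    rintro u (hu | rfl | hu) v (hv | rfl | hv) w (hw | rfl | hw) huv huw hvw
    · rw [hpos u hu, hpos v hv, hpos w hw]
      exact hD.det3_ne u hu v hv w hw huv huw hvw
    · exact hz2 u hu v hv huv
    · exact hm2 w hw u hu v hv huv
    · exact rot (hz2 w hw u hu huw.symm)
    · exact absurd rfl hvw
    · exact hmz w hw u hu
    · exact rot (hm2 v hv w hw u hu huw.symm)
    · exact swap (rot (rot (hmz v hv u hu)))
    · exact absurd (hv.2.1.unique hw.2.1) hvw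
    · exact rot (rot (hz2 v hv w hw hvw))
    · exact absurd rfl huw
    · exact swap (hmz w hw v hv)
    · exact absurd rfl huv
    · exact absurd rfl huv
    · exact absurd rfl huv
    · exact rot (hmz v hv w hw)
    · exact absurd rfl huw
    · exact absurd (hv.2.1.unique hw.2.1) hvw
    · exact rot (rot (hm2 u hu v hv w hw hvw))
    · exact rot (rot (hmz u hu v hv))
    · exact absurd (hu.2.1.unique hw.2.1) huw
    · exact swap (rot (hmz u hu w hw))
    · exact absurd rfl hvw
    · exact absurd (hu.2.1.unique hw.2.1) huw
    · exact absurd (hu.2.1.unique hv.2.1) huv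
    · exact absurd (hu.2.1.unique hv.2.1) huv
    · exact absurd (hu.2.1.unique hv.2.1) huv
  cell_pos a b c h := by
    rcases hS.cellIn_extend hbi hch hp hq hz hx hcz hcx h with
      h | ⟨rfl, rfl, rfl⟩ | ⟨rfl, rfl, rfl⟩ | ⟨rfl, rfl, rfl⟩
    · rw [hpos a h.1, hpos b h.2.1, hpos c h.2.2.1]
      exact hD.cell_pos a b c h
    · rwa [hpos _ hp, hpos _ hq]
    · rwa [hpos _ hp, hpos _ hq, det3_rotate]
    · rwa [hpos _ hp, hpos _ hq, ← det3_rotate]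
  ctr_pos m a b c h hc := by
    rcases hS.cellIn_extend hbi hch hp hq hz hx hcz hcx h with
      h | ⟨rfl, rfl, rfl⟩ | ⟨rfl, rfl, rfl⟩ | ⟨rfl, rfl, rfl⟩
    · rw [hpos a h.1, hpos b h.2.1, hpos m ((hS.ctr_mem m a b c h.2.2.2 hc).2 ⟨h.1, h.2.1, h.2.2.1⟩)]
      exact hD.ctr_pos m a b c h hc
    · rw [hpos _ hp, hpos _ hq]
      exact (hm m hc).1
    · rw [hpos _ hq]
      exact (hm m hc.rotate.rotate).2.1
    · rw [hpos _ hp]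
      exact (hm m hc.rotate).2.2
  meet := by
    -- the positions of the new vertices are strictly on one side of the old edge
    have hside : ∀ u, G.InCell u p q z → (u ∉ S ∧ 0 < det3 (pos p) (pos q) (pos' u)) ∨
        (u ∈ S ∧ det3 (pos p) (pos q) (pos' u) = 0) := by
      rintro u (rfl | rfl | rfl | hu)
      · right
        rw [hpos u hp]
        exact ⟨hp, det3_self_mid _ _⟩
      · right
        rw [hpos u hq]
        exact ⟨hq, det3_self_right _ _⟩
      · exact Or.inl ⟨hz, hzpos⟩
      · exact Or.inl ⟨hS.ctr_not_mem hbi hch hp hq hz hx hcz hcx hu, (hm u hu).1⟩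
    have hhull : ∀ u, G.InCell u p q z → pos' u ∈ triHull (pos p) (pos q) (pos' z) := by
      rintro u (rfl | rfl | rfl | hu)
      · rw [hpos u hp]
        exact left_mem_triHull _ _ _
      · rw [hpos u hq]
        exact mid_mem_triHull _ _ _
      · exact right_mem_triHull _ _ _
      · exact openTri_subset_triHull _ _ _ (hm u hu)
    have mid : ∀ u ∈ G.extend S p q z, ∀ v ∈ G.extend S p q z, G.graph.Adj u v →
        ¬ (G.InCell u p q z ∧ G.InCell v p q z) → ∀ w ∈ segment ℝ (pos' u) (pos' v),
        w ∈ triHull (pos p) (pos q) (pos' z) →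
        ∃ x, (x = u ∨ x = v) ∧ G.InCell x p q z ∧ w = pos' x := by
      intro u hu v hv hadj hn w hw hw'
      have huv : u ∈ S ∧ v ∈ S := by
        by_contra h
        exact hn (hS.inCell_of_adj hbi hch hp hq hz hx hcz hcx hu hv hadj h)
      rw [hpos u huv.1, hpos v huv.2] at hw
      have hwpq := hT ⟨hw', hD.segment_subset_region hbi hch hS huv.1 huv.2 hadj hw⟩
      obtain ⟨x', h1, h2, h3⟩ := hD.crossing_free hbi hch hS huv.1 huv.2 hp hq hadj (hcz.adj hbi hch)
        (by
          rintro (⟨rfl, rfl⟩ | ⟨rfl, rfl⟩)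
          · exact hn ⟨Or.inl rfl, Or.inr (Or.inl rfl)⟩
          · exact hn ⟨Or.inr (Or.inl rfl), Or.inl rfl⟩) hw hwpq
      refine ⟨x', h1, h2.elim Or.inl fun h => Or.inr (Or.inl h), ?_⟩
      rw [hpos x']
      · exact h3
      · rcases h1 with rfl | rfl
        exacts [huv.1, huv.2]
    intro u hu v hv hadj a b c hc hn w hw hw'
    rcases hS.cellIn_extend hbi hch hp hq hz hx hcz hcx hc with
      h | ⟨rfl, rfl, rfl⟩ | ⟨rfl, rfl, rfl⟩ | ⟨rfl, rfl, rfl⟩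
    · rw [hpos a h.1, hpos b h.2.1, hpos c h.2.2.1] at hw'
      by_cases huv : u ∈ S ∧ v ∈ S
      · rw [hpos u huv.1, hpos v huv.2] at hw
        obtain ⟨x', h1, h2, h3⟩ := hD.meet u huv.1 v huv.2 hadj a b c h hn w hw hw'
        refine ⟨x', h1, h2, ?_⟩
        rw [hpos x']
        · exact h3
        · rcases h1 with rfl | rfl
          exacts [huv.1, huv.2]
      · obtain ⟨hu', hv'⟩ := hS.inCell_of_adj hbi hch hp hq hz hx hcz hcx hu hv hadj huv
        have hwT := (convex_triHull _ _ _).segment_subset (hhull u hu') (hhull v hv') hw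
        have hw0 := det3_eq_zero_of_mem_segment (hT ⟨hwT, mem_region.2 ⟨a, b, c, h, hw'⟩⟩)
        obtain ⟨s, t, hs, ht, hst, rfl⟩ := hw
        rw [det3_combo _ _ _ _ hst] at hw0
        rcases hside u hu' with ⟨h1, h2⟩ | ⟨h1, h2⟩ <;> rcases hside v hv' with ⟨h3, h4⟩ | ⟨h3, h4⟩
        · exfalso
          rcases hs.eq_or_lt with rfl | hs
          · obtain rfl : t = 1 := by linarith
            linarith
          · have := mul_pos hs h2
            have := mul_nonneg ht h4.le
            linarith
        · rw [h4, mul_zero, add_zero] at hw0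
          obtain rfl : s = 0 := (mul_eq_zero.1 hw0).resolve_right h2.ne'
          obtain rfl : t = 1 := by linarith
          rw [zero_smul, zero_add, one_smul] at hw' ⊢
          refine ⟨v, Or.inr rfl, ?_, rfl⟩
          rw [hpos v h3] at hw'
          exact hD.inCell_of_mem_triHull hbi hch hS h h3 hw'
        · rw [h2, mul_zero, zero_add] at hw0
          obtain rfl : t = 0 := (mul_eq_zero.1 hw0).resolve_right h4.ne'
          obtain rfl : s = 1 := by linarith
          rw [zero_smul, add_zero, one_smul] at hw' ⊢
          refine ⟨u, Or.inl rfl, ?_, rfl⟩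
          rw [hpos u h1] at hw'
          exact hD.inCell_of_mem_triHull hbi hch hS h h1 hw'
        · exact absurd ⟨h1, h3⟩ huv
    · rw [hpos _ hp, hpos _ hq] at hw'
      exact mid u hu v hv hadj hn w hw hw'
    · rw [hpos _ hp, hpos _ hq, triHull_rotate] at hw'
      rw [inCell_rotate, inCell_rotate (x := v)] at hn
      obtain ⟨x', h1, h2, h3⟩ := mid u hu v hv hadj hn w hw hw'
      exact ⟨x', h1, h2.rotate, h3⟩
    · rw [hpos _ hp, hpos _ hq, ← triHull_rotate] at hw'
      rw [← inCell_rotate, ← inCell_rotate (x := v)] at hn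
      obtain ⟨x', h1, h2, h3⟩ := mid u hu v hv hadj hn w hw hw'
      exact ⟨x', h1, h2.rotate.rotate, h3⟩
  conn := by
    rw [region_extend hbi hch hS hp hq hz hx hcz hcx hpos]
    exact hconn
  nonedge := by
    rw [region_extend hbi hch hS hp hq hz hx hcz hcx hpos]
    have hzn : ∀ v ∈ S, ¬ G.graph.Adj z v → ∃ w ∈ segment ℝ (pos' z) (pos' v),
        w ∉ G.region S pos ∪ triHull (pos p) (pos q) (pos' z) := fun v hv hn => by
      rw [hpos v hv]
      refine hznon v hv ?_ ?_
      · rintro rfl; exact hn (hcz.adj'' hbi hch)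
      · rintro rfl; exact hn (hcz.adj' hbi hch).symm
    have hmn : ∀ m, G.Ctr m p q z → ∀ v ∈ S, ¬ G.graph.Adj m v → ∃ w ∈ segment ℝ (pos' m) (pos' v),
        w ∉ G.region S pos ∪ triHull (pos p) (pos q) (pos' z) := fun m hc v hv hn => by
      rw [hpos v hv]
      refine hmnon m hc v hv ?_ ?_
      · rintro rfl; exact hn ((hc.adj hbi hch).2 (Or.inl rfl))
      · rintro rfl; exact hn ((hc.adj hbi hch).2 (Or.inr (Or.inl rfl)))
    rintro u (hu | rfl | hu) v (hv | rfl | hv) huv hadj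
    · rw [hpos u hu, hpos v hv]
      exact hold u hu v hv huv hadj
    · rw [segment_symm]
      exact hzn u hu fun h => hadj h.symm
    · rw [segment_symm]
      exact hmn v hv u hu fun h => hadj h.symm
    · exact hzn v hv hadj
    · exact absurd rfl huv
    · exact absurd ((hv.adj hbi hch).2 (Or.inr (Or.inr rfl))).symm hadj
    · exact hmn u hu v hv hadj
    · exact absurd ((hu.adj hbi hch).2 (Or.inr (Or.inr rfl))) hadj
    · exact absurd (hu.2.1.unique hv.2.1) huv

end

end

end PlaneGraph

/-! ### Placing the new corner of an attached cell -/

/-- Visibility of a point outside a closed set is stable under moving one end of a segment. -/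
theorem eventually_exists_mem_segment {K : Set ℂ} (hK : IsClosed K) {a v : ℂ}
    (h : ∃ w ∈ segment ℝ a v, w ∉ K) : ∀ᶠ b in 𝓝 a, ∃ w ∈ segment ℝ b v, w ∉ K := by
  obtain ⟨_, ⟨s, t, hs, ht, hst, rfl⟩, hw⟩ := h
  have hc : Continuous fun b : ℂ => s • b + t • v := by fun_prop
  filter_upwards [hc.continuousAt.eventually (hK.isOpen_compl.mem_nhds hw)] with b hb
  exact ⟨_, ⟨s, t, hs, ht, hst, rfl⟩, hb⟩

theorem eventually_exists_mem_segment_union {P : Set ℂ} (hP : IsClosed P) {r s v : ℂ}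
    (hrs : segment ℝ r s ⊆ P) (h : ∃ w ∈ segment ℝ r v, w ∉ P) :
    ∀ᶠ y in 𝓝 r, ∃ w ∈ segment ℝ y v, w ∉ P ∪ triHull r s y := by
  obtain ⟨w, ⟨a, b, ha, hb, hab, rfl⟩, hw⟩ := h
  obtain ⟨δ, hδ, hsub⟩ := Metric.nhds_basis_closedBall.mem_iff.1 (hP.isOpen_compl.mem_nhds hw)
  have h1 := eventually_disjoint_triHull (r := r) (s := s) (K := Metric.closedBall (a • r + b • v) δ)
    Metric.isClosed_closedBall (Set.disjoint_left.2 fun p hp hp' => hsub hp (hrs hp'))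
  have hc : Continuous fun y : ℂ => a • y + b • v := by fun_prop
  filter_upwards [h1, hc.continuousAt.eventually (Metric.closedBall_mem_nhds _ hδ)] with y hy hy'
  refine ⟨_, ⟨a, b, ha, hb, hab, rfl⟩, ?_⟩
  rintro (h2 | h2)
  · exact hsub hy' h2
  · exact Set.disjoint_left.1 hy hy' h2

/-- If the line through `r` and `y` separates `v` from `s`, then the segment from `y` to `v` leaves
`y` outside the triangle `r s y`. -/
theorem exists_mem_segment_union {P : Set ℂ} (hP : IsClosed P) {r s y v : ℂ} {σ : ℝ} (hy : y ∉ P)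
    (h1 : 0 < σ * det3 r y s) (h2 : σ * det3 r y v < 0) :
    ∃ w ∈ segment ℝ y v, w ∉ P ∪ triHull r s y := by
  have hcont : Tendsto (fun t : ℝ => (1 - t) • y + t • v) (𝓝[>] 0) (𝓝 y) := by
    have : Continuous (fun t : ℝ => (1 - t) • y + t • v) := by fun_prop
    have h3 := this.tendsto 0
    simp only [sub_zero, one_smul, zero_smul, add_zero] at h3
    exact h3.mono_left nhdsWithin_le_nhds
  obtain ⟨t, ht, ht0, ht1⟩ := ((hcont.eventually (hP.isOpen_compl.mem_nhds hy)).and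
    (Ioo_mem_nhdsGT (zero_lt_one' ℝ))).exists
  refine ⟨_, ⟨1 - t, t, by linarith, ht0.le, by ring, rfl⟩, ?_⟩
  rintro (h3 | h3)
  · exact ht h3
  · have hconv : Convex ℝ {p | 0 ≤ σ * det3 r y p} := by
      intro p hp q hq a b ha hb hab
      simp only [Set.mem_ofPred_eq] at *
      rw [det3_combo _ _ _ _ hab]
      have := mul_nonneg ha hp
      have := mul_nonneg hb hq
      linarith
    have h4 := triHull_subset hconv (by simp) (by simpa using h1.le) (by simp) h3
    rw [Set.mem_ofPred_eq, det3_combo _ _ _ _ (by ring), det3_self_right] at h4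
    have := mul_neg_of_pos_of_neg ht0 h2
    linarith

namespace PlaneGraph

variable {V : Type*} {G : PlaneGraph V} [Finite V]

section

variable (G) in
/-- The positions for a new vertex `y` next to the edge `r s`, as seen from `r`: the line through `r`
and `y` has `s` on one side, given by `σ`, and all other neighbours of `r` in `S` on the other side. -/
def cone (S : Set V) (pos : V → ℂ) (σ : ℝ) (r s : V) : Set ℂ :=
  {y | 0 < σ * det3 (pos r) y (pos s) ∧
    ∀ w ∈ S, G.graph.Adj r w → w ≠ s → σ * det3 (pos r) y (pos w) < 0}

theorem isOpen_cone (S : Set V) (pos : V → ℂ) (σ : ℝ) (r s : V) : IsOpen (G.cone S pos σ r s) := by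
  have e : G.cone S pos σ r s = {y | 0 < σ * det3 (pos r) y (pos s)} ∩
      ⋂ w ∈ {w | w ∈ S ∧ G.graph.Adj r w ∧ w ≠ s}, {y | σ * det3 (pos r) y (pos w) < 0} := by
    ext y
    simp only [cone, Set.mem_ofPred_eq, Set.mem_inter_iff, Set.mem_iInter, and_imp]
  rw [e]
  exact (isOpen_lt continuous_const (continuous_const.mul (continuous_det3_mid _ _))).inter
    ((Set.toFinite _).isOpen_biInter fun w _ =>
      isOpen_lt (continuous_const.mul (continuous_det3_mid _ _)) continuous_const)

theorem cone_inter_nonempty {S : Set V} {pos : V → ℂ} {σ : ℝ} {r s : V}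
    (h : (G.cone S pos σ r s).Nonempty) {U : Set ℂ} (hU : U ∈ 𝓝 (pos r)) :
    (G.cone S pos σ r s ∩ U).Nonempty := by
  obtain ⟨D, hD1, hD2⟩ := h
  have hcont : Tendsto (fun t : ℝ => (1 - t) • pos r + t • D) (𝓝[>] 0) (𝓝 (pos r)) := by
    have : Continuous (fun t : ℝ => (1 - t) • pos r + t • D) := by fun_prop
    have h3 := this.tendsto 0
    simp only [sub_zero, one_smul, zero_smul, add_zero] at h3
    exact h3.mono_left nhdsWithin_le_nhds
  obtain ⟨t, ht, ht0⟩ := ((hcont.eventually hU).and self_mem_nhdsWithin).exists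
  have ht0' : 0 < t := ht0
  have e : ∀ w, det3 (pos r) ((1 - t) • pos r + t • D) w = t * det3 (pos r) D w := fun w => by
    rw [← det3_rotate, ← det3_rotate, det3_combo _ _ _ _ (by ring), det3_self_right,
      ← det3_rotate (pos r), ← det3_rotate D]
    ring
  refine ⟨_, ⟨?_, fun w hw hadj hne => ?_⟩, ht⟩
  · rw [e, mul_left_comm]
    exact mul_pos ht0' hD1
  · rw [e, mul_left_comm]
    exact mul_neg_of_pos_of_neg ht0' (hD2 w hw hadj hne)

variable (hbi : G.Biconnected) (hch : G.InnerChordal) {S : Set V} {pos : V → ℂ}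

include hbi hch

variable (hS : G.IsPatch S) (hD : G.IsDrawing S pos) {σ : ℝ} {r s x z : V} (hr : r ∈ S) (hs : s ∈ S)
  (hx : x ∈ S) (hz : z ∉ S) (hcx : G.SCell σ r s x) (hcz : G.SCell (-σ) r s z)

include hS hD hr hs hx hz hcx hcz

omit hS hx hcx in
/-- A triangle over `r s` with apex `y` in the cone at `r` does not overlap a cell with corner `r`: the
line through `r` and `s` separates the two if `s` is a corner of the cell, and otherwise the line
through `r` and `y` does. -/
theorem IsDrawing.inter_subset_of_corner {b c : V} (hc : G.CellIn S r b c) {y : ℂ}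
    (hy : y ∈ G.cone S pos σ r s) : triHull (pos r) (pos s) y ∩ triHull (pos r) (pos b) (pos c) ⊆
      segment ℝ (pos r) (pos s) := by
  rintro p ⟨hp, hp'⟩
  have hσ : σ = 1 ∨ σ = -1 := by
    rcases hcz.sign with h | h
    · right; linarith
    · left; linarith
  have hysgn : σ * det3 (pos r) (pos s) y < 0 := by
    have := hy.1
    rw [det3_swap'] at this
    linarith
  by_cases hsb : s = b
  · subst hsb
    have h1 : σ = 1 := by
      refine hσ.resolve_right fun h => hz ?_
      rw [hcz.unique hbi hch (Or.inl ⟨by rw [h]; norm_num, hc.2.2.2⟩)]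
      exact hc.2.2.1
    subst h1
    exact mem_segment_of_mem_triHull (by rw [one_mul]; exact hD.cell_pos _ _ _ hc) hysgn hp' hp
  by_cases hsc : s = c
  · subst hsc
    have hc' := (hc.rotate hbi hch).rotate hbi hch
    have h1 : σ = -1 := by
      refine hσ.resolve_left fun h => hz ?_
      rw [hcz.unique hbi hch (Or.inr ⟨by rw [h], hc'.2.2.2⟩)]
      exact hc.2.1
    subst h1
    rw [← triHull_rotate, ← triHull_rotate, triHull_swap] at hp'
    refine mem_segment_of_mem_triHull ?_ hysgn hp' hp
    have := hD.cell_pos _ _ _ hc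
    rw [det3_swap']
    linarith
  · have h1 := hy.2 b hc.2.1 (hc.2.2.2.adj hbi hch) (Ne.symm hsb)
    have h2 := hy.2 c hc.2.2.1 (hc.2.2.2.adj'' hbi hch).symm (Ne.symm hsc)
    have hconv : Convex ℝ {p | 0 ≤ σ * det3 (pos r) y p} := by
      intro p hp q hq a b ha hb hab
      simp only [Set.mem_ofPred_eq] at *
      rw [det3_combo _ _ _ _ hab]
      have := mul_nonneg ha hp
      have := mul_nonneg hb hq
      linarith
    have h3 := triHull_subset hconv (by simp) (by simpa using hy.1.le) (by simp) hp
    rw [eq_of_mem_triHull_of_neg h1 h2 hp' h3]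
    exact left_mem_segment ℝ _ _

omit hS hcz hx hz in
/-- A thin triangle over `r s` does not overlap a cell with corner `s` that does not contain `r`: the line
through `s` and some other corner of the cell separates `r`, and hence all points near `r`, from the
cell. -/
theorem IsDrawing.eventually_inter_subset_of_other {b c : V} (hc : G.CellIn S s b c)
    (hrc : ¬ G.InCell r s b c) : ∀ᶠ y in 𝓝 (pos r),
      triHull (pos r) (pos s) y ∩ triHull (pos s) (pos b) (pos c) ⊆ segment ℝ (pos r) (pos s) := by
  have hpos := hD.cell_pos _ _ _ hc
  have hrs : pos r ≠ pos s := fun h => (hcx.adj hbi hch).ne (hD.inj r hr s hs h)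
  have hor : det3 (pos s) (pos b) (pos r) < 0 ∨ det3 (pos s) (pos r) (pos c) < 0 := by
    by_contra hcon
    push Not at hcon
    obtain ⟨p, hp, hps, hpt⟩ := exists_mem_segment_mem_triHull hpos hrs hcon.1 hcon.2
    obtain ⟨v, hv, hv', he⟩ := hD.meet s hs r hr (hcx.adj hbi hch).symm _ _ _ hc
      (fun h => hrc h.2) p hp hpt
    rcases hv with rfl | rfl
    · exact hps he
    · exact hrc hv'
  rcases hor with h | h
  · filter_upwards [(continuous_det3 (pos s) (pos b)).continuousAt.eventually (gt_mem_nhds h)] with y hy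
    rintro p ⟨hp, hp'⟩
    have h1 := ((mem_triHull_iff hpos p).1 hp').1
    rw [← triHull_swap] at hp
    rw [eq_of_mem_triHull_of_neg (σ := 1) (q := pos b) (by rwa [one_mul]) (by rwa [one_mul]) hp
      (by rwa [one_mul])]
    exact right_mem_segment ℝ _ _
  · have h' : -1 * det3 (pos s) (pos c) (pos r) < 0 := by
      rw [det3_swap'] at h
      linarith
    have hc1 : Continuous fun y => -1 * det3 (pos s) (pos c) y :=
      continuous_const.mul (continuous_det3 _ _)
    filter_upwards [hc1.continuousAt.eventually (gt_mem_nhds h')] with y hy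
    rintro p ⟨hp, hp'⟩
    have h1 := ((mem_triHull_iff hpos p).1 hp').2.2
    rw [← triHull_swap] at hp
    rw [eq_of_mem_triHull_of_neg h' hy hp (by rw [det3_swap]; linarith)]
    exact right_mem_segment ℝ _ _

omit hx in
/-- A thin triangle over the edge `r s` in the cone at `r` meets a drawn cell at most in this
edge. -/
theorem IsDrawing.eventually_inter_cell_subset {a b c : V} (hc : G.CellIn S a b c) :
    ∀ᶠ y in 𝓝 (pos r), y ∈ G.cone S pos σ r s →
      triHull (pos r) (pos s) y ∩ triHull (pos a) (pos b) (pos c) ⊆ segment ℝ (pos r) (pos s) := by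
  have e1 := triHull_rotate (pos a) (pos b) (pos c)
  have e2 := triHull_rotate (pos b) (pos c) (pos a)
  have hcr := hc.rotate hbi hch
  have hcrr := hcr.rotate hbi hch
  obtain ⟨hro, hso, -⟩ := hcx.out
  by_cases hrc : G.InCell r a b c
  · refine Eventually.of_forall fun y hy => ?_
    rcases hrc.eq_of_out hro with rfl | rfl | rfl
    · exact hD.inter_subset_of_corner hbi hch hr hs hz hcz hc hy
    · rw [← e1]
      exact hD.inter_subset_of_corner hbi hch hr hs hz hcz hcr hy
    · rw [← e1, ← e2]
      exact hD.inter_subset_of_corner hbi hch hr hs hz hcz hcrr hy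
  by_cases hsc : G.InCell s a b c
  · rcases hsc.eq_of_out hso with rfl | rfl | rfl
    · exact (hD.eventually_inter_subset_of_other hbi hch hr hs hcx hc hrc).mono fun _ h _ => h
    · rw [← e1]
      exact (hD.eventually_inter_subset_of_other hbi hch hr hs hcx hcr
        fun h => hrc h.rotate.rotate).mono fun _ h _ => h
    · rw [← e1, ← e2]
      exact (hD.eventually_inter_subset_of_other hbi hch hr hs hcx hcrr
        fun h => hrc h.rotate).mono fun _ h _ => h
  · have hdis : Disjoint (triHull (pos a) (pos b) (pos c)) (segment ℝ (pos r) (pos s)) := by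
      rw [Set.disjoint_left]
      intro p hp hp'
      obtain ⟨v, hv, hv', -⟩ := hD.meet r hr s hs (hcx.adj hbi hch) a b c hc (fun h => hrc h.1) p hp'
        hp
      rcases hv with rfl | rfl
      · exact hrc hv'
      · exact hsc hv'
    filter_upwards [eventually_disjoint_triHull (isClosed_triHull _ _ _) hdis] with y hy _
    rintro p ⟨hp, hp'⟩
    exact absurd hp (Set.disjoint_left.1 hy hp')

omit hx in
theorem IsDrawing.eventually_inter_region_subset : ∀ᶠ y in 𝓝 (pos r), y ∈ G.cone S pos σ r s →
    triHull (pos r) (pos s) y ∩ G.region S pos ⊆ segment ℝ (pos r) (pos s) := by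
  have h : ∀ t : V × V × V, ∀ᶠ y in 𝓝 (pos r), G.CellIn S t.1 t.2.1 t.2.2 →
      y ∈ G.cone S pos σ r s → triHull (pos r) (pos s) y ∩
        triHull (pos t.1) (pos t.2.1) (pos t.2.2) ⊆ segment ℝ (pos r) (pos s) := by
    intro t
    by_cases ht : G.CellIn S t.1 t.2.1 t.2.2
    · exact (hD.eventually_inter_cell_subset hbi hch hS hr hs hz hcx hcz ht).mono fun _ h _ => h
    · exact Eventually.of_forall fun _ h => absurd h ht
  filter_upwards [eventually_all.2 h] with y hy hyc
  rintro p ⟨hp, hp'⟩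
  obtain ⟨a, b, c, hc, hpc⟩ := mem_region.1 hp'
  exact hy (a, b, c) hc hyc ⟨hp, hpc⟩

omit hx hz hcz in
/-- A thin triangle over `r s` does not obstruct the visibility between the vertices of `S`. -/
theorem IsDrawing.eventually_nonedge : ∀ᶠ y in 𝓝 (pos r), ∀ u ∈ S, ∀ v ∈ S, u ≠ v →
    ¬ G.graph.Adj u v → ∃ w ∈ segment ℝ (pos u) (pos v),
      w ∉ G.region S pos ∪ triHull (pos r) (pos s) y := by
  simp only [eventually_all]
  intro u hu v hv huv hn
  obtain ⟨w, hw, hw'⟩ := hD.nonedge u hu v hv huv hn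
  have hsub := hD.segment_subset_region hbi hch hS hr hs (hcx.adj hbi hch)
  filter_upwards [eventually_disjoint_triHull (K := {w}) isClosed_singleton
    (Set.disjoint_singleton_left.2 fun h => hw' (hsub h))] with y hy
  refine ⟨w, hw, ?_⟩
  rintro (h | h)
  · exact hw' h
  · exact Set.disjoint_singleton_left.1 hy h

omit hx in
/-- A point `y` of the cone close to `r` sees all vertices `v` of `S` other than `r` and `s`. If `v` is
not adjacent to `r`, then `y` inherits this from `r`; otherwise the line through `r` and `y`
separates `v` from the new triangle, and the segment from `y` to `v` starts in the complement. -/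
theorem IsDrawing.eventually_visible : ∀ᶠ y in 𝓝 (pos r), y ∈ G.cone S pos σ r s →
    ∀ v ∈ S, v ≠ r → v ≠ s → ∃ w ∈ segment ℝ y (pos v),
      w ∉ G.region S pos ∪ triHull (pos r) (pos s) y := by
  have hsub := hD.segment_subset_region hbi hch hS hr hs (hcx.adj hbi hch)
  have hcl := (isCompact_region (G := G) S pos).isClosed
  have h : ∀ v, ∀ᶠ y in 𝓝 (pos r), v ∈ S → v ≠ r → ¬ G.graph.Adj r v →
      ∃ w ∈ segment ℝ y (pos v), w ∉ G.region S pos ∪ triHull (pos r) (pos s) y := by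
    intro v
    simp only [eventually_all]
    intro hv hvr hn
    exact eventually_exists_mem_segment_union hcl hsub (hD.nonedge r hr v hv hvr.symm hn)
  filter_upwards [eventually_all.2 h, hD.eventually_inter_region_subset hbi hch hS hr hs hz hcx hcz]
    with y hy hyT hyc v hv hvr hvs
  by_cases hadj : G.graph.Adj r v
  · refine exists_mem_segment_union hcl (fun hyP => ?_) hyc.1 (hyc.2 v hv hadj hvs)
    have h1 := det3_eq_zero_of_mem_segment (hyT hyc ⟨right_mem_triHull _ _ _, hyP⟩)
    have h2 := hyc.1
    rw [det3_swap', h1] at h2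
    simp at h2
  · exact hy v hv hvr hadj

/-- If the cone at `r` is not empty, then the cell at the edge `r s` can be drawn with its new corner
close to `r`. -/
theorem IsDrawing.exists_extend {p q : V} (hpq : (σ = -1 ∧ p = r ∧ q = s) ∨ (σ = 1 ∧ p = s ∧ q = r))
    (hcone : (G.cone S pos σ r s).Nonempty) {U : Set ℂ} (hU : U ∈ 𝓝 (pos r)) :
    ∃ pos' : V → ℂ, (∀ v ∈ S, pos' v = pos v) ∧ (∀ v, v ∉ S → pos' v ∈ U) ∧
      pos' z ∈ G.cone S pos σ r s ∧ G.IsDrawing (G.extend S p q z) pos' := by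
  classical
  have hcz' : G.Cell p q z := by
    rcases hcz with ⟨h1, h⟩ | ⟨h1, h⟩ <;> rcases hpq with ⟨h2, rfl, rfl⟩ | ⟨h2, rfl, rfl⟩
    · exact h
    · rw [h2] at h1; norm_num at h1
    · rw [h2] at h1; norm_num at h1
    · exact h
  have hcx' : G.Cell q p x := by
    rcases hcx with ⟨h1, h⟩ | ⟨h1, h⟩ <;> rcases hpq with ⟨h2, rfl, rfl⟩ | ⟨h2, rfl, rfl⟩
    · rw [h2] at h1; norm_num at h1
    · exact h
    · exact h
    · rw [h2] at h1; norm_num at h1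
  have hp : p ∈ S := by rcases hpq with ⟨-, rfl, rfl⟩ | ⟨-, rfl, rfl⟩ <;> assumption
  have hq : q ∈ S := by rcases hpq with ⟨-, rfl, rfl⟩ | ⟨-, rfl, rfl⟩ <;> assumption
  have htri : ∀ y, triHull (pos p) (pos q) y = triHull (pos r) (pos s) y := by
    rcases hpq with ⟨-, rfl, rfl⟩ | ⟨-, rfl, rfl⟩
    · exact fun _ => rfl
    · exact fun y => triHull_swap _ _ _
  have hseg : segment ℝ (pos p) (pos q) = segment ℝ (pos r) (pos s) := by
    rcases hpq with ⟨-, rfl, rfl⟩ | ⟨-, rfl, rfl⟩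
    · rfl
    · exact segment_symm _ _ _
  have hdet : ∀ y ∈ G.cone S pos σ r s, 0 < det3 (pos p) (pos q) y := by
    intro y hy
    have h1 := hy.1
    rw [det3_swap'] at h1
    rcases hpq with ⟨rfl, rfl, rfl⟩ | ⟨rfl, rfl, rfl⟩
    · linarith
    · rw [det3_swap]; linarith
  have hcl := (isCompact_region (G := G) S pos).isClosed
  have hsub := hD.segment_subset_region hbi hch hS hr hs (hcx.adj hbi hch)
  have hev := (hD.eventually_inter_region_subset hbi hch hS hr hs hz hcx hcz).and
    ((hD.eventually_nonedge hbi hch hS hr hs hcx).and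
      ((hD.eventually_visible hbi hch hS hr hs hz hcx hcz).and hU))
  obtain ⟨U₀, hU₀, hU₀o, hrU₀⟩ := eventually_nhds_iff.1 hev
  -- an auxiliary larger triangle, which provides a collar of the new triangle
  obtain ⟨y', hy'c, hy'U⟩ := cone_inter_nonempty hcone (hU₀o.mem_nhds hrU₀)
  have hCo := isOpen_cone (G := G) S pos σ r s
  have hfin : {l : ℂ × ℂ | ∃ u ∈ S, ∃ v ∈ S, u ≠ v ∧ l = (pos u, pos v)}.Finite := by
    refine (Set.toFinite (Set.range fun t : V × V => (pos t.1, pos t.2))).subset ?_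
    rintro _ ⟨u, -, v, -, -, rfl⟩
    exact ⟨(u, v), rfl⟩
  have hfin' : ∀ l ∈ {l : ℂ × ℂ | ∃ u ∈ S, ∃ v ∈ S, u ≠ v ∧ l = (pos u, pos v)}, l.1 ≠ l.2 := by
    rintro _ ⟨u, hu, v, hv, huv, rfl⟩ h
    exact huv (hD.inj u hu v hv h)
  obtain ⟨y, ⟨hyT', hyc, hyU⟩, hygen⟩ := exists_mem_forall_det3_ne
    ((isOpen_openTri (pos p) (pos q) y').inter (hCo.inter hU₀o))
    (openTri_inter_nonempty (hdet y' hy'c) ((hCo.inter hU₀o).mem_nhds ⟨hy'c, hy'U⟩)) hfin hfin'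
  obtain ⟨hyT, hyold, hyvis, -⟩ := hU₀ y hyU
  replace hyT := hyT hyc
  replace hyvis := hyvis hyc
  have hygen' : ∀ u ∈ S, ∀ v ∈ S, u ≠ v → det3 (pos u) (pos v) y ≠ 0 := fun u hu v hv huv =>
    hygen _ ⟨u, hu, v, hv, huv, rfl⟩
  have hyne : ∀ u ∈ S, pos u ≠ y := by
    rintro u hu rfl
    by_cases hur : u = r
    · exact hygen' u hu s hs (by rw [hur]; exact (hcx.adj hbi hch).ne) (det3_self_mid _ _)
    · exact hygen' u hu r hr hur (det3_self_mid _ _)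
  -- the centre is placed close to the new corner
  have hclT : IsClosed (G.region S pos ∪ triHull (pos r) (pos s) y) :=
    hcl.union (isClosed_triHull _ _ _)
  have hevm : ∀ᶠ m in 𝓝 y, m ∈ U₀ ∧ ∀ v, v ∈ S → v ≠ r → v ≠ s → ∃ w ∈ segment ℝ m (pos v),
      w ∉ G.region S pos ∪ triHull (pos r) (pos s) y := by
    refine Filter.Eventually.and (p := fun m => m ∈ U₀) (hU₀o.mem_nhds hyU) ?_
    simp only [eventually_all]
    intro v hv hvr hvs
    exact eventually_exists_mem_segment hclT (hyvis v hv hvr hvs)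
  obtain ⟨N, hN, hNo, hyN⟩ := eventually_nhds_iff.1 hevm
  obtain ⟨m, ⟨hmT, hmN⟩, hmgen⟩ := exists_mem_forall_det3_ne
    (L := {l : ℂ × ℂ | ∃ u ∈ S, ∃ v ∈ S, u ≠ v ∧ l = (pos u, pos v)} ∪ (fun u => (pos u, y)) '' S)
    ((isOpen_openTri (pos p) (pos q) y).inter hNo)
    (openTri_inter_nonempty (hdet y hyc) (hNo.mem_nhds hyN)) (hfin.union (Set.toFinite _)) (by
      rintro l (hl | ⟨u, hu, rfl⟩)
      · exact hfin' l hl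
      · exact hyne u hu)
  obtain ⟨hmU, hmvis⟩ := hN m hmN
  let pos' : V → ℂ := fun v => if v ∈ S then pos v else if v = z then y else m
  have hpos' : ∀ v ∈ S, pos' v = pos v := fun v hv => if_pos hv
  have hposz : pos' z = y := by simp only [pos', if_neg hz, if_true]
  have hposm : ∀ m', G.Ctr m' p q z → pos' m' = m := fun m' hm' => by
    have h1 := hS.ctr_not_mem hbi hch hp hq hz hx hcz' hcx' hm'
    have h2 : m' ≠ z := by
      rintro rfl
      exact hm'.1 hcz'.2.2.1
    simp only [pos', if_neg h1, if_neg h2]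
  refine ⟨pos', hpos', fun v hv => ?_, by rwa [hposz], ?_⟩
  · simp only [pos', if_neg hv]
    split_ifs
    · exact (hU₀ y hyU).2.2.2
    · exact (hU₀ m hmU).2.2.2
  · have hvpq : ∀ {v : V}, v ≠ p → v ≠ q → v ≠ r ∧ v ≠ s := by
      intro v h1 h2
      rcases hpq with ⟨-, rfl, rfl⟩ | ⟨-, rfl, rfl⟩
      · exact ⟨h1, h2⟩
      · exact ⟨h2, h1⟩
    refine hD.extend hbi hch hS hp hq hz hx hcz' hcx' hpos' ?_ ?_ ?_ ?_ ?_ ?_ ?_ ?_ ?_ ?_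
    · rw [hposz, htri, hseg]
      exact hyT
    · rw [hposz]
      exact hdet y hyc
    · rw [hposz]
      exact hygen'
    · intro m' hm'
      rw [hposm m' hm', hposz]
      exact hmT
    · intro m' hm' u hu v hv huv
      rw [hposm m' hm']
      exact hmgen _ (Or.inl ⟨u, hu, v, hv, huv, rfl⟩)
    · intro m' hm' u hu
      rw [hposm m' hm', hposz]
      exact hmgen _ (Or.inr ⟨u, hu, rfl⟩)
    · rw [hposz]
      refine hD.conn.compl_union_triHull hcl (y' := y') ?_ ?_ hyT'
      · rw [hseg]
        exact hsub
      · rw [hseg, htri]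
        exact (hU₀ y' hy'U).1 hy'c
    · rw [hposz, htri]
      exact hyold
    · intro v hv h1 h2
      rw [hposz, htri]
      exact hyvis v hv (hvpq h1 h2).1 (hvpq h1 h2).2
    · intro m' hm' v hv h1 h2
      rw [hposm m' hm', hposz, htri]
      exact hmvis v hv (hvpq h1 h2).1 (hvpq h1 h2).2

end

end PlaneGraph

/-! ### Drawings guided by an orientation of the chords -/

namespace PlaneGraph

variable {V : Type*} (G : PlaneGraph V)

/-- The relation `I` selects an outside-obstacle orientation: `I u v` means that the chord `u v` is
directed towards `u`. -/
structure IsGuide (I : V → V → Prop) : Prop where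
  chord : ∀ u v, G.IsChord s(u, v) → (I u v ↔ ¬ I v u)
  share : ∀ u v w, I u v → I u w → v ≠ w → G.Tri u v w ∨ G.Tri u w v
  eq_or : ∀ u v w x, I u v → I u w → I u x → v = w ∨ v = x ∨ w = x

/-- The cell on one side of the chord `u v`, given by `σ`, has its corners in `S`, and the cell on
the other side does not. -/
def SBdry (S : Set V) (σ : ℝ) (u v : V) : Prop :=
  u ∈ S ∧ v ∈ S ∧ (∃ w ∈ S, G.SCell σ u v w) ∧ ∃ w, w ∉ S ∧ G.SCell (-σ) u v w

/-- The cells on both sides of the chord `u v` have their corners in `S`. -/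
def BothIn (S : Set V) (u v : V) : Prop :=
  u ∈ S ∧ v ∈ S ∧ (∃ w ∈ S, G.Cell u v w) ∧ ∃ w ∈ S, G.Cell v u w

/-- The edge `u v` is extreme at `u`: the line through `u` and `v` has all other neighbours of `u`
in `S` on the same side. -/
def IsExtreme (S : Set V) (pos : V → ℂ) (σ : ℝ) (u v : V) : Prop :=
  ∀ w ∈ S, G.graph.Adj u w → w ≠ v → 0 < σ * det3 (pos u) (pos v) (pos w)

/-- The invariant of the construction: at a chord on the boundary of the drawn region that is
directed towards `u`, the next cell can be attached with its new corner near `u`; and as long as no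
chord inside the region is directed towards `u`, the region is convex at `u`. -/
structure IsGuided (I : V → V → Prop) (S : Set V) (pos : V → ℂ) : Prop where
  cone : ∀ σ u v, G.SBdry S σ u v → I u v → (G.cone S pos σ u v).Nonempty
  extreme : ∀ σ u v, G.SBdry S σ u v → (∀ w, I u w → ¬ G.BothIn S u w) →
    G.IsExtreme S pos σ u v

/-- The vertex `x` is a corner or the centre of the triangle `a b c` in one of its orientations. -/
def SIn (x a b c : V) : Prop := G.InCell x a b c ∨ G.InCell x b a c

variable {G} [Finite V]

theorem SIn.swap {x a b c : V} (h : G.SIn x a b c) : G.SIn x b a c := Or.symm h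

theorem SIn.rotate {x a b c : V} (h : G.SIn x a b c) : G.SIn x b c a :=
  h.imp InCell.rotate fun h => h.rotate.rotate

theorem SIn.eq_of_out {x a b c : V} (h : G.SIn x a b c) (hx : G.Out x) : x = a ∨ x = b ∨ x = c := by
  rcases h with h | h
  · exact h.eq_of_out hx
  · rcases h.eq_of_out hx with h | h | h
    exacts [Or.inr (Or.inl h), Or.inl h, Or.inr (Or.inr h)]

/-- The cone at `r` is not empty if some small rotation of the ray from `r` through `B` satisfies the
conditions. -/
theorem cone_nonempty_of_perturb {S : Set V} {pos : V → ℂ} {σ : ℝ} {r s : V} (B E : ℂ)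
    (hs : 0 < σ * det3 (pos r) B (pos s) ∨
      (σ * det3 (pos r) B (pos s) = 0 ∧ 0 < σ * det3 (pos r) E (pos s)))
    (hw : ∀ w ∈ S, G.graph.Adj r w → w ≠ s → σ * det3 (pos r) B (pos w) < 0 ∨
      (σ * det3 (pos r) B (pos w) = 0 ∧ σ * det3 (pos r) E (pos w) < 0)) :
    (G.cone S pos σ r s).Nonempty := by
  have e : ∀ (t : ℝ) (w : ℂ), σ * det3 (pos r) ((1 - t) • B + t • E) w =
      (1 - t) * (σ * det3 (pos r) B w) + t * (σ * det3 (pos r) E w) := fun t w => by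
    simp only [det3, Complex.add_re, Complex.add_im, Complex.smul_re, Complex.smul_im, smul_eq_mul]
    ring
  have key : ∀ α β : ℝ, (0 < α ∨ (α = 0 ∧ 0 < β)) → ∀ᶠ t : ℝ in 𝓝[>] 0, 0 < (1 - t) * α + t * β := by
    rintro α β (h | ⟨rfl, h⟩)
    · have hc : Continuous fun t : ℝ => (1 - t) * α + t * β := by fun_prop
      have h1 := hc.tendsto 0
      simp only [sub_zero, one_mul, zero_mul, add_zero] at h1
      exact (h1.mono_left nhdsWithin_le_nhds).eventually (lt_mem_nhds h)
    · filter_upwards [self_mem_nhdsWithin] with t ht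
      have : 0 < t * β := mul_pos ht h
      linarith
  have h1 := key _ _ hs
  have h2 : ∀ w, ∀ᶠ t : ℝ in 𝓝[>] 0, w ∈ S → G.graph.Adj r w → w ≠ s →
      0 < (1 - t) * -(σ * det3 (pos r) B (pos w)) + t * -(σ * det3 (pos r) E (pos w)) := by
    intro w
    simp only [eventually_all]
    intro h3 h4 h5
    refine key _ _ ?_
    rcases hw w h3 h4 h5 with h | ⟨h, h'⟩
    · left; linarith
    · right; constructor <;> linarith
  obtain ⟨t, ht, ht'⟩ := (h1.and (eventually_all.2 h2)).exists
  refine ⟨(1 - t) • B + t • E, ?_, fun w h3 h4 h5 => ?_⟩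
  · rw [e]
    exact ht
  · rw [e]
    linarith [ht' w h3 h4 h5]

theorem det3_reflect (r b c : ℂ) : det3 r (2 * r - b) c = -det3 r b c := by
  simp only [det3, Complex.sub_re, Complex.sub_im, Complex.mul_re, Complex.mul_im, Complex.re_ofNat,
    Complex.im_ofNat]
  ring

/-- A new vertex can be placed beyond an extreme edge. -/
theorem IsExtreme.cone_nonempty {S : Set V} {pos : V → ℂ} {σ : ℝ} {u v x : V}
    (h : G.IsExtreme S pos σ u v) (hx : x ∈ S) (hadj : G.graph.Adj u x) (hne : x ≠ v) :
    (G.cone S pos σ u v).Nonempty := by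
  refine cone_nonempty_of_perturb (2 * pos u - pos v) (2 * pos u - pos x) (Or.inr ⟨?_, ?_⟩)
    fun w hw hadj hne => Or.inl ?_
  · rw [det3_reflect, det3_self_right, neg_zero, mul_zero]
  · rw [det3_reflect, ← det3_swap']
    exact h x hx hadj hne
  · rw [det3_reflect]
    linarith [h w hw hadj hne]

section

variable (hbi : G.Biconnected) (hch : G.InnerChordal)

include hbi hch

theorem Tri.not_ctr {a b c x : V} (h : G.Tri a b c) (ha : G.Out a) (hb : G.Out b) (hc : G.Out c) :
    ¬ G.Ctr x a b c ∧ ¬ G.Ctr x a c b := by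
  have hcell : G.Cell a b c := ⟨ha, hb, hc, Or.inl h⟩
  refine ⟨fun hx => ?_, fun hx => ?_⟩
  · rw [hx.2.1.unique h] at hx
    exact hx.1 hc
  · have h2 : G.Cell a c b := ⟨ha, hc, hb, Or.inr ⟨x, hx⟩⟩
    exact hcell.not_swap hbi hch ((h2.rotate hbi hch).rotate hbi hch)

theorem SCell.sign_unique {σ τ : ℝ} {a b c : V} (h : G.SCell σ a b c) (h' : G.SCell τ a b c) :
    σ = τ := by
  by_contra hne
  have : τ = -σ := by
    rcases h.sign with h1 | h1 <;> rcases h'.sign with h2 | h2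
    · exact absurd (h1.trans h2.symm) hne
    · rw [h1, h2]
    · rw [h1, h2, neg_neg]
    · exact absurd (h1.trans h2.symm) hne
  rw [this] at h'
  exact h.not_neg hbi hch h'

/-- The corner opposite to the edge `u v` of a drawn cell and its centre are on the side of this
edge that is given by the orientation. -/
theorem IsDrawing.sign_pos {S : Set V} {pos : V → ℂ} (hD : G.IsDrawing S pos) {σ : ℝ} {u v w x : V}
    (h : G.SCell σ u v w) (hu : u ∈ S) (hv : v ∈ S) (hw : w ∈ S) (hx : G.SIn x u v w) (hxu : x ≠ u)
    (hxv : x ≠ v) : 0 < σ * det3 (pos u) (pos v) (pos x) := by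
  have key : ∀ {u v : V}, G.CellIn S u v w → G.SIn x u v w → x ≠ u → x ≠ v →
      0 < det3 (pos u) (pos v) (pos x) := by
    rintro u v hc ((h | h | rfl | h) | (h | h | rfl | h)) hu hv
    · exact absurd h hu
    · exact absurd h hv
    · exact hD.cell_pos _ _ _ hc
    · exact hD.ctr_pos _ _ _ _ hc h
    · exact absurd h hv
    · exact absurd h hu
    · exact hD.cell_pos _ _ _ hc
    · exact absurd ⟨hc.2.2.2.2.1, hc.2.2.2.1, hc.2.2.2.2.2.1, Or.inr ⟨x, h⟩⟩
        (hc.2.2.2.not_swap hbi hch)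
  rcases h with ⟨rfl, h⟩ | ⟨rfl, h⟩
  · rw [one_mul]
    exact key ⟨hu, hv, hw, h⟩ hx hxu hxv
  · have := key ⟨hv, hu, hw, h⟩ hx.swap hxv hxu
    rw [det3_swap] at this
    linarith

theorem SBdry.not_bothIn {S : Set V} {σ : ℝ} {u v : V} (h : G.SBdry S σ u v) : ¬ G.BothIn S u v := by
  rintro ⟨-, -, ⟨w, hw, h1⟩, w', hw', h2⟩
  obtain ⟨-, -, -, c, hc, hc'⟩ := h
  rcases hc' with ⟨-, h3⟩ | ⟨-, h3⟩
  · exact hc (by rwa [h3.unique hbi hch h1])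
  · exact hc (by rwa [h3.unique hbi hch h2])

/-- The boundary of the extended patch: the edge at which the new cell is attached is replaced by
the two other edges of the cell. -/
theorem SBdry.of_extend {S : Set V} (hS : G.IsPatch S) {p q z x r s u v : V} {σ τ : ℝ}
    (hpq : (p = r ∧ q = s) ∨ (p = s ∧ q = r)) (hp : p ∈ S) (hq : q ∈ S) (hz : z ∉ S) (hx : x ∈ S)
    (hcz : G.Cell p q z) (hcx : G.Cell q p x) (hz' : G.SCell (-σ) r s z)
    (h : G.SBdry (G.extend S p q z) τ u v) :
    (G.SBdry S τ u v ∧ ¬ (u = r ∧ v = s) ∧ ¬ (u = s ∧ v = r)) ∨ (u = r ∧ v = z ∧ τ = σ) ∨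
      (u = s ∧ v = z ∧ τ = -σ) ∨ (u = z ∧ v = r ∧ τ = -σ) ∨ (u = z ∧ v = s ∧ τ = σ) := by
  obtain ⟨hu, hv, ⟨w, hw, hc⟩, c, hcS, hc'⟩ := h
  have hrs : ¬ (u = r ∧ v = s) ∧ ¬ (u = s ∧ v = r) := by
    constructor <;> rintro ⟨rfl, rfl⟩ <;> rcases hpq with ⟨rfl, rfl⟩ | ⟨rfl, rfl⟩
    · exact hcS (hS.scell_mem hbi hch hp hq hz hx hcz hcx (Or.inl hc'))
    · exact hcS (hS.scell_mem hbi hch hp hq hz hx hcz hcx (Or.inr hc'))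
    · exact hcS (hS.scell_mem hbi hch hp hq hz hx hcz hcx (Or.inr hc'))
    · exact hcS (hS.scell_mem hbi hch hp hq hz hx hcz hcx (Or.inl hc'))
  have mem : ∀ {y}, y ∈ G.extend S p q z → G.Out y → y ∈ S ∨ y = z := by
    rintro y (h1 | h1 | h1) hy
    · exact Or.inl h1
    · exact Or.inr h1
    · exact absurd hy h1.1
  have nbr : ∀ {y}, y ∈ S ∨ y = z → G.graph.Adj z y → y = r ∨ y = s := by
    rintro y (hy | rfl) hadj
    · have h1 := hS.eq_or_eq hbi hch hp hq hz hx hcz hcx hy hadj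
      rcases hpq with ⟨rfl, rfl⟩ | ⟨rfl, rfl⟩
      · exact h1
      · exact h1.symm
    · exact absurd rfl hadj.ne
  obtain ⟨ou, ov, ow⟩ := hc.out
  have huv := hc.adj hbi hch
  have hvw := (hc.rotate hbi hch).adj hbi hch
  have hwu := ((hc.rotate hbi hch).rotate hbi hch).adj hbi hch
  have hu' := mem hu ou
  have hv' := mem hv ov
  have hw' := mem hw ow
  by_cases hzu : u = z
  · subst hzu
    rcases nbr hv' huv with rfl | rfl <;> rcases nbr hw' hwu.symm with rfl | rfl
    · exact absurd rfl hvw.ne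
    · right; right; right; left
      exact ⟨rfl, rfl, hc.sign_unique hbi hch ((hz'.rotate hbi hch).rotate hbi hch)⟩
    · right; right; right; right
      refine ⟨rfl, rfl, hc.sign_unique hbi hch ?_⟩
      have := (hz'.rotate hbi hch).swap
      rwa [neg_neg] at this
    · exact absurd rfl hvw.ne
  by_cases hzv : v = z
  · subst hzv
    rcases nbr hu' huv.symm with rfl | rfl <;> rcases nbr hw' hvw with rfl | rfl
    · exact absurd rfl hwu.ne
    · right; left
      refine ⟨rfl, rfl, hc.sign_unique hbi hch ?_⟩
      have := hz'.swap' hbi hch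
      rwa [neg_neg] at this
    · right; right; left
      exact ⟨rfl, rfl, hc.sign_unique hbi hch (hz'.rotate hbi hch)⟩
    · exact absurd rfl hwu.ne
  by_cases hzw : w = z
  · subst hzw
    exfalso
    rcases nbr hu' hwu with rfl | rfl <;> rcases nbr hv' hvw.symm with rfl | rfl
    · exact huv.ne rfl
    · exact hrs.1 ⟨rfl, rfl⟩
    · exact hrs.2 ⟨rfl, rfl⟩
    · exact huv.ne rfl
  · left
    exact ⟨⟨hu'.resolve_right hzu, hv'.resolve_right hzv, ⟨w, hw'.resolve_right hzw, hc⟩,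
      c, fun h => hcS (Or.inl h), hc'⟩, hrs⟩

end

end PlaneGraph

/-! ### Attaching a cell at a chord -/

namespace PlaneGraph

variable {V : Type*} {G : PlaneGraph V} [Finite V]

section

variable (hbi : G.Biconnected) (hch : G.InnerChordal)

include hbi hch

/-- The conditions at the ends of a chord are preserved at the end `s` if the new vertices are close
to the neighbour `r` of `s`. -/
theorem exists_nhds_guided {S : Set V} {pos : V → ℂ} {r s : V} (hr : r ∈ S)
    (hsr : G.graph.Adj s r) : ∃ U ∈ 𝓝 (pos r), ∀ τ : ℝ, τ = 1 ∨ τ = -1 →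
      (∀ v, v ≠ r → (G.cone S pos τ s v).Nonempty →
        ∃ D ∈ G.cone S pos τ s v, ∀ t ∈ U, τ * det3 (pos s) D t < 0) ∧
      (∀ v, v ≠ r → G.IsExtreme S pos τ s v → ∀ t ∈ U, 0 < τ * det3 (pos s) (pos v) t) ∧
      (G.IsExtreme S pos τ s r → ∀ t ∈ U, ∀ w ∈ S, G.graph.Adj s w → w ≠ r →
        0 < τ * det3 (pos s) t (pos w)) := by
  have hD : ∀ (τ : ℝ) (v : V), ∃ D, (G.cone S pos τ s v).Nonempty → D ∈ G.cone S pos τ s v := by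
    intro τ v
    by_cases h : (G.cone S pos τ s v).Nonempty
    · exact ⟨h.some, fun _ => h.some_mem⟩
    · exact ⟨0, fun h' => absurd h' h⟩
  choose D hD using hD
  have h1 : ∀ τ : ℝ, ∀ᶠ t in 𝓝 (pos r), ∀ v, v ≠ r → (G.cone S pos τ s v).Nonempty →
      τ * det3 (pos s) (D τ v) t < 0 := by
    intro τ
    simp only [eventually_all]
    intro v hvr hne
    have hc : Continuous fun t => τ * det3 (pos s) (D τ v) t :=
      continuous_const.mul (continuous_det3 _ _)
    exact hc.continuousAt.eventually (gt_mem_nhds ((hD τ v hne).2 r hr hsr hvr.symm))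
  have h2 : ∀ τ : ℝ, ∀ᶠ t in 𝓝 (pos r), ∀ v, v ≠ r → G.IsExtreme S pos τ s v →
      0 < τ * det3 (pos s) (pos v) t := by
    intro τ
    simp only [eventually_all]
    intro v hvr hne
    have hc : Continuous fun t => τ * det3 (pos s) (pos v) t :=
      continuous_const.mul (continuous_det3 _ _)
    exact hc.continuousAt.eventually (lt_mem_nhds (hne r hr hsr hvr.symm))
  have h3 : ∀ τ : ℝ, ∀ᶠ t in 𝓝 (pos r), G.IsExtreme S pos τ s r → ∀ w, w ∈ S → G.graph.Adj s w →
      w ≠ r → 0 < τ * det3 (pos s) t (pos w) := by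
    intro τ
    simp only [eventually_all]
    intro he w hw hadj hne
    have hc : Continuous fun t => τ * det3 (pos s) t (pos w) :=
      continuous_const.mul (continuous_det3_mid _ _)
    exact hc.continuousAt.eventually (lt_mem_nhds (he w hw hadj hne))
  refine ⟨_, (((h1 1).and ((h2 1).and (h3 1))).and ((h1 (-1)).and ((h2 (-1)).and (h3 (-1))))), ?_⟩
  rintro τ (rfl | rfl)
  · exact ⟨fun v hvr hne => ⟨_, hD _ v hne, fun t ht => ht.1.1 v hvr hne⟩,
      fun v hvr he t ht => ht.1.2.1 v hvr he, fun he t ht => ht.1.2.2 he⟩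
  · exact ⟨fun v hvr hne => ⟨_, hD _ v hne, fun t ht => ht.2.1 v hvr hne⟩,
      fun v hvr he t ht => ht.2.2.1 v hvr he, fun he t ht => ht.2.2.2 he⟩

/-- At a boundary chord directed towards `r`, the next cell can be drawn such that the invariants
are preserved. -/
theorem IsGuided.exists_extend {I : V → V → Prop} (hI : G.IsGuide I) {S : Set V} {pos : V → ℂ}
    (hS : G.IsPatch S) (hD : G.IsDrawing S pos) (hG : G.IsGuided I S pos) {σ : ℝ} {r s : V}
    (hb : G.SBdry S σ r s) (hrs : I r s) :
    ∃ (S' : Set V) (pos' : V → ℂ), S ⊂ S' ∧ G.IsPatch S' ∧ G.IsDrawing S' pos' ∧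
      G.IsGuided I S' pos' := by
  obtain ⟨hr, hs, ⟨x, hx, hcx⟩, z, hz, hcz⟩ := id hb
  have hσ := hcx.sign
  obtain ⟨ror, sos, xox⟩ := hcx.out
  have zoz := hcz.out.2.2
  have hadjrs := hcx.adj hbi hch
  have hchord : ∀ {u v τ}, G.SBdry S τ u v → G.IsChord s(u, v) := by
    rintro u v τ ⟨-, -, ⟨w, -, h1⟩, w', -, h2⟩
    exact h1.isChord hbi hch h2
  -- the counterclockwise order of the cell
  obtain ⟨p, q, hpq⟩ : ∃ p q, (σ = -1 ∧ p = r ∧ q = s) ∨ (σ = 1 ∧ p = s ∧ q = r) := by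
    rcases hσ with h | h
    · exact ⟨s, r, Or.inr ⟨h, rfl, rfl⟩⟩
    · exact ⟨r, s, Or.inl ⟨h, rfl, rfl⟩⟩
  have hpq' : (p = r ∧ q = s) ∨ (p = s ∧ q = r) := hpq.imp And.right And.right
  have hcz' : G.Cell p q z := by
    rcases hcz with ⟨h1, h⟩ | ⟨h1, h⟩ <;> rcases hpq with ⟨h2, rfl, rfl⟩ | ⟨h2, rfl, rfl⟩
    · exact h
    · rw [h2] at h1; norm_num at h1
    · rw [h2] at h1; norm_num at h1
    · exact h
  have hcx' : G.Cell q p x := by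
    rcases hcx with ⟨h1, h⟩ | ⟨h1, h⟩ <;> rcases hpq with ⟨h2, rfl, rfl⟩ | ⟨h2, rfl, rfl⟩
    · rw [h2] at h1; norm_num at h1
    · exact h
    · exact h
    · rw [h2] at h1; norm_num at h1
  have hp : p ∈ S := by rcases hpq' with ⟨rfl, rfl⟩ | ⟨rfl, rfl⟩ <;> assumption
  have hq : q ∈ S := by rcases hpq' with ⟨rfl, rfl⟩ | ⟨rfl, rfl⟩ <;> assumption
  have hsin : ∀ {w}, G.InCell w p q z → G.SIn w r s z := by
    intro w hw
    rcases hpq' with ⟨rfl, rfl⟩ | ⟨rfl, rfl⟩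
    · exact Or.inl hw
    · exact Or.inr hw
  obtain ⟨U, hU, hUG⟩ := exists_nhds_guided hbi hch (pos := pos) hr hadjrs.symm
  obtain ⟨pos', hpos, hposU, hposz, hD'⟩ := hD.exists_extend hbi hch hS hr hs hx hz hcx hcz hpq
    (hG.cone σ r s hb hrs) hU
  have hS' := hS.extend hbi hch hp hq hz hx hcz' hcx'
  have hof : ∀ {τ u v}, G.SBdry (G.extend S p q z) τ u v → _ := fun h =>
    SBdry.of_extend hbi hch hS hpq' hp hq hz hx hcz' hcx' hcz h
  set S' := G.extend S p q z with hS'def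
  have hsub : S ⊆ S' := subset_extend S p q z
  have hzS' : z ∈ S' := Or.inr (Or.inl rfl)
  have hin : ∀ {u w}, u ∈ S' → w ∈ S' → G.graph.Adj u w → ¬ (u ∈ S ∧ w ∈ S) →
      G.SIn u r s z ∧ G.SIn w r s z := fun hu hw hadj hn =>
    (hS.inCell_of_adj hbi hch hp hq hz hx hcz' hcx' hu hw hadj hn).imp hsin hsin
  -- the neighbourhoods of the old vertices other than `r` and `s` do not change
  have hold : ∀ {u w}, u ∈ S → u ≠ r → u ≠ s → G.Out u → w ∈ S' → G.graph.Adj u w → w ∈ S := by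
    intro u w hu hur hus huo hw hadj
    by_contra hwS
    rcases (hin (hsub hu) hw hadj fun h => hwS h.2).1.eq_of_out huo with h | h | h
    · exact hur h
    · exact hus h
    · exact hz (h ▸ hu)
  -- the signs at the corners of the new cell
  have hrr : pos' r = pos r := hpos r hr
  have hss : pos' s = pos s := hpos s hs
  have hczr : G.SCell (-σ) s z r := hcz.rotate hbi hch
  have hcrz : G.SCell σ r z s := by
    have := hcz.swap' hbi hch
    rwa [neg_neg] at this
  have hczrs : G.SCell (-σ) z r s := hczr.rotate hbi hch
  have hczsr : G.SCell σ z s r := by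
    have := hczr.swap
    rwa [neg_neg] at this
  have hnew : ∀ w ∈ S', w ∉ S → G.graph.Adj r w → 0 < -σ * det3 (pos r) (pos s) (pos' w) := by
    intro w hw hwS hadj
    rw [← hrr, ← hss]
    refine hD'.sign_pos hbi hch hcz (hsub hr) (hsub hs) hzS'
      (hin (hsub hr) hw hadj fun h => hwS h.2).2 ?_ ?_
    · rintro rfl; exact hwS hr
    · rintro rfl; exact hwS hs
  have hextzr : G.IsExtreme S' pos' (-σ) z r := fun w hw hadj hne =>
    hD'.sign_pos hbi hch hczrs hzS' (hsub hr) (hsub hs)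
      (hin hzS' hw hadj fun h => hz h.1).2.rotate.rotate hadj.ne' hne
  have hextzs : G.IsExtreme S' pos' σ z s := fun w hw hadj hne =>
    hD'.sign_pos hbi hch hczsr hzS' (hsub hs) (hsub hr)
      (hin hzS' hw hadj fun h => hz h.1).2.rotate.swap hadj.ne' hne
  have hboth : ∀ {u w}, G.BothIn S u w → G.BothIn S' u w := by
    rintro u w ⟨h1, h2, ⟨a, h3, h4⟩, b, h5, h6⟩
    exact ⟨hsub h1, hsub h2, ⟨a, hsub h3, h4⟩, b, hsub h5, h6⟩
  have hbrs : G.BothIn S' r s := by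
    refine ⟨hsub hr, hsub hs, ?_⟩
    rcases hcx with ⟨h1, h⟩ | ⟨h1, h⟩ <;> rcases hcz with ⟨h2, h'⟩ | ⟨h2, h'⟩
    · rw [h1] at h2; norm_num at h2
    · exact ⟨⟨x, hsub hx, h⟩, z, hzS', h'⟩
    · exact ⟨⟨z, hzS', h'⟩, x, hsub hx, h⟩
    · rw [h1] at h2; norm_num at h2
  -- the new edge at `s` is extreme if no chord in the region is directed towards `s`
  have hextsz : (∀ w, I s w → ¬ G.BothIn S' s w) → G.IsExtreme S' pos' (-σ) s z := by
    intro hno w hw hadj hne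
    by_cases hwr : w = r
    · rw [hwr]
      exact hD'.sign_pos hbi hch hczr (hsub hs) hzS' (hsub hr) (Or.inl (Or.inr (Or.inr (Or.inl rfl))))
        hadjrs.ne (fun h => hz (h ▸ hr))
    · by_cases hwS : w ∈ S
      · have he := hG.extreme (-σ) s r ⟨hs, hr, ⟨x, hx, hcx.swap⟩, z, hz, hcz.swap⟩
          fun w hw hb => hno w hw (hboth hb)
        have := (hUG (-σ) hcz.sign).2.2 he (pos' z) (hposU z hz) w hwS hadj hwr
        rwa [hss, hpos w hwS]
      · exact hD'.sign_pos hbi hch hczr (hsub hs) hzS' (hsub hr)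
          (hin (hsub hs) hw hadj fun h => hwS h.2).2.rotate hadj.ne' hne
  refine ⟨S', pos', ⟨hsub, fun h => hz (h hzS')⟩, hS', hD', ⟨?_, ?_⟩⟩
  · intro τ u v hb' hI'
    have hb'' := hb'
    obtain ⟨-, -, ⟨y, hy, hcy⟩, -⟩ := hb''
    have hyadj := ((hcy.rotate hbi hch).rotate hbi hch).adj hbi hch
    have hyne := (hcy.rotate hbi hch).adj hbi hch
    have hcone : G.IsExtreme S' pos' τ u v → (G.cone S' pos' τ u v).Nonempty := fun he =>
      he.cone_nonempty hy hyadj.symm hyne.ne'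
    rcases hof hb' with ⟨hb0, hn1, hn2⟩ | ⟨rfl, rfl, rfl⟩ | ⟨rfl, rfl, rfl⟩ | ⟨rfl, rfl, rfl⟩ |
      ⟨rfl, rfl, rfl⟩
    · have hu := hb0.1
      have hv := hb0.2.1
      have hτ : τ = 1 ∨ τ = -1 := hcy.sign
      by_cases hur : u = r
      · -- the second chord directed towards `r` belongs to the same face
        subst hur
        have hvs : v ≠ s := fun h => hn1 ⟨rfl, h⟩
        have vov := (hcy.out).2.1
        have hshare := hI.share u s v hrs hI' hvs.symm
        have hcell : G.SCell 1 u s v ∨ G.SCell (-1) u s v := by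
          rcases hshare with h | h
          · exact Or.inl (Or.inl ⟨rfl, ror, sos, vov, Or.inl h⟩)
          · refine Or.inr (Or.inr ⟨rfl, Cell.rotate hbi hch (Cell.rotate hbi hch ?_)⟩)
            exact ⟨ror, vov, sos, Or.inl h⟩
        have hcell' : G.SCell σ u s v := by
          have hnot : ¬ G.SCell (-σ) u s v := fun h => hz (by rwa [hcz.unique hbi hch h])
          rcases hσ with h1 | h1 <;> rw [h1] at hnot ⊢
          · exact hcell.resolve_right hnot
          · rw [neg_neg] at hnot
            exact hcell.resolve_left hnot
        have hτσ : τ = -σ := by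
          obtain ⟨-, -, -, c, hc, hc'⟩ := hb0
          by_contra hne
          have : τ = σ := by
            rcases hτ with h1 | h1 <;> rcases hσ with h2 | h2 <;> rw [h1, h2] at hne ⊢ <;>
              norm_num at hne
          subst this
          exact hc (by rwa [hc'.unique hbi hch (hcell'.swap' hbi hch)])
        subst hτσ
        have hnb : ∀ w ∈ S, G.graph.Adj u w → w = s ∨ w = v := by
          obtain ⟨-, -, -, c, hc, hc'⟩ := hb0
          rw [neg_neg] at hc'
          intro w hw hadj
          have hnc : ¬ G.Ctr w u s v ∧ ¬ G.Ctr w u v s := by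
            rcases hshare with h | h
            · exact h.not_ctr hbi hch ror sos vov
            · exact (h.not_ctr hbi hch ror vov sos).symm
          rcases hS.corner σ u s v hcell' hr hs hv ⟨z, hz, hcz⟩ ⟨c, hc, hc'⟩ w hw hadj with
            h | h | h | h
          · exact Or.inl h
          · exact Or.inr h
          · exact absurd h hnc.1
          · exact absurd h hnc.2
        have hsv : 0 < σ * det3 (pos u) (pos s) (pos v) :=
          hD.sign_pos hbi hch hcell' hr hs hv (Or.inl (Or.inr (Or.inr (Or.inl rfl))))
            (hcell'.swap' hbi hch |>.adj hbi hch).ne' hvs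
        -- only `s`, `v` and the new vertices are adjacent to `u`: extend the edge `s u` beyond `u`,
        -- slightly turned such that `s` is on the same side as the new vertices
        refine cone_nonempty_of_perturb (2 * pos u - pos s) (2 * pos u - pos v) (Or.inl ?_) ?_
        · rw [hrr, hpos v hv, det3_reflect]
          linarith
        · intro w hw hadj hne
          rw [hrr, det3_reflect, det3_reflect]
          by_cases hwS : w ∈ S
          · obtain rfl := (hnb w hwS hadj).resolve_right hne
            right
            rw [hss, det3_self_right, det3_swap' (pos u) (pos w) (pos v)]
            constructor
            · ring
            · linarith
          · left
            linarith [hnew w hw hwS hadj]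
      by_cases hus : u = s
      · subst hus
        have hvr : v ≠ r := fun h => hn2 ⟨rfl, h⟩
        obtain ⟨D, hDc, hDU⟩ := (hUG τ hτ).1 v hvr (hG.cone τ u v hb0 hI')
        refine ⟨D, ?_, fun w hw hadj hne => ?_⟩
        · rw [hss, hpos v hv]
          exact hDc.1
        · rw [hss]
          by_cases hwS : w ∈ S
          · rw [hpos w hwS]
            exact hDc.2 w hwS hadj hne
          · exact hDU _ (hposU w hwS)
      · obtain ⟨D, hDc⟩ := hG.cone τ u v hb0 hI'
        refine ⟨D, ?_, fun w hw hadj hne => ?_⟩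
        · rw [hpos u hu, hpos v hv]
          exact hDc.1
        · have hwS := hold hu hur hus hcy.out.1 hw hadj
          rw [hpos u hu, hpos w hwS]
          exact hDc.2 w hwS hadj hne
    · -- both the old and the new edge at `r` are directed towards `r`
      have hne : s ≠ v := fun h => hz (h ▸ hs)
      have hnc : ∀ w, ¬ G.Ctr w u s v ∧ ¬ G.Ctr w u v s := fun w => by
        rcases hI.share u s v hrs hI' hne with h | h
        · exact h.not_ctr hbi hch ror sos zoz
        · exact (h.not_ctr hbi hch ror zoz sos).symm
      have he := hG.extreme τ u s hb fun w hw hbw => by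
        rcases hI.eq_or u s v w hrs hI' hw with h | h | h
        · exact hne h
        · subst h
          exact hb.not_bothIn hbi hch hbw
        · subst h
          exact hz hbw.2.1
      have hxs : x ≠ s := ((hcx.rotate hbi hch).adj hbi hch).ne'
      have hux := ((hcx.rotate hbi hch).rotate hbi hch).adj hbi hch
      -- the edge `s u` was extreme: extend it beyond `u`, slightly turned towards `x`, such that
      -- all old neighbours are on one side and the new corner is on the other
      refine cone_nonempty_of_perturb (2 * pos u - pos s) (pos x) (Or.inl ?_) ?_
      · rw [hrr, det3_reflect]
        linarith [hnew v hzS' hz (hcrz.adj hbi hch)]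
      · intro w hw hadj hwv
        have hwS : w ∈ S := by
          by_contra hwS
          rcases (hin (hsub hr) hw hadj fun h => hwS h.2).2 with h | h
          · rcases h with h | h | h | h
            · exact hadj.ne' h
            · exact hwS (h ▸ hs)
            · exact hwv h
            · exact (hnc w).1 h
          · rcases h with h | h | h | h
            · exact hwS (h ▸ hs)
            · exact hadj.ne' h
            · exact hwv h
            · exact (hnc w).2 h.rotate
        rw [hrr, det3_reflect, hpos w hwS]
        by_cases hws : w = s
        · right
          rw [hws, det3_self_right, det3_swap' (pos u) (pos s) (pos x)]
          have := he x hx hux.symm hxs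
          constructor
          · ring
          · linarith
        · left
          linarith [he w hwS hadj hws]
    · refine hcone (hextsz fun w hw hbw => ?_)
      by_cases hwv : w = v
      · subst hwv
        exact hb'.not_bothIn hbi hch hbw
      · obtain ⟨-, hwS', ⟨c, -, hc⟩, -⟩ := id hbw
        have hadj : G.graph.Adj v w := by
          rcases hI.share u v w hI' hw (Ne.symm hwv) with h | h
          · exact h.adj'
          · exact h.adj'.symm
        rcases (hin hzS' hwS' hadj fun h => hz h.1).2.eq_of_out hc.2.1 with h | h | h
        · subst h
          exact (hI.chord w u (hchord hb)).1 hrs hw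
        · exact (hc.adj hbi hch).ne' h
        · exact hwv h
    · exact hcone hextzr
    · exact hcone hextzs
  · intro τ u v hb' hno
    rcases hof hb' with ⟨hb0, hn1, hn2⟩ | ⟨rfl, rfl, rfl⟩ | ⟨rfl, rfl, rfl⟩ | ⟨rfl, rfl, rfl⟩ |
      ⟨rfl, rfl, rfl⟩
    · have hu := hb0.1
      have hv := hb0.2.1
      by_cases hur : u = r
      · subst hur
        exact absurd hbrs (hno s hrs)
      have he := hG.extreme τ u v hb0 fun w hw hbw => hno w hw (hboth hbw)
      obtain ⟨-, -, ⟨y, hy, hcy⟩, -⟩ := hb0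
      intro w hw hadj hne
      rw [hpos u hu, hpos v hv]
      by_cases hwS : w ∈ S
      · rw [hpos w hwS]
        exact he w hwS hadj hne
      · by_cases hus : u = s
        · subst hus
          have hvr : v ≠ r := fun h => hn2 ⟨rfl, h⟩
          exact (hUG τ hcy.sign).2.1 v hvr he _ (hposU w hwS)
        · exact absurd (hold hu hur hus hcy.out.1 hw hadj) hwS
    · exact absurd hbrs (hno s hrs)
    · exact hextsz hno
    · exact hextzr
    · exact hextzs

end

end PlaneGraph

/-! ### A guided drawing of the whole graph -/

namespace PlaneGraph

variable {V : Type*} {G : PlaneGraph V} [Finite V]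

section

variable (hbi : G.Biconnected) (hch : G.InnerChordal)

include hbi hch

omit hch in
/-- An edge of the outer face, directed such that its other face is on the left. -/
theorem exists_tri_out : ∃ a b c, G.Tri a b c ∧ G.Out a ∧ G.Out b := by
  obtain ⟨d, hd⟩ := G.exists_leftFace G.outerFace
  have h1 : G.leftFace d.symm ≠ G.outerFace := fun h => hbi.leftFace_ne_symm d (hd.trans h.symm)
  obtain ⟨c, hc⟩ := exists_tri h1
  exact ⟨_, _, c, hc, ⟨G.facePerm d, G.facePerm_fst d, by rw [leftFace_facePerm, hd]⟩, d, rfl, hd⟩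

/-- A single cell with its centre is drawn by any triangle in the right orientation with a point
inside. -/
theorem Cell.isDrawing {p q z : V} (h : G.Cell p q z) {pos : V → ℂ}
    (hpos : 0 < det3 (pos p) (pos q) (pos z))
    (hm : ∀ m, G.Ctr m p q z → pos m ∈ openTri (pos p) (pos q) (pos z)) :
    G.IsDrawing {v | G.InCell v p q z} pos := by
  have rot : ∀ {a b c : ℂ}, det3 a b c ≠ 0 → det3 b c a ≠ 0 := fun h => by rwa [det3_rotate]
  have swap : ∀ {a b c : ℂ}, det3 a b c ≠ 0 → det3 b a c ≠ 0 := fun h => by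
    rwa [det3_swap, neg_ne_zero]
  have hctr : ∀ {m v w : V}, G.Ctr m p q z → G.InCell v p q z → G.InCell w p q z → m ≠ v → m ≠ w →
      v ≠ w → det3 (pos v) (pos w) (pos m) ≠ 0 := by
    intro m v w hmc hv hw h1 h2 h3
    obtain ⟨e1, e2, e3⟩ := hm m hmc
    rcases hv with rfl | rfl | rfl | hv
    on_goal 4 => exact absurd (hmc.2.1.unique hv.2.1) h1
    all_goals
      rcases hw with rfl | rfl | rfl | hw
      on_goal 4 => exact absurd (hmc.2.1.unique hw.2.1) h2
      all_goals first
        | exact absurd rfl h3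
        | exact e1.ne'
        | exact e2.ne'
        | exact e3.ne'
        | exact swap e1.ne'
        | exact swap e2.ne'
        | exact swap e3.ne'
  have hdet : ∀ u, G.InCell u p q z → ∀ v, G.InCell v p q z → ∀ w, G.InCell w p q z → u ≠ v →
      u ≠ w → v ≠ w → det3 (pos u) (pos v) (pos w) ≠ 0 := by
    intro u hu v hv w hw h1 h2 h3
    by_cases hum : G.Ctr u p q z
    · exact rot (rot (hctr hum hv hw h1 h2 h3))
    by_cases hvm : G.Ctr v p q z
    · exact rot (hctr hvm hw hu h3 h1.symm h2.symm)
    by_cases hwm : G.Ctr w p q z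
    · exact hctr hwm hu hv h2.symm h3.symm h1
    have e : ∀ {x : V}, G.InCell x p q z → ¬ G.Ctr x p q z → x = p ∨ x = q ∨ x = z := by
      rintro x (h | h | h | h) hx
      · exact Or.inl h
      · exact Or.inr (Or.inl h)
      · exact Or.inr (Or.inr h)
      · exact absurd h hx
    rcases e hu hum with rfl | rfl | rfl <;> rcases e hv hvm with rfl | rfl | rfl <;>
      rcases e hw hwm with rfl | rfl | rfl <;> first
        | exact absurd rfl h1
        | exact absurd rfl h2
        | exact absurd rfl h3
        | exact hpos.ne'
        | exact rot hpos.ne'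
        | exact rot (rot hpos.ne')
        | exact swap hpos.ne'
        | exact swap (rot hpos.ne')
        | exact swap (rot (rot hpos.ne'))
  have hcell : ∀ {a b c}, G.CellIn {v | G.InCell v p q z} a b c →
      (a = p ∧ b = q ∧ c = z) ∨ (a = q ∧ b = z ∧ c = p) ∨ (a = z ∧ b = p ∧ c = q) :=
    fun hc => h.eq_or hbi hch hc
  have hin : ∀ {a b c x}, G.CellIn {v | G.InCell v p q z} a b c → G.InCell x p q z →
      G.InCell x a b c := by
    intro a b c x hc hx
    rcases hcell hc with ⟨rfl, rfl, rfl⟩ | ⟨rfl, rfl, rfl⟩ | ⟨rfl, rfl, rfl⟩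
    exacts [hx, hx.rotate, hx.rotate.rotate]
  have hreg : G.region {v | G.InCell v p q z} pos = triHull (pos p) (pos q) (pos z) := by
    ext w
    rw [mem_region]
    constructor
    · rintro ⟨a, b, c, hc, hw⟩
      rcases hcell hc with ⟨rfl, rfl, rfl⟩ | ⟨rfl, rfl, rfl⟩ | ⟨rfl, rfl, rfl⟩
      · exact hw
      · rwa [triHull_rotate] at hw
      · rwa [← triHull_rotate] at hw
    · exact fun hw => ⟨p, q, z, ⟨Or.inl rfl, Or.inr (Or.inl rfl), Or.inr (Or.inr (Or.inl rfl)), h⟩, hw⟩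
  refine ⟨fun u hu v hv huv => ?_, fun u hu v hv w hw => hdet u hu v hv w hw, fun a b c hc => ?_,
    fun m a b c hc hmc => ?_, fun u hu v hv _ a b c hc hn => absurd ⟨hin hc hu, hin hc hv⟩ hn, ?_,
    fun u hu v hv huv hn => absurd (InCell.adj hbi hch h hu hv huv) hn⟩
  · by_contra hne
    obtain ⟨w, hw, huw, hvw⟩ : ∃ w, G.InCell w p q z ∧ u ≠ w ∧ v ≠ w := by
      have h1 := (h.adj hbi hch).ne
      have h2 := (h.adj' hbi hch).ne
      have h3 := (h.adj'' hbi hch).ne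
      by_contra hcon
      push Not at hcon
      have c1 := hcon p (Or.inl rfl)
      have c2 := hcon q (Or.inr (Or.inl rfl))
      have c3 := hcon z (Or.inr (Or.inr (Or.inl rfl)))
      by_cases e1 : u = p
      · by_cases e2 : v = q
        · exact h2 (e2.symm.trans (c3 fun e => h3 (e.symm.trans e1)))
        · exact e2 (c2 fun e => h1 (e1.symm.trans e))
      · have e2 := c1 e1
        by_cases e3 : u = q
        · exact h3 ((c3 fun e => h2 (e3.symm.trans e)).symm.trans e2)
        · exact h1 (e2.symm.trans (c2 e3))
    refine hdet u hu v hv w hw hne huw hvw ?_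
    rw [huv, det3_self_left]
  · rcases hcell hc with ⟨rfl, rfl, rfl⟩ | ⟨rfl, rfl, rfl⟩ | ⟨rfl, rfl, rfl⟩
    · exact hpos
    · rwa [det3_rotate]
    · rwa [← det3_rotate]
  · rcases hcell hc with ⟨rfl, rfl, rfl⟩ | ⟨rfl, rfl, rfl⟩ | ⟨rfl, rfl, rfl⟩
    · exact (hm m hmc).1
    · exact (hm m hmc.rotate.rotate).2.1
    · exact (hm m hmc.rotate).2.2
  · rw [hreg]
    exact isPreconnected_compl_triHull hpos

/-- A drawing of a single cell satisfies the invariants of the construction. -/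
theorem Cell.isGuided {I : V → V → Prop} {p q z : V} (h : G.Cell p q z) {pos : V → ℂ}
    (hD : G.IsDrawing {v | G.InCell v p q z} pos) :
    G.IsGuided I {v | G.InCell v p q z} pos := by
  have hext : ∀ σ u v, G.SBdry {v | G.InCell v p q z} σ u v →
      G.IsExtreme {v | G.InCell v p q z} pos σ u v := by
    rintro σ u v ⟨hu, hv, ⟨y, hy, hcy⟩, -⟩ w hw hadj hne
    refine hD.sign_pos hbi hch hcy hu hv hy ?_ hadj.ne' hne
    have hw' : G.SIn w p q z := Or.inl hw
    rcases hcy with ⟨-, hc⟩ | ⟨-, hc⟩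
    · rcases h.eq_or hbi hch ⟨hu, hv, hy, hc⟩ with ⟨rfl, rfl, rfl⟩ | ⟨rfl, rfl, rfl⟩ | ⟨rfl, rfl, rfl⟩
      exacts [hw', hw'.rotate, hw'.rotate.rotate]
    · refine SIn.swap ?_
      rcases h.eq_or hbi hch ⟨hv, hu, hy, hc⟩ with ⟨rfl, rfl, rfl⟩ | ⟨rfl, rfl, rfl⟩ | ⟨rfl, rfl, rfl⟩
      exacts [hw', hw'.rotate, hw'.rotate.rotate]
  refine ⟨fun σ u v hb _ => ?_, fun σ u v hb _ => hext σ u v hb⟩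
  obtain ⟨-, -, ⟨y, hy, hcy⟩, -⟩ := id hb
  exact (hext σ u v hb).cone_nonempty hy (((hcy.rotate hbi hch).rotate hbi hch).adj hbi hch).symm
    ((hcy.rotate hbi hch).adj hbi hch).ne'

/-- A patch without boundary chords contains all vertices. -/
theorem IsPatch.eq_univ {S : Set V} (hS : G.IsPatch S) {a b c : V} (hc : G.CellIn S a b c)
    (hno : ∀ σ u v, ¬ G.SBdry S σ u v) : S = Set.univ := by
  have hfill : ∀ {u v w : V}, G.Tri u v w → G.Out u → G.Out v → u ∈ S → v ∈ S →
      ∃ c, G.Cell u v c ∧ (w ∈ S ↔ c ∈ S) := by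
    intro u v w h hou hov hu hv
    obtain ⟨c, hc, rfl | hm⟩ := h.exists_cell hbi hch hou hov
    · exact ⟨w, hc, Iff.rfl⟩
    · exact ⟨c, hc, (hS.ctr_mem w u v c hc hm).trans ⟨fun h => h.2.2, fun h => ⟨hu, hv, h⟩⟩⟩
  let A : V → V → Prop := fun u v => ∃ w, G.Tri u v w ∧ u ∈ S ∧ v ∈ S ∧ w ∈ S
  have hA0 : A a b := by
    obtain ⟨ha, hb, hcS, hoa, hob, -, h | ⟨m, h⟩⟩ := id hc
    · exact ⟨c, h, ha, hb, hcS⟩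
    · exact ⟨m, h.2.1, ha, hb, (hS.ctr_mem m a b c hc.2.2.2 h).2 ⟨ha, hb, hcS⟩⟩
  have hall : ∀ {u v w : V}, G.Tri u v w → A u v := by
    intro u v w h
    refine forall_of_closed hbi hch A (fun u v ⟨w, hw, _⟩ => ⟨w, hw⟩) ?_ ?_ hA0 h
    · rintro u v w ⟨w', hw', hu, hv, hwS⟩ h
      obtain rfl := hw'.unique h
      exact ⟨u, h.rotate hbi hch, hv, hwS, hu⟩
    · rintro u v w' ⟨w, hw, hu, hv, hwS⟩ h
      refine ⟨w', h, hv, hu, ?_⟩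
      have hinner : ∀ {u : V}, u ∈ S → ¬ G.Out u → G.graph.Adj u w' → w' ∈ S := by
        intro u hu hou hadj
        obtain ⟨a, b, c, ⟨ha, hb, hc, -⟩, hm⟩ := hS.exists_ctr hbi hch hu hou
        rcases (hm.adj hbi hch).1 hadj with rfl | rfl | rfl <;> assumption
      by_cases hou : G.Out u
      · by_cases hov : G.Out v
        · obtain ⟨c, hc, hcw⟩ := hfill hw hou hov hu hv
          obtain ⟨c', hc', hcw'⟩ := hfill h hov hou hv hu
          rw [hcw']
          by_contra hcS
          exact hno 1 u v ⟨hu, hv, ⟨c, hcw.1 hwS, Or.inl ⟨rfl, hc⟩⟩, c', hcS, Or.inr ⟨rfl, hc'⟩⟩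
        · exact hinner hv hov (h.rotate hbi hch |>.rotate hbi hch).adj.symm
      · exact hinner hu hou (h.rotate hbi hch).adj
  refine Set.eq_univ_of_forall fun v => ?_
  obtain ⟨a, b, h⟩ := hbi.exists_tri v
  obtain ⟨-, -, hv, -⟩ := hall h
  exact hv

/-- A guide leads to a drawing of the whole graph. -/
theorem IsGuide.exists_isDrawing {I : V → V → Prop} (hI : G.IsGuide I) :
    ∃ pos : V → ℂ, G.IsPatch Set.univ ∧ G.IsDrawing Set.univ pos := by
  classical
  let 𝒮 : Set (Set V) := {S | (∃ a b c, G.CellIn S a b c) ∧ G.IsPatch S ∧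
    ∃ pos, G.IsDrawing S pos ∧ G.IsGuided I S pos}
  have hne : 𝒮.Nonempty := by
    obtain ⟨p, q, w, hw, hp, hq⟩ := exists_tri_out hbi
    obtain ⟨z, hz, -⟩ := hw.exists_cell hbi hch hp hq
    let pos : V → ℂ := fun v => if v = p then 0 else if v = q then 1 else if v = z then Complex.I
      else (1 / 3 : ℝ) + (1 / 3 : ℝ) * Complex.I
    have h1 : pos p = 0 := if_pos rfl
    have h2 : pos q = 1 := by simp only [pos, if_neg (hz.adj hbi hch).ne', if_true]
    have h3 : pos z = Complex.I := by
      simp only [pos, if_neg (hz.adj'' hbi hch).ne, if_neg (hz.adj' hbi hch).ne', if_true]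
    have h4 : ∀ m, G.Ctr m p q z → pos m = (1 / 3 : ℝ) + (1 / 3 : ℝ) * Complex.I := by
      intro m hm
      have e1 : m ≠ p := fun h => hm.1 (h ▸ hp)
      have e2 : m ≠ q := fun h => hm.1 (h ▸ hq)
      have e3 : m ≠ z := fun h => hm.1 (h ▸ hz.2.2.1)
      simp only [pos, if_neg e1, if_neg e2, if_neg e3]
    have hD : G.IsDrawing {v | G.InCell v p q z} pos := by
      refine hz.isDrawing hbi hch ?_ fun m hm => ?_
      · rw [h1, h2, h3]
        simp [det3]
      · rw [h1, h2, h3, h4 m hm]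
        refine ⟨?_, ?_, ?_⟩ <;> simp [det3]
        norm_num
    exact ⟨_, ⟨p, q, z, Or.inl rfl, Or.inr (Or.inl rfl), Or.inr (Or.inr (Or.inl rfl)), hz⟩,
      hz.isPatch hbi hch, pos, hD, hz.isGuided hbi hch hD⟩
  obtain ⟨S, ⟨⟨a, b, c, hc⟩, hS, pos, hD, hG⟩, hmax⟩ := (Set.toFinite 𝒮).exists_maximal hne
  have hno : ∀ σ u v, I u v → ¬ G.SBdry S σ u v := by
    intro σ u v hI' hb
    obtain ⟨S', pos', hss, hS', hD', hG'⟩ := hG.exists_extend hbi hch hI hS hD hb hI'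
    have hsub := hss.subset
    exact hss.not_subset (hmax (y := S') ⟨⟨a, b, c, hsub hc.1, hsub hc.2.1, hsub hc.2.2.1, hc.2.2.2⟩,
      hS', pos', hD', hG'⟩ hsub)
  have huniv : S = Set.univ := by
    refine hS.eq_univ hbi hch hc fun σ u v hb => ?_
    by_cases hI' : I u v
    · exact hno σ u v hI' hb
    · obtain ⟨hu, hv, ⟨w, hw, hcw⟩, w', hw', hcw'⟩ := id hb
      have h1 : I v u := by
        by_contra h
        exact hI' ((hI.chord u v (hcw.isChord hbi hch hcw')).2 h)
      exact hno (-σ) v u h1 ⟨hv, hu, ⟨w, hw, hcw.swap⟩, w', hw', hcw'.swap⟩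
  rw [huniv] at hS hD
  exact ⟨pos, hS, hD⟩

end

end PlaneGraph

/-! ### Counterclockwise angles -/

theorem ccwAngle_nonneg (a b : ℂ) : 0 ≤ ccwAngle a b :=
  (toIcoMod_mem_Ico Real.two_pi_pos 0 (Complex.arg (b / a))).1

theorem ccwAngle_lt (a b : ℂ) : ccwAngle a b < 2 * Real.pi := by
  have := (toIcoMod_mem_Ico Real.two_pi_pos 0 (Complex.arg (b / a))).2
  rwa [zero_add] at this

theorem ccwAngle_coe (a b : ℂ) :
    ((ccwAngle a b : ℝ) : Real.Angle) = ((Complex.arg (b / a) : ℝ) : Real.Angle) := by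
  rw [Real.Angle.angle_eq_iff_two_pi_dvd_sub]
  refine ⟨-toIcoDiv Real.two_pi_pos 0 (Complex.arg (b / a)), ?_⟩
  rw [ccwAngle, toIcoMod, zsmul_eq_mul]
  push_cast
  ring

theorem ccwAngle_add {a b c : ℂ} (ha : a ≠ 0) (hb : b ≠ 0) (hc : c ≠ 0) :
    ccwAngle a b + ccwAngle b c = ccwAngle a c ∨
      ccwAngle a b + ccwAngle b c = ccwAngle a c + 2 * Real.pi := by
  have h : ((ccwAngle a b + ccwAngle b c : ℝ) : Real.Angle) = ((ccwAngle a c : ℝ) : Real.Angle) := by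
    rw [Real.Angle.coe_add, ccwAngle_coe, ccwAngle_coe, ccwAngle_coe,
      Complex.arg_div_coe_angle hb ha, Complex.arg_div_coe_angle hc hb,
      Complex.arg_div_coe_angle hc ha]
    abel
  obtain ⟨k, hk⟩ := Real.Angle.angle_eq_iff_two_pi_dvd_sub.1 h
  have h1 := ccwAngle_nonneg a b
  have h2 := ccwAngle_nonneg b c
  have h3 := ccwAngle_nonneg a c
  have h4 := ccwAngle_lt a b
  have h5 := ccwAngle_lt b c
  have h6 := ccwAngle_lt a c
  have hpi := Real.pi_pos
  have hk1 : (-1 : ℝ) < k := by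
    by_contra hcon
    push Not at hcon
    nlinarith
  have hk2 : (k : ℝ) < 2 := by
    by_contra hcon
    push Not at hcon
    nlinarith
  have hk1' : (-1 : ℤ) < k := by exact_mod_cast hk1
  have hk2' : k < (2 : ℤ) := by exact_mod_cast hk2
  obtain rfl | rfl : k = 0 ∨ k = 1 := by omega
  · left
    push_cast at hk
    linarith
  · right
    push_cast at hk
    linarith

theorem sin_ccwAngle (u v w : ℂ) (huv : v ≠ u) :
    ∃ r : ℝ, 0 < r ∧ det3 u v w = r * Real.sin (ccwAngle (v - u) (w - u)) := by
  have h1 : Real.sin (ccwAngle (v - u) (w - u)) = Real.sin (Complex.arg ((w - u) / (v - u))) := by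
    rw [← Real.Angle.sin_coe, ccwAngle_coe, Real.Angle.sin_coe]
  rw [h1, Complex.sin_arg]
  have hn : 0 < Complex.normSq (v - u) := Complex.normSq_pos.2 (sub_ne_zero.2 huv)
  have h2 : ((w - u) / (v - u)).im * Complex.normSq (v - u) = det3 u v w := by
    rw [Complex.div_im]
    field_simp
    simp only [det3, Complex.sub_re, Complex.sub_im]
    ring
  by_cases hw : w = u
  · refine ⟨1, one_pos, ?_⟩
    subst hw
    simp
  · have h3 : 0 < ‖(w - u) / (v - u)‖ :=
      norm_pos_iff.2 (div_ne_zero (sub_ne_zero.2 hw) (sub_ne_zero.2 huv))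
    refine ⟨Complex.normSq (v - u) * ‖(w - u) / (v - u)‖, by positivity, ?_⟩
    rw [← h2]
    field_simp

theorem det3_eq_zero_of_ccwAngle {u v w : ℂ} (huv : v ≠ u) (h : ccwAngle (v - u) (w - u) = 0) :
    det3 u v w = 0 := by
  obtain ⟨r, -, hr⟩ := sin_ccwAngle u v w huv
  rw [hr, h, Real.sin_zero, mul_zero]

/-- A direction that is not in the angle between two directions comes after both of them in the
counterclockwise order. -/
theorem ccwAngle_le {u v x w : ℂ} (hv : v ≠ u) (hx : x ≠ u) (hw : w ≠ u) (hvx : 0 < det3 u v x)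
    (hvw : det3 u v w ≠ 0) (h : ¬ (0 < det3 u v w ∧ 0 < det3 u w x)) :
    ccwAngle (v - u) (x - u) ≤ ccwAngle (v - u) (w - u) := by
  by_contra hcon
  push Not at hcon
  have hpi := Real.pi_pos
  have hα : ccwAngle (v - u) (x - u) < Real.pi := by
    obtain ⟨r, hr, he⟩ := sin_ccwAngle u v x hv
    by_contra hcon
    push Not at hcon
    have h1 : Real.sin (ccwAngle (v - u) (x - u)) ≤ 0 := by
      have := Real.sin_nonneg_of_nonneg_of_le_pi (x := ccwAngle (v - u) (x - u) - Real.pi)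
        (by linarith) (by linarith [ccwAngle_lt (v - u) (x - u)])
      rw [Real.sin_sub_pi] at this
      linarith
    have := mul_nonpos_of_nonneg_of_nonpos hr.le h1
    linarith
  have h0 := ccwAngle_nonneg (v - u) (w - u)
  have hβ : 0 < ccwAngle (v - u) (w - u) :=
    lt_of_le_of_ne h0 fun he => hvw (det3_eq_zero_of_ccwAngle hv he.symm)
  apply h
  constructor
  · obtain ⟨r, hr, he⟩ := sin_ccwAngle u v w hv
    rw [he]
    exact mul_pos hr (Real.sin_pos_of_pos_of_lt_pi hβ (by linarith))
  · obtain ⟨r, hr, he⟩ := sin_ccwAngle u w x hw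
    rw [he]
    have hlt := ccwAngle_lt (w - u) (x - u)
    rcases ccwAngle_add (sub_ne_zero.2 hv) (sub_ne_zero.2 hw) (sub_ne_zero.2 hx) with h1 | h1
    · exact mul_pos hr (Real.sin_pos_of_pos_of_lt_pi (by linarith) (by linarith))
    · have := ccwAngle_nonneg (v - u) (x - u)
      linarith

/-! ### The drawing realizes the embedding -/

namespace PlaneGraph

variable {V : Type*} {G : PlaneGraph V} [Finite V]

section

variable (hbi : G.Biconnected) (hch : G.InnerChordal) {pos : V → ℂ}
  (hS : G.IsPatch Set.univ) (hD : G.IsDrawing Set.univ pos)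

include hbi hch hS hD

theorem IsDrawing.range_subset : drawnSet G.graph pos ⊆ G.region Set.univ pos := by
  rintro p (⟨v, rfl⟩ | hp)
  · obtain ⟨w, -, hadj⟩ := hS.exists_adj v trivial
    exact hD.segment_subset_region hbi hch hS (Set.mem_univ _) (Set.mem_univ _) hadj
      (left_mem_segment ℝ _ _)
  · obtain ⟨d, hd⟩ := Set.mem_iUnion.1 hp
    exact hD.segment_subset_region hbi hch hS (Set.mem_univ _) (Set.mem_univ _) d.adj hd

/-- The outer face of the drawing is the complement of the cells. -/
theorem IsDrawing.drawnOuterFace_eq : drawnOuterFace G.graph pos = (G.region Set.univ pos)ᶜ := by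
  ext p
  constructor
  · intro hp hp'
    obtain ⟨a, b, c, hc, hpc⟩ := mem_region.1 hp'
    have h := hc.2.2.2
    exact disjoint_drawnOuterFace (h.adj hbi hch) (h.adj' hbi hch) (h.adj'' hbi hch)
      (hD.cell_pos a b c hc).ne' hpc hp
  · intro hp
    have hsub := hD.range_subset hbi hch hS
    refine ⟨fun h => hp (hsub h), fun hb => ?_⟩
    have h1 : (G.region Set.univ pos)ᶜ ⊆ connectedComponentIn (drawnSet G.graph pos)ᶜ p :=
      hD.conn.subset_connectedComponentIn hp (Set.compl_subset_compl.2 hsub)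
    have h2 := (isCompact_region (G := G) Set.univ pos).isBounded.union (hb.subset h1)
    rw [Set.union_compl_self] at h2
    exact NormedSpace.unbounded_univ ℝ ℂ h2

theorem IsDrawing.isPlaneOutsideObstacleRep : IsPlaneOutsideObstacleRep G.graph pos := by
  refine ⟨⟨fun u v h => hD.inj u trivial v trivial h, fun u v w h1 h2 h3 => ?_,
    fun u v huv hn => ?_⟩, fun a b c d hab hcd hne p hp => ?_⟩
  · rw [collinear_iff_det3]
    exact hD.det3_ne u trivial v trivial w trivial h1 h2 h3
  · rw [hD.drawnOuterFace_eq hbi hch hS]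
    obtain ⟨p, hp, hp'⟩ := hD.nonedge u trivial v trivial huv hn
    exact ⟨p, hp, hp'⟩
  · obtain ⟨w, h1, h2, h3⟩ := hD.crossing_free hbi hch hS (Set.mem_univ _) (Set.mem_univ _)
      (Set.mem_univ _) (Set.mem_univ _) hab hcd (fun h => hne (Sym2.eq_iff.2 h)) hp.1 hp.2
    exact ⟨w, ⟨h1, h2⟩, h3.symm⟩

/-- The inner triangles are drawn counterclockwise. -/
theorem IsDrawing.tri_pos {a b c : V} (h : G.Tri a b c) : 0 < det3 (pos a) (pos b) (pos c) := by
  have key : ∀ {a b c : V}, G.Tri a b c → ¬ G.Out c → 0 < det3 (pos a) (pos b) (pos c) := by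
    intro a b c h hc
    obtain ⟨a', b', c', hcell, hm⟩ := hS.exists_ctr hbi hch (Set.mem_univ c) hc
    have hr := hcell.rotate hbi hch
    have h' := (h.rotate hbi hch).rotate hbi hch
    have fin : ∀ {a' b' c'}, G.CellIn Set.univ a' b' c' → G.Ctr c a' b' c' → a = a' →
        0 < det3 (pos a) (pos b) (pos c) := by
      rintro a' b' c' hcell hm rfl
      rw [h'.unique ((hm.2.1.rotate hbi hch).rotate hbi hch)]
      exact hD.ctr_pos c _ _ _ hcell hm
    rcases (hm.adj hbi hch).1 h'.adj with h1 | h1 | h1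
    · exact fin hcell hm h1
    · exact fin hr hm.rotate h1
    · exact fin (hr.rotate hbi hch) hm.rotate.rotate h1
  by_cases hc : G.Out c
  · by_cases hb : G.Out b
    · by_cases ha : G.Out a
      · exact hD.cell_pos a b c ⟨trivial, trivial, trivial, ha, hb, hc, Or.inl h⟩
      · rw [← det3_rotate]
        exact key (h.rotate hbi hch) ha
    · rw [← det3_rotate, ← det3_rotate]
      exact key ((h.rotate hbi hch).rotate hbi hch) hb
  · exact key h hc

/-- The drawn inner triangles contain no further vertices. -/
theorem IsDrawing.eq_of_mem_triHull {a b c w : V} (h : G.Tri a b c)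
    (hw : pos w ∈ triHull (pos a) (pos b) (pos c)) : w = a ∨ w = b ∨ w = c := by
  have key : ∀ {a b c : V}, G.Tri a b c → ¬ G.Out c → pos w ∈ triHull (pos a) (pos b) (pos c) →
      w = a ∨ w = b ∨ w = c := by
    intro a b c h hc hw
    obtain ⟨a', b', c', hcell, hm⟩ := hS.exists_ctr hbi hch (Set.mem_univ c) hc
    have hr := hcell.rotate hbi hch
    have h' := (h.rotate hbi hch).rotate hbi hch
    have fin : ∀ {a' b' c'}, G.CellIn Set.univ a' b' c' → G.Ctr c a' b' c' → a = a' →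
        w = a ∨ w = b ∨ w = c := by
      rintro a' b' c' hcell hm rfl
      obtain rfl := h'.unique ((hm.2.1.rotate hbi hch).rotate hbi hch)
      have hsub : triHull (pos a) (pos b) (pos c) ⊆ triHull (pos a) (pos b) (pos c') :=
        triHull_subset (convex_triHull _ _ _) (left_mem_triHull _ _ _) (mid_mem_triHull _ _ _)
          (hD.mem_triHull_of_inCell hbi hch hcell (Or.inr (Or.inr (Or.inr hm))))
      rcases hD.inCell_of_mem_triHull hbi hch hS hcell (Set.mem_univ w) (hsub hw) with
        h1 | h1 | rfl | h1
      · exact Or.inl h1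
      · exact Or.inr (Or.inl h1)
      · -- the third corner of the cell is beyond the centre
        have h1 := ((mem_triHull_iff (hD.ctr_pos c _ _ _ hcell hm) _).1 hw).2.1
        have h2 := (hD.ctr_mem_openTri hbi hch hcell hm).2.1
        rw [det3_swap'] at h1
        linarith
      · exact Or.inr (Or.inr (h1.2.1.unique hm.2.1))
    rcases (hm.adj hbi hch).1 h'.adj with h1 | h1 | h1
    · exact fin hcell hm h1
    · exact fin hr hm.rotate h1
    · exact fin (hr.rotate hbi hch) hm.rotate.rotate h1
  by_cases hc : G.Out c
  · by_cases hb : G.Out b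
    · by_cases ha : G.Out a
      · have hcell : G.CellIn Set.univ a b c :=
          ⟨trivial, trivial, trivial, ha, hb, hc, Or.inl h⟩
        rcases hD.inCell_of_mem_triHull hbi hch hS hcell (Set.mem_univ w) hw with h1 | h1 | h1 | h1
        · exact Or.inl h1
        · exact Or.inr (Or.inl h1)
        · exact Or.inr (Or.inr h1)
        · exact absurd h1 (h.not_ctr hbi hch ha hb hc).1
      · rw [← triHull_rotate] at hw
        rcases key (h.rotate hbi hch) ha hw with h1 | h1 | h1
        exacts [Or.inr (Or.inl h1), Or.inr (Or.inr h1), Or.inl h1]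
    · rw [← triHull_rotate, ← triHull_rotate] at hw
      rcases key ((h.rotate hbi hch).rotate hbi hch) hb hw with h1 | h1 | h1
      exacts [Or.inr (Or.inr h1), Or.inl h1, Or.inr (Or.inl h1)]
  · exact key h hc hw

/-- At a dart `d` with an inner face on its left, no other edge is drawn in the angle between `d` and
`rot d`: its end would lie in the drawn inner triangle. -/
theorem IsDrawing.ccwAngle_le_of_inner {d e : G.graph.Dart} (hd : G.leftFace d ≠ G.outerFace)
    (he : e.fst = d.fst) (hne : e ≠ d) :
    ccwAngle (pos d.snd - pos d.fst) (pos (G.rot d).snd - pos d.fst) ≤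
      ccwAngle (pos d.snd - pos d.fst) (pos e.snd - pos d.fst) := by
  obtain ⟨x, hx⟩ := exists_tri hd
  rw [hx.rot_eq hbi hch rfl rfl]
  by_cases hex : e.snd = x
  · rw [hex]
  have hed : e.snd ≠ d.snd := fun h => hne (dart_ext he h)
  have hadj : G.graph.Adj d.fst e.snd := he ▸ e.adj
  obtain ⟨n1, n2, n3⟩ := hx.ne hbi hch
  have hrep := hD.isPlaneOutsideObstacleRep hbi hch hS
  have hpne : ∀ {v : V}, v ≠ d.fst → pos v ≠ pos d.fst := fun h h' => h (hrep.1.injective h')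
  have hpos := hD.tri_pos hbi hch hS hx
  refine ccwAngle_le (hpne n1.symm) (hpne n3) (hpne hadj.ne') hpos
    (hD.det3_ne _ trivial _ trivial _ trivial n1 hadj.ne hed.symm) fun h => ?_
  have hmem := hrep.mem_triHull d.adj hx.adj' (hx.rotate hbi hch).adj' hadj hed hex
    ⟨mul_pos hpos h.1, mul_pos hpos h.2⟩
  rcases hD.eq_of_mem_triHull hbi hch hS hx hmem with h1 | h1 | h1
  · exact hadj.ne' h1
  · exact hed h1
  · exact hex h1

/-- The rotation at every vertex is the counterclockwise order in the drawing. At the dart `d` with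
the outer face on its left this follows from the statement for the inner faces: if the first dart
`e` after `d` were not `rot d`, then `d` would lie between `rot⁻¹ e` and `e`. -/
theorem IsDrawing.ccwAngle_rot_le (d e : G.graph.Dart) (he : e.fst = d.fst) (hne : e ≠ d) :
    ccwAngle (pos d.snd - pos d.fst) (pos (G.rot d).snd - pos (G.rot d).fst) ≤
      ccwAngle (pos d.snd - pos d.fst) (pos e.snd - pos e.fst) := by
  rw [G.rot_fst, he]
  by_cases hd : G.leftFace d = G.outerFace
  swap
  · exact hD.ccwAngle_le_of_inner hbi hch hS hd he hne
  have hrep := hD.isPlaneOutsideObstacleRep hbi hch hS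
  have hzero : ∀ f g : G.graph.Dart, f.fst = d.fst → g.fst = d.fst → f ≠ g →
      ccwAngle (pos f.snd - pos d.fst) (pos g.snd - pos d.fst) ≠ 0 := by
    intro f g hf hg hfg h
    have n1 : d.fst ≠ f.snd := fun h => f.adj.ne (hf.trans h)
    have n2 : d.fst ≠ g.snd := fun h => g.adj.ne (hg.trans h)
    have n3 : f.snd ≠ g.snd := fun h => hfg (dart_ext (hf.trans hg.symm) h)
    exact hD.det3_ne _ trivial _ trivial _ trivial n1 n2 n3
      (det3_eq_zero_of_ccwAngle (fun h => n1 (hrep.1.injective h).symm) h)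
  have hsub : ∀ f : G.graph.Dart, f.fst = d.fst → pos f.snd - pos d.fst ≠ 0 := by
    intro f hf h
    exact f.adj.ne (hf.trans (hrep.1.injective (sub_eq_zero.1 h)).symm)
  obtain ⟨f, ⟨hf, hfd⟩, hmin⟩ := Set.exists_min_image {f : G.graph.Dart | f.fst = d.fst ∧ f ≠ d}
    (fun f => ccwAngle (pos d.snd - pos d.fst) (pos f.snd - pos d.fst)) (Set.toFinite _)
    ⟨e, he, hne⟩
  suffices hf' : f = G.rot d by
    rw [← hf']
    exact hmin e ⟨he, hne⟩
  by_contra hfr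
  set g := G.rot⁻¹ f with hg
  have hfg : G.rot g = f := G.rot_rot_inv f
  have hgfst : g.fst = d.fst := by rw [← hf, ← hfg, G.rot_fst]
  have hgd : g ≠ d := fun h => hfr (by rw [← hfg, h])
  have hgin : G.leftFace g ≠ G.outerFace := fun h =>
    hgd (hbi.eq_of_leftFace_eq hgfst (h.trans hd.symm))
  have h1 := hD.ccwAngle_le_of_inner hbi hch hS hgin hgfst.symm (Ne.symm hgd)
  rw [hfg, hgfst] at h1
  have h2 := hmin g ⟨hgfst, hgd⟩
  have hpi := Real.pi_pos
  have hgf : g ≠ f := fun h => hbi.rot_ne g (hfg.trans h.symm)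
  have p1 := lt_of_le_of_ne (ccwAngle_nonneg _ _) (hzero d f rfl hf hfd.symm).symm
  have p2 := lt_of_le_of_ne (ccwAngle_nonneg _ _) (hzero g f hgfst hf hgf).symm
  have p3 := lt_of_le_of_ne (ccwAngle_nonneg _ _) (hzero d g rfl hgfst hgd.symm).symm
  have p4 := lt_of_le_of_ne (ccwAngle_nonneg _ _) (hzero g d hgfst rfl hgd).symm
  have hdd : ccwAngle (pos d.snd - pos d.fst) (pos d.snd - pos d.fst) = 0 := by
    rw [ccwAngle, div_self (hsub d rfl), Complex.arg_one]
    simp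
  have q1 := ccwAngle_add (hsub d rfl) (hsub g hgfst) (hsub d rfl)
  have q2 := ccwAngle_add (hsub d rfl) (hsub g hgfst) (hsub f hf)
  rw [hdd] at q1
  have := ccwAngle_lt (pos d.snd - pos d.fst) (pos f.snd - pos d.fst)
  rcases q1 with q1 | q1 <;> rcases q2 with q2 | q2 <;> linarith

/-- A drawing of the whole graph realizes the embedding. The outer face of the drawing is the
complement of the cells, and a point slightly to the left of an edge is in the triangle on this side,
if there is one. -/
theorem IsDrawing.isRealizedBy : G.IsRealizedBy pos := by
  refine ⟨hD.ccwAngle_rot_le hbi hch hS, fun d => ?_⟩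
  rw [hD.drawnOuterFace_eq hbi hch hS]
  let M : ℂ := (pos d.fst + pos d.snd) / 2
  let γ : ℝ → ℂ := fun ε => M + (ε : ℂ) * Complex.I * (pos d.snd - pos d.fst)
  change _ ↔ ∀ᶠ ε : ℝ in 𝓝[>] 0, γ ε ∈ (G.region Set.univ pos)ᶜ
  have hrep := hD.isPlaneOutsideObstacleRep hbi hch hS
  have hne : pos d.fst ≠ pos d.snd := fun h => d.adj.ne (hrep.1.injective h)
  have hM : M = (1 / 2 : ℝ) • pos d.fst + (1 / 2 : ℝ) • pos d.snd := by
    simp only [M, Complex.real_smul]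
    push_cast
    ring
  have hγ : Tendsto γ (𝓝[>] 0) (𝓝 M) := by
    have hc : Continuous γ := by fun_prop
    have := hc.tendsto 0
    simp only [γ, Complex.ofReal_zero, zero_mul, add_zero] at this
    exact this.mono_left nhdsWithin_le_nhds
  have hdet : ∀ ε, det3 (pos d.fst) (pos d.snd) (γ ε) =
      ε * Complex.normSq (pos d.snd - pos d.fst) := by
    intro ε
    simp only [γ, M, det3, Complex.normSq_apply, Complex.add_re, Complex.add_im, Complex.mul_re,
      Complex.mul_im, Complex.I_re, Complex.I_im, Complex.sub_re, Complex.sub_im, Complex.ofReal_re,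
      Complex.ofReal_im, Complex.div_ofNat_re, Complex.div_ofNat_im]
    ring
  have hn : 0 < Complex.normSq (pos d.snd - pos d.fst) :=
    Complex.normSq_pos.2 (sub_ne_zero.2 hne.symm)
  have hdpos : ∀ᶠ ε in 𝓝[>] 0, 0 < det3 (pos d.fst) (pos d.snd) (γ ε) := by
    filter_upwards [self_mem_nhdsWithin] with ε hε
    rw [hdet]
    exact mul_pos hε hn
  constructor
  · intro hd
    have hcell : ∀ t : V × V × V, ∀ᶠ ε in 𝓝[>] 0, G.CellIn Set.univ t.1 t.2.1 t.2.2 →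
        γ ε ∉ triHull (pos t.1) (pos t.2.1) (pos t.2.2) := by
      rintro ⟨a, b, c⟩
      by_cases hc : G.CellIn Set.univ a b c
      swap
      · exact Eventually.of_forall fun _ h => absurd h hc
      by_cases hMt : M ∈ triHull (pos a) (pos b) (pos c)
      swap
      · exact (hγ.eventually ((isClosed_triHull _ _ _).isOpen_compl.mem_nhds hMt)).mono
          fun _ h _ => h
      have hin : G.InCell d.fst a b c ∧ G.InCell d.snd a b c := by
        by_contra hn
        obtain ⟨x, hx, -, hMx⟩ := hD.meet d.fst trivial d.snd trivial d.adj a b c hc hn M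
          ⟨1 / 2, 1 / 2, by norm_num, by norm_num, by norm_num, hM.symm⟩ hMt
        rcases hx with rfl | rfl
        · exact hne (by simp only [M] at hMx; linear_combination -2 * hMx)
        · exact hne (by simp only [M] at hMx; linear_combination 2 * hMx)
      have ho1 : G.Out d.fst := ⟨d, rfl, hd⟩
      have ho2 : G.Out d.snd := ⟨G.facePerm d, G.facePerm_fst d, by rw [leftFace_facePerm, hd]⟩
      -- the dart is a side of the cell, and it has the cell on its right
      have hright : ∀ {a b c}, G.CellIn Set.univ a b c → d.fst = b → d.snd = a →
          ∀ᶠ ε in 𝓝[>] 0, γ ε ∉ triHull (pos a) (pos b) (pos c) := by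
        rintro a b c hc rfl rfl
        filter_upwards [hdpos] with ε hε hmem
        have h1 := ((mem_triHull_iff (hD.cell_pos _ _ _ hc) _).1 hmem).1
        rw [det3_swap] at h1
        linarith
      have hleft : ∀ {a b c}, G.CellIn Set.univ a b c → d.fst = a → d.snd = b → False := by
        rintro a b c ⟨-, -, -, -, -, -, h | ⟨m, h⟩⟩ h1 h2
        · exact h.leftFace_ne h1 h2 hd
        · exact h.2.1.leftFace_ne h1 h2 hd
      have hr := hc.rotate hbi hch
      have hrr := hr.rotate hbi hch
      suffices h : ∀ᶠ ε in 𝓝[>] 0, γ ε ∉ triHull (pos a) (pos b) (pos c) from h.mono fun _ h _ => h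
      rcases hin.1.eq_of_out ho1 with h1 | h1 | h1 <;> rcases hin.2.eq_of_out ho2 with h2 | h2 | h2
      · exact absurd (h1.trans h2.symm) d.adj.ne
      · exact (hleft hc h1 h2).elim
      · rw [← triHull_rotate, ← triHull_rotate]
        exact hright hrr h1 h2
      · exact hright hc h1 h2
      · exact absurd (h1.trans h2.symm) d.adj.ne
      · exact (hleft hr h1 h2).elim
      · exact (hleft hrr h1 h2).elim
      · rw [← triHull_rotate]
        exact hright hr h1 h2
      · exact absurd (h1.trans h2.symm) d.adj.ne
    filter_upwards [eventually_all.2 hcell] with ε hε hmem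
    obtain ⟨a, b, c, hc, hp⟩ := mem_region.1 hmem
    exact hε (a, b, c) hc hp
  · intro hev
    by_contra hd
    obtain ⟨x, hx⟩ := exists_tri hd
    have hpos := hD.tri_pos hbi hch hS hx
    have hM1 : 0 < det3 (pos d.snd) (pos x) M := by
      rw [hM, det3_combo _ _ _ _ (by norm_num), det3_self_mid, det3_rotate]
      linarith
    have hM2 : 0 < det3 (pos x) (pos d.fst) M := by
      rw [hM, det3_combo _ _ _ _ (by norm_num), det3_self_right, ← det3_rotate]
      linarith
    have e1 := hγ.eventually (((continuous_det3 _ _).continuousAt).eventually (lt_mem_nhds hM1))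
    have e2 := hγ.eventually (((continuous_det3 _ _).continuousAt).eventually (lt_mem_nhds hM2))
    obtain ⟨ε, h0, h1, h2, h3⟩ := (hev.and (hdpos.and (e1.and e2))).exists
    rw [← hD.drawnOuterFace_eq hbi hch hS] at h0
    exact disjoint_drawnOuterFace hx.adj hx.adj' (hx.rotate hbi hch).adj' hpos.ne'
      (openTri_subset_triHull _ _ _ ⟨h1, h2, h3⟩) h0

end

/-- The arcs of an outside-obstacle orientation are a guide. -/
theorem IsOutsideObstacleOrientation.isGuide (hbi : G.Biconnected) (hch : G.InnerChordal)
    {A : Set G.graph.Dart} (h : G.IsOutsideObstacleOrientation A) :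
    G.IsGuide fun u v => ∃ d ∈ A, d.fst = v ∧ d.snd = u := by
  obtain ⟨⟨hA1, hA2⟩, hA3, hA4⟩ := h
  refine ⟨fun u v huv => ?_, ?_, ?_⟩
  · have hadj : G.graph.Adj u v := huv.1
    have h1 := hA2 ⟨(v, u), hadj.symm⟩ (by
      have e : (⟨(v, u), hadj.symm⟩ : G.graph.Dart).edge = s(u, v) := Sym2.eq_swap
      rwa [e])
    constructor
    · rintro ⟨d, hd, rfl, rfl⟩ ⟨e, he, he1, he2⟩
      have he' : e = SimpleGraph.Dart.symm ⟨(d.fst, d.snd), hadj.symm⟩ := dart_ext he1 he2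
      exact h1.1 hd (he' ▸ he)
    · intro hn
      refine ⟨_, h1.2 fun hs => hn ⟨_, hs, rfl, rfl⟩, rfl, rfl⟩
  · rintro u v w ⟨d, hd, rfl, rfl⟩ ⟨e, he, rfl, heu⟩ hne
    have hde : d ≠ e := fun h => hne (by rw [h])
    have hc2 : (G.incoming A d.snd).ncard = 2 := by
      refine le_antisymm (hA3 _) ?_
      rw [← Set.ncard_pair hde]
      refine Set.ncard_le_ncard ?_ (Set.toFinite _)
      rintro _ (rfl | rfl)
      exacts [⟨hd, rfl⟩, ⟨he, heu⟩]
    obtain ⟨f, hf1, hf2⟩ := hA4 _ hc2 d ⟨hd, rfl⟩ e ⟨he, heu⟩ hde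
    have e1 : d.edge = s(d.snd, d.fst) := Sym2.eq_swap
    have e2 : e.edge = s(d.snd, e.fst) := by rw [← heu]; exact Sym2.eq_swap
    have c1 := hA1 d hd
    have c2 := hA1 e he
    rw [e1] at c1 hf1
    rw [e2] at c2 hf2
    exact tri_or_of_share_face hbi hch hne c1 c2 hf1 hf2
  · rintro u v w x ⟨d, hd, rfl, hdu⟩ ⟨e, he, rfl, heu⟩ ⟨f, hf, rfl, hfu⟩
    by_contra hcon
    push Not at hcon
    have h3 : 2 < (G.incoming A u).ncard :=
      (Set.two_lt_ncard (Set.toFinite _)).2 ⟨d, ⟨hd, hdu⟩, e, ⟨he, heu⟩, f, ⟨hf, hfu⟩,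
        fun h => hcon.1 (by rw [h]), fun h => hcon.2.1 (by rw [h]), fun h => hcon.2.2 (by rw [h])⟩
    have := hA3 u
    omega

/-- An orientation gives a representation that realizes the embedding. -/
theorem exists_rep_of_orientation (hbi : G.Biconnected) (hch : G.InnerChordal)
    {A : Set G.graph.Dart} (h : G.IsOutsideObstacleOrientation A) :
    ∃ pos : V → ℂ, IsPlaneOutsideObstacleRep G.graph pos ∧ G.IsRealizedBy pos := by
  obtain ⟨pos, hS, hD⟩ := (IsOutsideObstacleOrientation.isGuide hbi hch h).exists_isDrawing hbi hch
  exact ⟨pos, hD.isPlaneOutsideObstacleRep hbi hch hS, hD.isRealizedBy hbi hch hS⟩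

end PlaneGraph

theorem mainTheorem1 {V : Type*} [Finite V] (G : PlaneGraph V)
    (hbi : G.Biconnected) (hch : G.InnerChordal) :
    ((∃ pos : V → ℂ, IsPlaneOutsideObstacleRep G.graph pos) ↔
      ∃ A : Set G.graph.Dart, G.IsOutsideObstacleOrientation A) ∧
    ((∃ pos : V → ℂ, IsPlaneOutsideObstacleRep G.graph pos ∧ G.IsRealizedBy pos) ↔
      ∃ A : Set G.graph.Dart, G.IsOutsideObstacleOrientation A) := by
  refine ⟨⟨fun ⟨pos, h⟩ => PlaneGraph.exists_orientation_of_rep hbi hch h, fun ⟨A, hA⟩ => ?_⟩,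
    ⟨fun ⟨pos, h, _⟩ => PlaneGraph.exists_orientation_of_rep hbi hch h, fun ⟨A, hA⟩ => ?_⟩⟩
  · obtain ⟨pos, h, -⟩ := PlaneGraph.exists_rep_of_orientation hbi hch hA
    exact ⟨pos, h⟩
  · exact PlaneGraph.exists_rep_of_orientation hbi hch hA
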